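/- **Conventions.** A Turing machine is a deterministic multi-tape machine, given by a finite list of quintuples, with two-way infinite tapes over $\{\text{blank},0,1\}$, its input on the first tape and its output on the last one. Every machine has a description as a binary word. For a fixed number of tapes, $M_1,M_2,\dots$ is the enumeration of the Turing machines with that number of tapes in the order of descriptions: $M_i$ is the machine described by the $i$-th binary word, ordered by length and then lexicographically (a word that describes no machine stands for the machine without quintuples, which halts at once). A function $T:\mathbb N\to\mathbb N$ is time-constructible if $T(n)\ge n$ and some Turing machine computes $T(n)$ in binary from $1^n$ in $O(T(n))$ steps. A classification domain $\mathcal X\times\mathcal Y$ consists of measurable spaces $\mathcal X,\mathcal Y$ with measurable binary codes of fixed widths for points and labels, where distinct labels have distinct codes; machines see samples through these codes. A learner outputs an encoded predictor $1^e0a$, which stands for the machine $M_e$ with the word $a$ hard-wired: on the point $x$ it answers what $M_e$ outputs on the code of $x$ followed by $a$. Learning on $n$ samples with time bound $T$, every predictor $f$ is run for at most $T(n)$ steps, and $\mathcal L_{\mathcal D}(f)$ is the probability over $(x,y)\sim\mathcal D$ that it does not answer $y$ on $x$ within that time; a learner that outputs no predictor has loss $1$. Write $\bar M_i$ for $M_i$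 run for at most $T(n)$ steps, $\log_2$ for the binary and $\log$ for the natural logarithm. **Lemma (Universal Learner).** For every number of tapes of the enumerated machines, every time-constructible $T$ and every classification domain $\mathcal X\times\mathcal Y$ there is a Turing machine $\mathcal A^*_T$ (with some number of tapes of its own) such that: 1. (Runtime.) On every sequence of $n$ samples, $\mathcal A^*_T$ halts and outputs a predictor within $R(n)$ steps, where $R(n)=O\big(T(n)\,(\log T(n))^d\big)$ for some $d$; that is, its runtime is $\widetilde{O}(T(n))$. 2. (Selection.) Let $n\ge 2$ and let $Z$ be a sequence of $n$ samples. Let $f_i$, for $1\le i\le\log_2 n$, be the output of $\bar M_i$ on the first $\lfloor 0.99n\rfloor$ samples of $Z$, and let $\hat\ell_i$ be the fraction of the remaining samples on which $f_i$ errs ($\hat\ell_i=1$ if there is no $f_i$). Then for some $j$ with $\hat\ell_j=\min_{i\le\log_2 n}\hat\ell_i$, the output of $\mathcal A^*_T$ on $Z$ is $f_j$ (no claim about the output if there is no $f_j$). 3. (Guarantee.) For every probability distribution $\mathcal D$ on $\mathcal X\times\mathcal Y$ and every $n\ge 2$, $$\mathbb E_{Z\sim\mathcal D^n}\big[\mathcal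 L_{\mathcal D}(\mathcal A^*_T(Z))\big]\le\min_{1\le i\le\log_2 n}\ \mathbb E_{Z\sim\mathcal D^{\lfloor 0.99n\rfloor}}\big[\mathcal L_{\mathcal D}(\bar M_i(Z))\big]+10\sqrt2\,\sqrt{\frac{\log\log n+\log 2}{n}} .$$ -/

import Mathlib

open MeasureTheory Filter Asymptotics

/-! ### Turing machines -/

/-- A quintuple of a deterministic Turing machine with `k + 1` two-way infinite tapes over the
alphabet `{blank, 0, 1}`, where `none` is the blank; `none` as a move means that the head stays. -/
@[ext]
structure Rule (k : ℕ) where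
  state : ℕ
  read : Fin (k + 1) → Option Bool
  next : ℕ
  write : Fin (k + 1) → Option Bool
  move : Fin (k + 1) → Option Turing.Dir

/-- A Turing machine with `k + 1` tapes: a finite list of quintuples. The first quintuple that
matches the current state and the scanned symbols is carried out; if none matches, the machine
halts. The initial state is `0`. -/
@[ext]
structure Machine (k : ℕ) where
  rules : List (Rule k)

/-- State, tape contents and head positions. -/
structure Config (k : ℕ) where
  state : ℕ
  tape : Fin (k + 1) → Turing.Tape (Option Bool)

/-- Move the head of a tape, or leave it where it is. -/
def moveHead (d : Option Turing.Dir) (t : Turing.Tape (Option Bool)) :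
    Turing.Tape (Option Bool) :=
  match d with
  | none => t
  | some d => t.move d

/-- The word that starts at the head of a tape and ends before the first blank. -/
def readWord (t : Turing.Tape (Option Bool)) : List Bool :=
  t.right₀.liftOn (fun l => (l.takeWhile Option.isSome).reduceOption) (by
    rintro a b ⟨n, rfl⟩
    have h : (List.replicate n (default : Option Bool)).takeWhile Option.isSome = [] := by
      cases n <;> simp [List.replicate_succ, show (default : Option Bool) = none from rfl]
    congr 1
    induction a with
    | nil => simpa using h.symm
    | cons x xs ih => cases x <;> simp_all)

namespace Machine

variable {k : ℕ}

/-- One step; `none` if the machine has halted. -/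
def step (M : Machine k) (c : Config k) : Option (Config k) :=
  (M.rules.find? fun r => decide (r.state = c.state ∧ r.read = fun j => (c.tape j).head)).map
    fun r => ⟨r.next, fun j => moveHead (r.move j) ((c.tape j).write (r.write j))⟩

/-- The initial configuration: the input stands on the first tape, with the head on its first
symbol, and the other tapes are blank. -/
def init (k : ℕ) (w : List Bool) : Config k where
  state := 0
  tape j := if j = 0 then Turing.Tape.mk₁ (w.map some) else Turing.Tape.mk₁ []

/-- The configuration after `t` steps on input `w` (or the halting one, if that comes before). -/
def run (M : Machine k) (w : List Bool) (t : ℕ) : Config k :=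
  (fun c => (M.step c).getD c)^[t] (init k w)

/-- The result of running `M` on input `w` for at most `t` steps: `none` if it does not halt
within `t` steps, and otherwise the word at the head of the last tape. -/
def output (M : Machine k) (w : List Bool) (t : ℕ) : Option (List Bool) :=
  if (M.step (M.run w t)).isNone then some (readWord ((M.run w t).tape (Fin.last k))) else none

end Machine

/-! ### Descriptions of machines as binary words, and their enumeration -/

/-- The self-delimiting unary code `1 ⋯ 1 0` of a natural number. -/
def unary (n : ℕ) : List Bool := List.replicate n true ++ [false]

/-- Two bits for a tape symbol. -/
def symbolBits : Option Bool → List Bool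
  | none => [false, false]
  | some b => [true, b]

/-- Two bits for a head move. -/
def moveBits : Option Turing.Dir → List Bool
  | none => [false, false]
  | some Turing.Dir.left => [true, false]
  | some Turing.Dir.right => [true, true]

/-- The binary word of a quintuple. -/
def Rule.encode {k : ℕ} (r : Rule k) : List Bool :=
  unary r.state ++ ((List.ofFn r.read).flatMap symbolBits ++
    (unary r.next ++ ((List.ofFn r.write).flatMap symbolBits ++
      (List.ofFn r.move).flatMap moveBits)))

/-- The binary word of a machine: the concatenation of the words of its quintuples. -/
def Machine.encode {k : ℕ} (M : Machine k) : List Bool := M.rules.flatMap Rule.encode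

theorem unary_append_inj {a b : ℕ} {u v : List Bool} (h : unary a ++ u = unary b ++ v) :
    a = b ∧ u = v := by
  induction a generalizing b with
  | zero => cases b <;> simp_all [unary, List.replicate_succ]
  | succ a ih =>
    cases b with
    | zero => simp [unary, List.replicate_succ] at h
    | succ b =>
      have := @ih b (by simpa [unary, List.replicate_succ] using h)
      exact ⟨by rw [this.1], this.2⟩

theorem flatMap_append_inj {α : Type*} {f : α → List Bool} (hf : Function.Injective f)
    (hl : ∀ x y, (f x).length = (f y).length) {a b : List α} (hab : a.length = b.length)
    {u v : List Bool} (h : a.flatMap f ++ u = b.flatMap f ++ v) : a = b ∧ u = v := by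
  induction a generalizing b with
  | nil => cases b <;> simp_all
  | cons x xs ih =>
    cases b with
    | nil => simp at hab
    | cons y ys =>
      simp only [List.flatMap_cons, List.append_assoc] at h
      obtain ⟨h1, h2⟩ := List.append_inj h (hl x y)
      obtain ⟨h3, h4⟩ := ih (by simpa using hab) h2
      exact ⟨by rw [hf h1, h3], h4⟩

theorem Rule.encode_append_inj {k : ℕ} {r s : Rule k} {u v : List Bool}
    (h : r.encode ++ u = s.encode ++ v) : r = s ∧ u = v := by
  have hs : Function.Injective symbolBits := by decide
  have hm : Function.Injective moveBits := by
    rintro (_ | _ | _) (_ | _ | _) <;> simp [moveBits]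
  have hsl : ∀ x y, (symbolBits x).length = (symbolBits y).length := by decide
  have hml : ∀ x y, (moveBits x).length = (moveBits y).length := by
    rintro (_ | _ | _) (_ | _ | _) <;> simp [moveBits]
  simp only [Rule.encode, List.append_assoc] at h
  obtain ⟨h1, h⟩ := unary_append_inj h
  obtain ⟨h2, h⟩ := flatMap_append_inj hs hsl (by simp) h
  obtain ⟨h3, h⟩ := unary_append_inj h
  obtain ⟨h4, h⟩ := flatMap_append_inj hs hsl (by simp) h
  obtain ⟨h5, h⟩ := flatMap_append_inj hm hml (by simp) h
  exact ⟨Rule.ext h1 (List.ofFn_injective h2) h3 (List.ofFn_injective h4)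
    (List.ofFn_injective h5), h⟩

theorem Machine.encode_injective {k : ℕ} : Function.Injective (@Machine.encode k) := by
  have hne : ∀ r : Rule k, r.encode ≠ [] := by
    intro r; simp [Rule.encode, unary]
  rintro ⟨a⟩ ⟨b⟩ h
  congr 1
  simp only [Machine.encode] at h
  induction a generalizing b with
  | nil => cases b <;> simp_all
  | cons x xs ih =>
    cases b with
    | nil => simp_all
    | cons y ys =>
      simp only [List.flatMap_cons] at h
      obtain ⟨h1, h2⟩ := Rule.encode_append_inj h
      rw [h1, ih _ h2]

/-- The machine that a binary word describes; a word that describes no machine is read as the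
machine without quintuples. -/
noncomputable def Machine.decode (k : ℕ) (w : List Bool) : Machine k :=
  Function.extend Machine.encode id (fun _ => ⟨[]⟩) w

theorem Machine.decode_encode {k : ℕ} (M : Machine k) : Machine.decode k M.encode = M :=
  Machine.encode_injective.extend_apply id _ M

/-- The `i`-th binary word, `i = 1, 2, 3, …`, in the order `ε, 0, 1, 00, 01, 10, 11, 000, …`
(by length, and lexicographically among words of the same length): the binary digits of `i`
without the leading one. -/
def nthWord (i : ℕ) : List Bool := i.bits.reverse.tail

/-- The enumeration `M₁, M₂, …` of the Turing machines with `k + 1` tapes in the lexicographic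
order of their descriptions. -/
noncomputable def nthMachine (k i : ℕ) : Machine k := Machine.decode k (nthWord i)

/-- `T n ≥ n`, and some Turing machine computes the binary digits of `T n` (least significant
digit first) from `n` in unary in `O(T n)` steps. -/
def TimeConstructible (T : ℕ → ℕ) : Prop :=
  (∀ n, n ≤ T n) ∧ ∃ (k : ℕ) (M : Machine k) (C : ℕ),
    ∀ n, M.output (List.replicate n true) (C * T n + C) = some (T n).bits

/-! ### Learning -/

/-- A binary word `1 ⋯ 1 0 a` with `e` leading ones encodes a predictor: the machine `M_e` with
the word `a` hard-wired, which answers on the point `x` what `M_e` outputs on input `x a`. This is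
its answer within `t` steps. -/
noncomputable def predict (k : ℕ) (p x : List Bool) (t : ℕ) : Option (List Bool) :=
  (nthMachine k (p.takeWhile id).length).output (x ++ p.drop ((p.takeWhile id).length + 1)) t

/-- Input space and label space of a classification problem, presented to machines through binary
codes of some fixed widths. Distinct labels have distinct codes; points with the same code cannot
be told apart by a machine. -/
structure ClassificationDomain (X Y : Type*) [MeasurableSpace X] [MeasurableSpace Y] where
  pointWidth : ℕ
  labelWidth : ℕ
  point : X → Fin pointWidth → Bool
  label : Y → Fin labelWidth → Bool
  measurable_point : Measurable point
  measurable_label : Measurable label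
  label_injective : Function.Injective label

namespace ClassificationDomain

variable {X Y : Type*} [MeasurableSpace X] [MeasurableSpace Y] (dom : ClassificationDomain X Y)

/-- The word of a sample sequence: for each sample a marker `1`, the code of the point and the
code of the label. -/
def encodeSamples (S : List (X × Y)) : List Bool :=
  S.flatMap fun z => true :: (List.ofFn (dom.point z.1) ++ List.ofFn (dom.label z.2))

/-- The encoded predictor `f` (`none` if there is none) does not answer with the label of `z.2`
on the point `z.1` within `t` steps. -/
def Errs (k : ℕ) (f : Option (List Bool)) (t : ℕ) (z : X × Y) : Prop :=
  ∀ p, f = some p → predict k p (List.ofFn (dom.point z.1)) t ≠ some (List.ofFn (dom.label z.2))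

/-- The test error of an encoded predictor that is run for at most `t` steps. -/
noncomputable def loss (k : ℕ) (D : Measure (X × Y)) (f : Option (List Bool)) (t : ℕ) : ℝ :=
  D.real {z | dom.Errs k f t z}

open Classical in
/-- The fraction of a list of samples on which an encoded predictor errs. -/
noncomputable def empiricalLoss (k : ℕ) (S : List (X × Y)) (f : Option (List Bool)) (t : ℕ) :
    ℝ :=
  (S.countP fun z => decide (dom.Errs k f t z)) / S.length

/-- The expected test error, over `m` independent samples from `D`, of the learner `M` run for at
most `s` steps, where the predictor that it outputs is run for at most `t` steps. -/
noncomputable def expectedLoss (k : ℕ) (D : Measure (X × Y)) {l : ℕ} (M : Machine l)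
    (m s t : ℕ) : ℝ :=
  ∫ S : Fin m → X × Y, dom.loss k D (M.output (dom.encodeSamples (List.ofFn S)) s) t
    ∂(Measure.pi fun _ => D)

/-- The predictor that the `i`-th machine outputs within `t` steps on the first `⌊0.99 n⌋` of the
`n` samples in `S`. -/
noncomputable def trained (k i : ℕ) (S : List (X × Y)) (t : ℕ) : Option (List Bool) :=
  (nthMachine k i).output (dom.encodeSamples (S.take (99 * S.length / 100))) t

/-- The empirical loss of this predictor on the other samples. -/
noncomputable def holdoutLoss (k i : ℕ) (S : List (X × Y)) (t : ℕ) : ℝ :=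
  dom.empiricalLoss k (S.drop (99 * S.length / 100)) (dom.trained k i S t) t

end ClassificationDomain

/-!
The universal learner splits its `n` samples into the first `⌊0.99 n⌋`, used for training, and a
holdout set. It runs each of the first `log₂ n` machines of the enumeration for `T n` steps on the
training samples, counts the errors of the resulting predictor on the holdout samples, and outputs a
predictor with the fewest errors.

**Running time.** The description of `M_i` has at most `log₂ i` bits, so that a simulation of `T n`
steps costs `O(T n · (log n)²)` (`Run.simulate`). A naive evaluation on the holdout set would need
one simulation for each sample, that is, a factor `n`. But the widths of the codes are constants of
the domain, so there are only constantly many codes of samples; the learner simulates a predictor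
once for each of them and counts the occurrences of the code in the holdout set (`Run.evaluate`).
The machine of a predictor `1^e 0 a` is short as well: its description has at most `log₂ e` bits, and
`e` is bounded by the running time of the machine that wrote the predictor. Together with `T n ≥ n`, and with the computation of `T n` by the machine that time
constructibility provides, this gives `O(T n · (log T n)³)` (`Run.learner`, `isBigO_stepBound`).

**Construction of the machine.** Machines are built from flowchart fragments, which compose by
sequence, branching and loops (`Frag`). The learner is a program over registers, each of which is a
stack on a tape of its own, over the tapes of the simulated machine, and over the tapes of the machine
that computes the time bound. The predicate `Run F s s' t` states that `F` transforms the contents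
`s` into `s'` within `t` steps; a program and its resulting machine are connected by
`Frag.exists_machine`. The universal simulation presupposes a word that does describe a machine, so
descriptions are first parsed (`Run.validate`), and the tapes are erased after each simulation.

**Guarantee.** For fixed training samples, the holdout samples are independent of the candidates. By
Hoeffding's lemma the deviation of the empirical loss of one candidate on `m` samples is
sub-Gaussian with variance proxy `1 / (4 m)`, and bounding the largest of `K` deviations by the sum of
their exponentials shows that the choice costs at most `√(log K / (2 m))` in expectation
(`integral_le_of_selection`). Here `K = ⌊log₂ n⌋ ≤ 2 log n` and `m ≥ n / 100`. The expectation over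
all samples is the iterated one over training and holdout samples (`integral_pi_append`).
-/

namespace UniversalLearner

open Turing (Tape Dir ListBlank)

/-! ### Tapes given by two lists -/

theorem mk₂_head (L R : List (Option Bool)) : (Tape.mk₂ L R).head = R.headI := by
  simp [Tape.mk₂]

theorem mk₂_write (b : Option Bool) (L R : List (Option Bool)) :
    (Tape.mk₂ L R).write b = Tape.mk₂ L (b :: R.tail) := by
  simp [Tape.mk₂, Tape.mk', Tape.write]

theorem mk₂_right (L R : List (Option Bool)) :
    (Tape.mk₂ L R).move Dir.right = Tape.mk₂ (R.headI :: L) R.tail := by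
  simp [Tape.mk₂]

theorem mk₂_left (L R : List (Option Bool)) :
    (Tape.mk₂ L R).move Dir.left = Tape.mk₂ L.tail (L.headI :: R) := by
  simp [Tape.mk₂]

theorem listBlank_none_cons : ListBlank.cons (none : Option Bool) (ListBlank.mk []) =
    ListBlank.mk [] := by
  ext n
  cases n <;> simp [ListBlank.nth_mk]

/-- The tape that represents the stack `w`: the head is on the top of the stack, the rest of the
stack is to its right, and everything else is blank. -/
def stackTape (w : List Bool) : Tape (Option Bool) := Tape.mk₁ (w.map some)

theorem stackTape_head (w : List Bool) : (stackTape w).head = w.head? := by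
  cases w <;> simp [stackTape, Tape.mk₁, mk₂_head]
  rfl

theorem stackTape_push (w : List Bool) (b : Bool) :
    ((stackTape w).move Dir.left).write (some b) = stackTape (b :: w) := by
  rw [stackTape, Tape.mk₁, mk₂_left, mk₂_write]
  rfl

/-- Popping from the empty stack is harmless. -/
theorem stackTape_pop (w : List Bool) :
    ((stackTape w).write none).move Dir.right = stackTape w.tail := by
  rw [stackTape, Tape.mk₁, mk₂_write, mk₂_right, List.map_tail.symm]
  simp only [stackTape, Tape.mk₁, Tape.mk₂, List.headI_cons, List.tail_cons]
  congr 1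
  exact listBlank_none_cons

theorem readWord_mk₂ (L R : List (Option Bool)) :
    readWord (Tape.mk₂ L R) = (R.takeWhile Option.isSome).reduceOption := by
  simp only [readWord, Tape.mk₂, Tape.mk'_right₀]
  rfl

theorem readWord_stackTape (w : List Bool) : readWord (stackTape w) = w := by
  rw [stackTape, Tape.mk₁, readWord_mk₂]
  induction w with
  | nil => rfl
  | cons b w ih => simpa [List.reduceOption_cons_of_some] using ih

/-! ### Flowchart fragments -/

/-- A fragment of a multi-tape machine with tapes indexed by `ι`: the control states are the
numbers below `size`, the entry is `0` and the exit is `size`. In state `q`, seeing `h`, it writes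
and moves according to `act q h` and goes to `next q h`. -/
structure Frag (ι : Type) where
  size : ℕ
  next : ℕ → (ι → Option Bool) → ℕ
  act : ℕ → (ι → Option Bool) → ι → Option Bool × Option Dir

namespace Frag

variable {ι : Type}

/-- The symbols under the heads. -/
def heads (s : ι → Tape (Option Bool)) : ι → Option Bool := fun i => (s i).head

/-- Write and move on every tape. -/
def apply (a : ι → Option Bool × Option Dir) (s : ι → Tape (Option Bool)) :
    ι → Tape (Option Bool) := fun i => moveHead (a i).2 ((s i).write (a i).1)

/-- One step of a fragment; nothing happens outside its control states. -/
def step (F : Frag ι) (c : ℕ × (ι → Tape (Option Bool))) : ℕ × (ι → Tape (Option Bool)) :=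
  if c.1 < F.size then (F.next c.1 (heads c.2), apply (F.act c.1 (heads c.2)) c.2) else c

/-- Started at its entry with tapes `s`, the fragment reaches its exit with tapes `s'` within `t`
steps. -/
def Exec (F : Frag ι) (s s' : ι → Tape (Option Bool)) (t : ℕ) : Prop :=
  ∃ u ≤ t, F.step^[u] (0, s) = (F.size, s')

theorem Exec.mono {F : Frag ι} {s s' : ι → Tape (Option Bool)} {t t' : ℕ} (h : F.Exec s s' t)
    (ht : t ≤ t') : F.Exec s s' t' := by
  obtain ⟨u, hu, h⟩ := h
  exact ⟨u, hu.trans ht, h⟩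

theorem step_iterate_of_le (F : Frag ι) {c : ℕ × (ι → Tape (Option Bool))} (h : F.size ≤ c.1)
    (t : ℕ) : F.step^[t] c = c :=
  Function.iterate_fixed (by simp [step, h]) t

/-- A fragment that is embedded in another one, up to a renaming `φ` of the states, runs there
as it does on its own. -/
theorem relocate (F H : Frag ι) (φ : ℕ → ℕ)
    (hφ : ∀ q < F.size, φ q < H.size ∧ ∀ h, H.next (φ q) h = φ (F.next q h) ∧
      H.act (φ q) h = F.act q h) (t : ℕ) (c : ℕ × (ι → Tape (Option Bool))) :
    ∃ u ≤ t, H.step^[u] (φ c.1, c.2) = (φ (F.step^[t] c).1, (F.step^[t] c).2) := by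
  induction t generalizing c with
  | zero => exact ⟨0, le_rfl, rfl⟩
  | succ t ih =>
    by_cases hc : c.1 < F.size
    · obtain ⟨u, hu, h⟩ := ih (F.step c)
      refine ⟨u + 1, by omega, ?_⟩
      rw [Function.iterate_succ_apply, Function.iterate_succ_apply, ← h]
      congr 1
      obtain ⟨h1, h2⟩ := hφ c.1 hc
      simp [step, hc, h1, h2]
    · exact ⟨0, by omega, by rw [step_iterate_of_le F (by omega)]; rfl⟩

theorem Exec.relocate {F : Frag ι} {s s' : ι → Tape (Option Bool)} {t : ℕ} (hF : F.Exec s s' t)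
    (H : Frag ι) (φ : ℕ → ℕ)
    (hφ : ∀ q < F.size, φ q < H.size ∧ ∀ h, H.next (φ q) h = φ (F.next q h) ∧
      H.act (φ q) h = F.act q h) :
    ∃ u ≤ t, H.step^[u] (φ 0, s) = (φ F.size, s') := by
  obtain ⟨u, hu, h⟩ := hF
  obtain ⟨v, hv, h'⟩ := Frag.relocate F H φ hφ u (0, s)
  rw [h] at h'
  exact ⟨v, hv.trans hu, h'⟩

/-- The fragment that does nothing. -/
def skip : Frag ι := ⟨0, fun _ _ => 0, fun _ h i => (h i, none)⟩

theorem exec_skip (s : ι → Tape (Option Bool)) : (skip : Frag ι).Exec s s 0 := ⟨0, le_rfl, rfl⟩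

/-- Sequential composition. -/
def seq (F G : Frag ι) : Frag ι where
  size := F.size + G.size
  next q h := if q < F.size then F.next q h else G.next (q - F.size) h + F.size
  act q h := if q < F.size then F.act q h else G.act (q - F.size) h

theorem exec_seq {F G : Frag ι} {s s₁ s₂ : ι → Tape (Option Bool)} {t₁ t₂ : ℕ}
    (h₁ : F.Exec s s₁ t₁) (h₂ : G.Exec s₁ s₂ t₂) : (F.seq G).Exec s s₂ (t₁ + t₂) := by
  obtain ⟨u, hu, hu'⟩ := h₁.relocate (F.seq G) id (fun q hq => ⟨by simp [seq]; omega, fun h => by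
    simp [seq, hq]⟩)
  obtain ⟨v, hv, hv'⟩ := h₂.relocate (F.seq G) (· + F.size) (fun q hq => ⟨by simp [seq]; omega,
    fun h => by simp [seq]⟩)
  refine ⟨v + u, by omega, ?_⟩
  rw [Function.iterate_add_apply]
  simp only [id_eq, zero_add] at hu' hv'
  rw [hu', hv', add_comm]
  rfl

/-- Branching on the symbol under one head. State `0` tests the symbol; the entries of `F` and `G`
are `1` and `1 + F.size`, and the exit of `F`, which is the entry of `G`, is redirected to the common
exit. A fragment of size `0` has no entry state, so its entry is the exit. -/
def ite (i : ι) (c : Option Bool → Bool) (F G : Frag ι) : Frag ι where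
  size := 1 + F.size + G.size
  next q h :=
    if q = 0 then
      if c (h i) then (if F.size = 0 then 1 + G.size else 1) else 1 + F.size
    else if q ≤ F.size then
      if F.next (q - 1) h = F.size then 1 + F.size + G.size else F.next (q - 1) h + 1
    else G.next (q - 1 - F.size) h + 1 + F.size
  act q h :=
    if q = 0 then fun j => (h j, none)
    else if q ≤ F.size then F.act (q - 1) h else G.act (q - 1 - F.size) h

theorem apply_stay (s : ι → Tape (Option Bool)) : apply (fun j => ((s j).head, none)) s = s := by
  funext j
  simp [apply, moveHead]

theorem exec_ite_true {i : ι} {c : Option Bool → Bool} {F G : Frag ι}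
    {s s' : ι → Tape (Option Bool)} {t : ℕ} (hc : c (s i).head = true) (h : F.Exec s s' t) :
    (ite i c F G).Exec s s' (t + 1) := by
  obtain ⟨u, hu, hu'⟩ := h.relocate (ite i c F G)
    (fun q => if q = F.size then 1 + F.size + G.size else q + 1)
    (fun q hq => ⟨by simp [ite, hq.ne]; omega, fun h => by
      simp [ite, hq.ne, Nat.succ_le_of_lt hq]⟩)
  refine ⟨u + 1, by omega, ?_⟩
  rw [Function.iterate_succ_apply]
  have : (ite i c F G).step (0, s) = ((if 0 = F.size then 1 + F.size + G.size else 0 + 1), s) := by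
    have h0 : 0 < 1 + F.size + G.size := by omega
    simp only [step, ite, h0, if_true, heads, hc, apply_stay]
    congr 1
    split_ifs <;> omega
  rw [this, hu']
  simp [ite]

theorem exec_ite_false {i : ι} {c : Option Bool → Bool} {F G : Frag ι}
    {s s' : ι → Tape (Option Bool)} {t : ℕ} (hc : c (s i).head = false) (h : G.Exec s s' t) :
    (ite i c F G).Exec s s' (t + 1) := by
  obtain ⟨u, hu, hu'⟩ := h.relocate (ite i c F G) (fun q => q + 1 + F.size)
    (fun q hq => ⟨by simp [ite]; omega, fun h => by
      have h2 : ¬ (q + 1 + F.size ≤ F.size) := by omega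
      have h3 : q + 1 + F.size - 1 - F.size = q := by omega
      simp [ite, h2]⟩)
  refine ⟨u + 1, by omega, ?_⟩
  rw [Function.iterate_succ_apply]
  have : (ite i c F G).step (0, s) = (0 + 1 + F.size, s) := by
    have h0 : 0 < 1 + F.size + G.size := by omega
    simp [step, ite, h0, heads, hc, apply_stay s]
  rw [this, hu']
  simp [ite]; omega

/-- Repeat `F` as long as the symbol under one head satisfies `c`: state `0` tests the symbol, and
the exit of `F` is redirected to it. -/
def loop (i : ι) (c : Option Bool → Bool) (F : Frag ι) : Frag ι where
  size := F.size + 1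
  next q h :=
    if q = 0 then
      if c (h i) then (if F.size = 0 then 0 else 1) else F.size + 1
    else if F.next (q - 1) h = F.size then 0 else F.next (q - 1) h + 1
  act q h := if q = 0 then fun j => (h j, none) else F.act (q - 1) h

theorem exec_loop_false {i : ι} {c : Option Bool → Bool} {F : Frag ι}
    {s : ι → Tape (Option Bool)} (hc : c (s i).head = false) : (loop i c F).Exec s s 1 := by
  refine ⟨1, le_rfl, ?_⟩
  simp [step, loop, apply_stay, heads, hc]

theorem exec_loop_true {i : ι} {c : Option Bool → Bool} {F : Frag ι}
    {s s₁ s₂ : ι → Tape (Option Bool)} {t₁ t₂ : ℕ} (hc : c (s i).head = true)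
    (h₁ : F.Exec s s₁ t₁) (h₂ : (loop i c F).Exec s₁ s₂ t₂) :
    (loop i c F).Exec s s₂ (1 + t₁ + t₂) := by
  obtain ⟨u, hu, hu'⟩ := h₁.relocate (loop i c F)
    (fun q => if q = F.size then 0 else q + 1)
    (fun q hq => ⟨by simp [loop, hq.ne]; omega, fun h => by simp [loop, hq.ne]⟩)
  obtain ⟨v, hv, hv'⟩ := h₂
  refine ⟨v + (u + 1), by omega, ?_⟩
  rw [Function.iterate_add_apply, Function.iterate_succ_apply]
  have : (loop i c F).step (0, s) = ((if 0 = F.size then 0 else 0 + 1), s) := by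
    simp only [step, loop, Nat.zero_lt_succ, if_true, apply_stay, heads, hc]
    congr 1
    split_ifs <;> omega
  rw [this, hu']
  simpa using hv'

/-- Write and move on one tape. -/
def act1 [DecidableEq ι] (i : ι) (o : Option Bool → Option Bool) (d : Option Dir) : Frag ι where
  size := 1
  next _ _ := 1
  act _ h j := if j = i then (o (h i), d) else (h j, none)

theorem exec_act1 [DecidableEq ι] (i : ι) (o : Option Bool → Option Bool) (d : Option Dir)
    (s : ι → Tape (Option Bool)) :
    (act1 i o d).Exec s (Function.update s i (moveHead d ((s i).write (o (s i).head)))) 1 := by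
  refine ⟨1, le_rfl, ?_⟩
  simp only [step, act1, Function.iterate_one, Nat.lt_one_iff, if_true]
  congr 1
  funext j
  by_cases h : j = i
  · subst h; simp [apply, heads]
  · simp [apply, heads, h, moveHead]

/-- The machine `M`, working on the tapes selected by `e`. The size exceeds every state that occurs in
a quintuple; where no quintuple applies, the fragment goes to its exit. -/
noncomputable def ofMachine [DecidableEq ι] {m : ℕ} (M : Machine m) (e : Fin (m + 1) → ι) :
    Frag ι where
  size := (M.rules.map fun r => max r.state r.next).sum + 1
  next q h := ((M.rules.find? fun r => decide (r.state = q ∧ r.read = fun j => h (e j))).map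
    Rule.next).getD ((M.rules.map fun r => max r.state r.next).sum + 1)
  act q h i :=
    match M.rules.find? fun r => decide (r.state = q ∧ r.read = fun j => h (e j)) with
    | none => (h i, none)
    | some r => if hi : ∃ j, e j = i then (r.write hi.choose, r.move hi.choose) else (h i, none)

open Classical in
/-- The tapes `tp` put in place of those selected by `e`. -/
noncomputable def place {m : ℕ} (e : Fin (m + 1) → ι) (tp : Fin (m + 1) → Tape (Option Bool))
    (s : ι → Tape (Option Bool)) : ι → Tape (Option Bool) :=
  fun i => if hi : ∃ j, e j = i then tp hi.choose else s i

theorem place_apply {m : ℕ} {e : Fin (m + 1) → ι} (he : Function.Injective e)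
    (tp : Fin (m + 1) → Tape (Option Bool)) (s : ι → Tape (Option Bool)) (j : Fin (m + 1)) :
    place e tp s (e j) = tp j := by
  have hi : ∃ j', e j' = e j := ⟨j, rfl⟩
  simp only [place, hi, dif_pos]
  rw [he hi.choose_spec]

theorem place_apply_of_ne {m : ℕ} {e : Fin (m + 1) → ι}
    (tp : Fin (m + 1) → Tape (Option Bool)) (s : ι → Tape (Option Bool)) {i : ι}
    (h : ∀ j, e j ≠ i) : place e tp s i = s i := by
  simp [place, h]

/-- The extra step is the one in which the fragment finds that no quintuple applies. -/
theorem exec_ofMachine [DecidableEq ι] {m : ℕ} (M : Machine m) {e : Fin (m + 1) → ι}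
    (he : Function.Injective e) (w : List Bool) (t : ℕ) (hM : (M.step (M.run w t)).isNone)
    (s : ι → Tape (Option Bool)) (hs : ∀ j, s (e j) = (Machine.init m w).tape j) :
    (ofMachine M e).Exec s (place e (M.run w t).tape s) (t + 1) := by
  set N := (M.rules.map fun r => max r.state r.next).sum with hN
  have hmem : ∀ r ∈ M.rules, r.next ≤ N := fun r hr =>
    (le_max_right _ _).trans (List.single_le_sum (by simp) _ (List.mem_map_of_mem hr))
  have key : ∀ u, (M.run w u).state ≤ N ∧ ∃ v ≤ u, (ofMachine M e).step^[v] (0, s) =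
      ((M.run w u).state, place e (M.run w u).tape s) := by
    intro u
    induction u with
    | zero =>
      refine ⟨by simp [Machine.run, Machine.init], 0, le_rfl, ?_⟩
      simp only [Machine.run, Function.iterate_zero, id]
      congr 1
      funext i
      by_cases hi : ∃ j, e j = i
      · obtain ⟨j, rfl⟩ := hi
        rw [place_apply he, hs]
      · push Not at hi
        rw [place_apply_of_ne _ _ hi]
    | succ u ih =>
      obtain ⟨ih1, v, hv, ih⟩ := ih
      have hrun : M.run w (u + 1) = (M.step (M.run w u)).getD (M.run w u) := by
        simp [Machine.run, Function.iterate_succ_apply']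
      set c := M.run w u
      rcases hst : M.rules.find? (fun r => decide (r.state = c.state ∧
        r.read = fun j => (c.tape j).head)) with _ | r
      · have : M.step c = none := by simp only [Machine.step, hst, Option.map_none]
        rw [this] at hrun
        exact ⟨by rw [hrun]; exact ih1, v, by omega, by rw [hrun]; exact ih⟩
      · have hstep : M.step c = some ⟨r.next, fun j => moveHead (r.move j)
          ((c.tape j).write (r.write j))⟩ := by
          simp only [Machine.step, hst, Option.map_some]
        rw [hstep] at hrun
        rw [hrun]
        refine ⟨hmem r (List.mem_of_find?_eq_some hst), v + 1, by omega, ?_⟩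
        rw [Function.iterate_succ_apply', ih]
        have hh : (fun j => heads (place e c.tape s) (e j)) = fun j => (c.tape j).head := by
          funext j; simp [heads, place_apply he]
        have hlt : c.state < (ofMachine M e).size := by simp only [ofMachine]; omega
        simp only [step, hlt, if_true]
        simp only [ofMachine, hh, hst, Option.map_some, Option.getD_some]
        congr 1
        funext i
        by_cases hi : ∃ j, e j = i
        · simp only [apply, hi, dif_pos, place]
        · simp [apply, hi, place, heads, moveHead]
  obtain ⟨h1, v, hv, h⟩ := key t
  refine ⟨v + 1, by omega, ?_⟩
  rw [Function.iterate_succ_apply', h]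
  set c := M.run w t
  have hst : M.rules.find? (fun r => decide (r.state = c.state ∧
        r.read = fun j => (c.tape j).head)) = none := by
    simpa only [Machine.step, Option.isNone_iff_eq_none, Option.map_eq_none_iff] using hM
  have hh : (fun j => heads (place e c.tape s) (e j)) = fun j => (c.tape j).head := by
    funext j; simp [heads, place_apply he]
  have hlt : c.state < (ofMachine M e).size := by simp only [ofMachine]; omega
  simp only [step, hlt, if_true]
  simp only [ofMachine, hh, hst, Option.map_none, Option.getD_none]
  exact congrArg _ (apply_stay _)

/-- The quintuples of a fragment: one for each control state and each combination of scanned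
symbols. -/
noncomputable def rules [Fintype ι] [DecidableEq ι] {l : ℕ} (F : Frag ι) (φ : Fin (l + 1) ≃ ι) :
    List (Rule l) :=
  (List.range F.size).flatMap fun q =>
    (Finset.univ : Finset (Fin (l + 1) → Option Bool)).toList.map fun h =>
      { state := q, read := h, next := F.next q fun i => h (φ.symm i)
        write := fun j => (F.act q (fun i => h (φ.symm i)) (φ j)).1
        move := fun j => (F.act q (fun i => h (φ.symm i)) (φ j)).2 }

theorem find_rules [Fintype ι] [DecidableEq ι] {l : ℕ} (F : Frag ι) (φ : Fin (l + 1) ≃ ι) (q : ℕ)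
    (g : Fin (l + 1) → Option Bool) :
    (F.rules φ).find? (fun r => decide (r.state = q ∧ r.read = g)) =
      if q < F.size then some
        { state := q, read := g, next := F.next q fun i => g (φ.symm i)
          write := fun j => (F.act q (fun i => g (φ.symm i)) (φ j)).1
          move := fun j => (F.act q (fun i => g (φ.symm i)) (φ j)).2 } else none := by
  rcases hf : (F.rules φ).find? (fun r => decide (r.state = q ∧ r.read = g)) with _ | r
  · rw [List.find?_eq_none] at hf
    split_ifs with hq
    · exfalso
      refine hf _ (List.mem_flatMap.2 ⟨q, List.mem_range.2 hq, List.mem_map.2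
        ⟨g, by simp, rfl⟩⟩) ?_
      simp
    · rwa [← List.find?_eq_none] at hf
  · have h1 := List.find?_some hf
    have h2 := List.mem_of_find?_eq_some hf
    simp only [rules, List.mem_flatMap, List.mem_range, List.mem_map] at h2
    obtain ⟨q', hq', h, -, rfl⟩ := h2
    simp only [decide_eq_true_eq] at h1
    obtain ⟨rfl, rfl⟩ := h1
    rw [if_pos hq']
    exact hf

/-- A fragment that starts on an input tape and ends on an output tape yields a machine: the tapes
are renumbered so that the input is on the first one and the output on the last one. -/
theorem exists_machine [Fintype ι] [DecidableEq ι] (F : Frag ι) {i o : ι} (hio : i ≠ o) :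
    ∃ (l : ℕ) (A : Machine l), ∀ (w : List Bool) (s' : ι → Tape (Option Bool)) (t : ℕ),
      F.Exec (fun j => if j = i then stackTape w else stackTape []) s' t →
        A.output w t = some (readWord (s' o)) := by
  obtain ⟨l, hl⟩ : ∃ l, Fintype.card ι = l + 1 :=
    Nat.exists_eq_succ_of_ne_zero (Fintype.card_pos_iff.2 ⟨i⟩).ne'
  have e₀ : ι ≃ Fin (l + 1) := Fintype.equivFinOfCardEq hl
  have hl0 : (0 : Fin (l + 1)) ≠ Fin.last l := by
    intro h
    have : l = 0 := by simpa [Fin.ext_iff, eq_comm] using h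
    subst this
    exact hio (e₀.injective (by ext; omega))
  let e₁ : ι ≃ Fin (l + 1) := e₀.trans (Equiv.swap (e₀ i) 0)
  have he₁ : e₁ i = 0 := by simp [e₁]
  let e : ι ≃ Fin (l + 1) := e₁.trans (Equiv.swap (e₁ o) (Fin.last l))
  have hei : e i = 0 := by
    have : e₁ o ≠ 0 := fun h => hio (e₁.injective (he₁.trans h.symm))
    simp only [e, Equiv.trans_apply, he₁]
    exact Equiv.swap_apply_of_ne_of_ne this.symm hl0
  have heo : e o = Fin.last l := by simp [e]
  refine ⟨l, ⟨F.rules e.symm⟩, fun w s' t hF => ?_⟩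
  set A : Machine l := ⟨F.rules e.symm⟩ with hA
  have hstep : ∀ c : Config l, A.step c = if c.state < F.size then
      some ⟨(F.step (c.state, fun i => c.tape (e i))).1,
        fun j => (F.step (c.state, fun i => c.tape (e i))).2 (e.symm j)⟩ else none := by
    intro c
    simp only [Machine.step, hA, find_rules]
    split_ifs with hq
    · simp only [step, hq, if_true, apply, Equiv.apply_symm_apply, Option.map_some]
      rfl
    · rfl
  have hrun : ∀ u, F.step^[u] (0, fun j => if j = i then stackTape w else stackTape []) =
      ((A.run w u).state, fun j => (A.run w u).tape (e j)) := by
    intro u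
    induction u with
    | zero =>
      simp only [Machine.run, Function.iterate_zero, id, Machine.init]
      congr 1
      funext j
      have : e j = 0 ↔ j = i := by rw [← hei, e.apply_eq_iff_eq]
      simp [this, stackTape]
    | succ u ih =>
      rw [Function.iterate_succ_apply', ih]
      have hr : A.run w (u + 1) = (A.step (A.run w u)).getD (A.run w u) := by
        simp [Machine.run, Function.iterate_succ_apply']
      rw [hr, hstep]
      split_ifs with hq
      · simp
      · simp [step, hq]
  obtain ⟨u, hu, hF⟩ := hF
  obtain ⟨v, rfl⟩ := Nat.exists_eq_add_of_le' hu
  have hv := hrun (v + u)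
  rw [Function.iterate_add_apply, hF, step_iterate_of_le F le_rfl] at hv
  simp only [Prod.mk.injEq] at hv
  rw [Machine.output, hstep, ← hv.1, ← heo, hv.2]
  simp

end Frag

/-! ### Programs over registers and tapes -/

/-- The registers of the learner; each is kept as a stack on a tape of its own, and numbers are kept
in unary unless stated otherwise.

* `inp`, `out`: the input, from which the training samples are removed later, and the output;
* `nn`, `mm`, `n2`, `kk`: the numbers of samples, of holdout samples, of training samples, and of
  machines still to be tried;
* `tr`, `clk`, `big`: the training samples, the number of steps of a simulation, and a word longer than
  any tape content of a simulated machine;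
* `wr`, `best`, `has`, `p`, `err`: the current machine (its description in reverse), the least number of
  errors so far, whether there is a current predictor, that predictor, and its number of errors;
* `er`, `arg`: the two parts of an encoded predictor;
* `desc`, `d`, `st`, `nx`, `fl`, `fnd`, `bad`: description of the simulated machine, its unread rest,
  current state, next state, whether the current quintuple matches, whether a quintuple has been
  carried out, and whether a description is invalid;
* `t1`, `t2`, `a1`, `ck`, `u`, `hc`: auxiliary registers. -/
inductive Reg
  | inp | out | t1 | t2 | nn | mm | kk | tr | clk | big | wr | best | desc | d | bad | st | a1 | nx
  | fl | fnd | ck | p | has | err | er | arg | u | hc | n2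
  deriving DecidableEq

instance : Fintype Reg where
  elems := {.inp, .out, .t1, .t2, .nn, .mm, .kk, .tr, .clk, .big, .wr, .best, .desc, .d, .bad, .st,
    .a1, .nx, .fl, .fnd, .ck, .p, .has, .err, .er, .arg, .u, .hc, .n2}
  complete r := by cases r <;> decide

/-- The tapes of the learner: those of the machine that computes the time bound, those of the
simulated machines, and the registers. -/
abbrev Idx (m k : ℕ) := Fin (m + 1) ⊕ Fin (k + 1) ⊕ Reg

/-- The contents of the tapes, where those of the registers are given as words. -/
@[ext]
structure Store (m k : ℕ) where
  aux : Fin (m + 1) → Tape (Option Bool)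
  sim : Fin (k + 1) → Tape (Option Bool)
  reg : Reg → List Bool

variable {m k : ℕ}

namespace Store

/-- Assign a word to a register. -/
def set (s : Store m k) (r : Reg) (w : List Bool) : Store m k :=
  { s with reg := fun r' => if r' = r then w else s.reg r' }

/-- Replace the tapes of the simulated machine. -/
def setSim (s : Store m k) (tp : Fin (k + 1) → Tape (Option Bool)) : Store m k :=
  { s with sim := tp }

/-- Replace the tapes of the machine that computes the time bound. -/
def setAux (s : Store m k) (tp : Fin (m + 1) → Tape (Option Bool)) : Store m k :=
  { s with aux := tp }

@[simp] theorem set_reg (s : Store m k) (r r' : Reg) (w : List Bool) :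
    (s.set r w).reg r' = if r' = r then w else s.reg r' := rfl
@[simp] theorem set_sim (s : Store m k) (r : Reg) (w : List Bool) : (s.set r w).sim = s.sim := rfl
@[simp] theorem set_aux (s : Store m k) (r : Reg) (w : List Bool) : (s.set r w).aux = s.aux := rfl
@[simp] theorem setSim_reg (s : Store m k) (tp : Fin (k + 1) → Tape (Option Bool)) :
    (s.setSim tp).reg = s.reg := rfl
@[simp] theorem setSim_sim (s : Store m k) (tp : Fin (k + 1) → Tape (Option Bool)) :
    (s.setSim tp).sim = tp := rfl
@[simp] theorem setSim_aux (s : Store m k) (tp : Fin (k + 1) → Tape (Option Bool)) :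
    (s.setSim tp).aux = s.aux := rfl
@[simp] theorem setAux_reg (s : Store m k) (tp : Fin (m + 1) → Tape (Option Bool)) :
    (s.setAux tp).reg = s.reg := rfl
@[simp] theorem setAux_sim (s : Store m k) (tp : Fin (m + 1) → Tape (Option Bool)) :
    (s.setAux tp).sim = s.sim := rfl
@[simp] theorem setAux_aux (s : Store m k) (tp : Fin (m + 1) → Tape (Option Bool)) :
    (s.setAux tp).aux = tp := rfl

theorem ext' {s s' : Store m k} (h : s.aux = s'.aux ∧ s.sim = s'.sim ∧ ∀ r, s.reg r = s'.reg r) :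
    s = s' := Store.ext h.1 h.2.1 (funext h.2.2)

theorem set_self {s : Store m k} {r : Reg} {w : List Bool} (h : s.reg r = w) : s.set r w = s :=
  ext' ⟨rfl, rfl, fun r' => by by_cases hr : r' = r <;> simp [hr, h]⟩

@[simp] theorem set_set (s : Store m k) (r : Reg) (w w' : List Bool) :
    (s.set r w).set r w' = s.set r w' :=
  ext' ⟨rfl, rfl, fun r' => by by_cases hr : r' = r <;> simp [hr]⟩

/-- The contents of all tapes. -/
def phys (s : Store m k) : Idx m k → Tape (Option Bool) :=
  Sum.elim s.aux (Sum.elim s.sim fun r => stackTape (s.reg r))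

theorem phys_set (s : Store m k) (r : Reg) (w : List Bool) :
    (s.set r w).phys = Function.update s.phys (.inr (.inr r)) (stackTape w) := by
  funext i
  rcases i with i | i | i
  · simp [phys]
  · simp [phys]
  · by_cases hi : i = r
    · subst hi; simp [phys]
    · simp [phys, hi]

theorem phys_setSim_update (s : Store m k) (j : Fin (k + 1)) (tp : Tape (Option Bool)) :
    (s.setSim (Function.update s.sim j tp)).phys =
      Function.update s.phys (.inr (.inl j)) tp := by
  funext i
  rcases i with i | i | i
  · rw [Function.update_of_ne Sum.inl_ne_inr]; rfl
  · by_cases hi : i = j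
    · subst hi; rw [Function.update_self]; exact Function.update_self _ _ _
    · rw [Function.update_of_ne fun h => hi (Sum.inl_injective (Sum.inr_injective h))]
      exact Function.update_of_ne hi _ _
  · rw [Function.update_of_ne (by simp)]; rfl

end Store

/-- Programs of the learner. -/
abbrev Prog (m k : ℕ) := Frag (Idx m k)

/-- Started on `s`, the program ends with `s'` within `t` steps. -/
def Run (F : Prog m k) (s s' : Store m k) (t : ℕ) : Prop := F.Exec s.phys s'.phys t

/-- Consecutive execution of a list of programs. -/
def block (l : List (Prog m k)) : Prog m k := l.foldr Frag.seq Frag.skip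

/-- Branching on the top of a register. -/
def ifR (r : Reg) (c : Option Bool → Bool) (F G : Prog m k) : Prog m k :=
  Frag.ite (.inr (.inr r)) c F G

/-- Repetition as long as the top of a register satisfies `c`. -/
def whileR (r : Reg) (c : Option Bool → Bool) (F : Prog m k) : Prog m k :=
  Frag.loop (.inr (.inr r)) c F

/-- Branching on the scanned symbol of a tape of the simulated machine. -/
def ifT (j : Fin (k + 1)) (c : Option Bool → Bool) (F G : Prog m k) : Prog m k :=
  Frag.ite (.inr (.inl j)) c F G

/-- Write and move on a tape of the simulated machine. -/
def actT (j : Fin (k + 1)) (o : Option Bool → Option Bool) (d : Option Dir) : Prog m k :=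
  Frag.act1 (.inr (.inl j)) o d

/-- Put a bit on top of a register. -/
def push (r : Reg) (b : Bool) : Prog m k :=
  (Frag.act1 (.inr (.inr r)) id (some Dir.left)).seq
    (Frag.act1 (.inr (.inr r)) (fun _ => some b) none)

/-- Remove the top of a register, if there is one. -/
def pop (r : Reg) : Prog m k := Frag.act1 (.inr (.inr r)) (fun _ => none) (some Dir.right)

namespace Run

variable {F G : Prog m k} {s s₁ s₂ : Store m k} {t t₁ t₂ : ℕ}

theorem conv (h : Run F s s₁ t₁) (hs : s₁ = s₂) (ht : t₁ ≤ t₂) : Run F s s₂ t₂ :=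
  hs ▸ Frag.Exec.mono h ht

theorem mono (h : Run F s s₁ t₁) (ht : t₁ ≤ t₂) : Run F s s₁ t₂ := Frag.Exec.mono h ht

theorem nil : Run (block []) s s 0 := Frag.exec_skip _

theorem cons {Fs : List (Prog m k)} (h₁ : Run F s s₁ t₁) (h₂ : Run (block Fs) s₁ s₂ t₂) :
    Run (block (F :: Fs)) s s₂ (t₁ + t₂) := Frag.exec_seq h₁ h₂

theorem ifR_true {r : Reg} {c : Option Bool → Bool} (hc : c (s.reg r).head? = true)
    (h : Run F s s₁ t) : Run (ifR r c F G) s s₁ (t + 1) :=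
  Frag.exec_ite_true (by simpa [Store.phys, stackTape_head] using hc) h

theorem ifR_false {r : Reg} {c : Option Bool → Bool} (hc : c (s.reg r).head? = false)
    (h : Run G s s₁ t) : Run (ifR r c F G) s s₁ (t + 1) :=
  Frag.exec_ite_false (by simpa [Store.phys, stackTape_head] using hc) h

theorem ifT_true {j : Fin (k + 1)} {c : Option Bool → Bool} (hc : c (s.sim j).head = true)
    (h : Run F s s₁ t) : Run (ifT j c F G) s s₁ (t + 1) :=
  Frag.exec_ite_true (by simpa [Store.phys] using hc) h

theorem ifT_false {j : Fin (k + 1)} {c : Option Bool → Bool} (hc : c (s.sim j).head = false)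
    (h : Run G s s₁ t) : Run (ifT j c F G) s s₁ (t + 1) :=
  Frag.exec_ite_false (by simpa [Store.phys] using hc) h

theorem whileR_false {r : Reg} {c : Option Bool → Bool} (hc : c (s.reg r).head? = false) :
    Run (whileR r c F) s s 1 :=
  Frag.exec_loop_false (by simpa [Store.phys, stackTape_head] using hc)

theorem whileR_true {r : Reg} {c : Option Bool → Bool} (hc : c (s.reg r).head? = true)
    (h₁ : Run F s s₁ t₁) (h₂ : Run (whileR r c F) s₁ s₂ t₂) :
    Run (whileR r c F) s s₂ (1 + t₁ + t₂) :=
  Frag.exec_loop_true (by simpa [Store.phys, stackTape_head] using hc) h₁ h₂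

theorem actT (j : Fin (k + 1)) (o : Option Bool → Option Bool) (d : Option Dir) (s : Store m k) :
    Run (actT j o d) s
      (s.setSim (Function.update s.sim j (moveHead d ((s.sim j).write (o (s.sim j).head))))) 1 := by
  unfold Run
  rw [Store.phys_setSim_update]
  exact Frag.exec_act1 (.inr (.inl j)) o d s.phys

theorem pop (r : Reg) (s : Store m k) : Run (pop r) s (s.set r (s.reg r).tail) 1 := by
  unfold Run
  rw [Store.phys_set, ← stackTape_pop]
  exact Frag.exec_act1 (ι := Idx m k) (.inr (.inr r)) (fun _ => none) (some Dir.right) s.phys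

theorem push (r : Reg) (b : Bool) (s : Store m k) :
    Run (push r b) s (s.set r (b :: s.reg r)) 2 := by
  have h := Frag.exec_seq
    (Frag.exec_act1 (ι := Idx m k) (.inr (.inr r)) id (some Dir.left) s.phys)
    (Frag.exec_act1 (ι := Idx m k) (.inr (.inr r)) (fun _ => some b) none _)
  unfold Run
  rw [Store.phys_set, ← stackTape_push]
  rw [Function.update_idem, Function.update_self] at h
  exact h

end Run

/-! ### Register routines -/

/-- The top is `1`. -/
def isOne (o : Option Bool) : Bool := o == some true

/-- The top is `0`. -/
def isZero (o : Option Bool) : Bool := o == some false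

/-- A truth value as the content of a register. -/
def flag (b : Bool) : List Bool := if b then [true] else []

@[simp] theorem flag_true : flag true = [true] := rfl
@[simp] theorem flag_false : flag false = [] := rfl
@[simp] theorem flag_tail (b : Bool) : (flag b).tail = [] := by cases b <;> rfl
@[simp] theorem isOne_some (b : Bool) : isOne (some b) = b := by cases b <;> rfl
@[simp] theorem isOne_none : isOne none = false := rfl
@[simp] theorem isZero_none : isZero none = false := rfl
@[simp] theorem isZero_some (b : Bool) : isZero (some b) = !b := by cases b <;> rfl

/-- Empty a register. -/
def clear (r : Reg) : Prog m k := whileR r Option.isSome (pop r)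

theorem Run.clear {r : Reg} {u : List Bool} {s : Store m k} (h : s.reg r = u) :
    Run (clear r) s (s.set r []) (2 * u.length + 1) := by
  induction u generalizing s with
  | nil => exact (Run.whileR_false (by simp [h])).conv (Store.set_self h).symm (by simp)
  | cons x u ih =>
    refine (Run.whileR_true (by simp [h]) (Run.pop r s) (ih (by simp [h]))).conv (by simp) ?_
    simp only [List.length_cons]; omega

/-- Move the top of `a` to `b`. -/
def shift (a b : Reg) : Prog m k :=
  ifR a isOne (block [pop a, push b true])
    (ifR a isZero (block [pop a, push b false]) (block []))

theorem Run.shift {a b : Reg} (hab : a ≠ b) {x : Bool} {u w : List Bool} {s : Store m k}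
    (ha : s.reg a = x :: u) (hb : s.reg b = w) :
    Run (shift a b) s ((s.set a u).set b (x :: w)) 5 := by
  cases x
  · exact (Run.ifR_false (by simp [ha]) (Run.ifR_true (by simp [ha]) (.cons (.pop _ _)
      (.cons (.push _ _ _) .nil)))).conv (by simp [ha, hb, hab.symm]) le_rfl
  · exact (Run.ifR_true (by simp [ha]) (.cons (.pop _ _)
      (.cons (.push _ _ _) .nil))).conv (by simp [ha, hb, hab.symm]) (by omega)

/-- Move the word in `a` to `b`, which reverses it. -/
def move (a b : Reg) : Prog m k := whileR a Option.isSome (shift a b)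

theorem Run.move {a b : Reg} (hab : a ≠ b) {u w : List Bool} {s : Store m k}
    (ha : s.reg a = u) (hb : s.reg b = w) :
    Run (move a b) s ((s.set a []).set b (u.reverse ++ w)) (6 * u.length + 1) := by
  induction u generalizing s w with
  | nil =>
    refine (Run.whileR_false (by simp [ha])).conv ?_ (by simp)
    rw [Store.set_self ha, Store.set_self (by simpa using hb)]
  | cons x u ih =>
    refine (Run.whileR_true (by simp [ha]) (.shift hab ha hb)
      (ih (w := x :: w) (by simp [hab]) (by simp))).conv ?_ ?_
    · refine Store.ext' ⟨by simp, by simp, fun r => ?_⟩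
      simp only [Store.set_reg]
      grind
    · simp only [List.length_cons]; omega

/-- Move the first `N` bits of `a` to `b`, in reverse order. -/
def shiftN (N : ℕ) (a b : Reg) : Prog m k := block (List.replicate N (shift a b))

theorem Run.shiftN {a b : Reg} (hab : a ≠ b) {N : ℕ} {v u w : List Bool} {s : Store m k}
    (hv : v.length = N) (ha : s.reg a = v ++ u) (hb : s.reg b = w) :
    Run (shiftN N a b) s ((s.set a u).set b (v.reverse ++ w)) (5 * N) := by
  subst hv
  induction v generalizing s w with
  | nil => exact Run.nil.conv (by simp_all [Store.set_self]) (by simp)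
  | cons x v ih =>
    refine (Run.cons (.shift hab ha hb) (ih (w := x :: w) (by simp [hab]) (by simp))).conv ?_ ?_
    · refine Store.ext' ⟨by simp, by simp, fun r => ?_⟩
      simp only [Store.set_reg]
      grind
    · simp only [List.length_cons]; omega

/-- Move the top of `t` to `a` and put a copy of it on `b`. -/
def shift2 (t a b : Reg) : Prog m k :=
  ifR t isOne (block [pop t, push a true, push b true])
    (ifR t isZero (block [pop t, push a false, push b false]) (block []))

theorem Run.shift2 {t a b : Reg} (hta : t ≠ a) (htb : t ≠ b) (hab : a ≠ b) {x : Bool}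
    {u v w : List Bool} {s : Store m k} (ht : s.reg t = x :: u) (ha : s.reg a = v)
    (hb : s.reg b = w) :
    Run (shift2 t a b) s (((s.set t u).set a (x :: v)).set b (x :: w)) 7 := by
  cases x
  · exact (Run.ifR_false (by simp [ht]) (Run.ifR_true (by simp [ht]) (.cons (.pop _ _)
      (.cons (.push _ _ _) (.cons (.push _ _ _) .nil))))).conv
      (by simp [ht, ha, hb, hab.symm, hta.symm, htb.symm]) le_rfl
  · exact (Run.ifR_true (by simp [ht]) (.cons (.pop _ _)
      (.cons (.push _ _ _) (.cons (.push _ _ _) .nil)))).conv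
      (by simp [ht, ha, hb, hab.symm, hta.symm, htb.symm]) (by omega)

/-- Put a copy of the word in `a` in front of that in `b`, with `t` as an auxiliary register. -/
def dup (a b t : Reg) : Prog m k :=
  block [move a t, whileR t Option.isSome (shift2 t a b)]

theorem Run.dup {t a b : Reg} (hta : t ≠ a) (htb : t ≠ b) (hab : a ≠ b) {u w : List Bool}
    {s : Store m k} (ht : s.reg t = []) (ha : s.reg a = u) (hb : s.reg b = w) :
    Run (dup a b t) s (s.set b (u ++ w)) (14 * u.length + 2) := by
  have key : ∀ (u v w : List Bool) (s : Store m k), s.reg t = u → s.reg a = v → s.reg b = w →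
      Run (whileR t Option.isSome (UniversalLearner.shift2 t a b)) s
        (((s.set t []).set a (u.reverse ++ v)).set b (u.reverse ++ w)) (8 * u.length + 1) := by
    intro u
    induction u with
    | nil =>
      intro v w s ht ha hb
      refine (Run.whileR_false (by simp [ht])).conv ?_ (by simp)
      refine Store.ext' ⟨by simp, by simp, fun r => ?_⟩
      simp only [Store.set_reg]
      grind
    | cons x u ih =>
      intro v w s ht ha hb
      refine (Run.whileR_true (by simp [ht]) (.shift2 hta htb hab ht ha hb)
        (ih (x :: v) (x :: w) _ (by simp [hta, htb]) (by simp [hab]) (by simp))).conv ?_ ?_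
      · refine Store.ext' ⟨by simp, by simp, fun r => ?_⟩
        simp only [Store.set_reg]
        grind
      · simp only [List.length_cons]; omega
  refine (Run.cons (.move hta.symm ha ht) (.cons (key (u.reverse) [] w _ (by simp)
    (by simp [hta.symm]) (by simp [hab.symm, htb.symm, hb])) .nil)).conv ?_ ?_
  · refine Store.ext' ⟨by simp, by simp, fun r => ?_⟩
    simp only [Store.set_reg]
    grind
  · simp only [List.length_reverse]; omega

/-! ### One step of the universal simulation -/

/-- Compare the unary number at the front of `d` with the current state in `st`; the result is left
in `fl`. -/
def cmpState : Prog m k :=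
  block [push .fl true,
    whileR .d isOne (block [pop .d, ifR .st Option.isSome (block [pop .st, push .a1 true])
      (pop .fl)]),
    pop .d, ifR .st Option.isSome (pop .fl) (block []), move .a1 .st]

theorem Run.cmpState {x q : ℕ} {rest : List Bool} {s : Store m k}
    (hd : s.reg .d = unary x ++ rest) (hst : s.reg .st = List.replicate q true)
    (ha : s.reg .a1 = []) (hfl : s.reg .fl = []) :
    Run cmpState s ((s.set .d rest).set .fl (flag (decide (x = q)))) (20 * (x + q + 1)) := by
  have key : ∀ (x q c : ℕ) (b : Bool) (s : Store m k),
      s.reg .d = unary x ++ rest → s.reg .st = List.replicate q true →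
      s.reg .a1 = List.replicate c true → s.reg .fl = flag b →
      Run (whileR .d isOne (block [UniversalLearner.pop .d, ifR .st Option.isSome
        (block [UniversalLearner.pop .st, UniversalLearner.push .a1 true])
        (UniversalLearner.pop .fl)])) s
        ((((s.set .d (false :: rest)).set .st (List.replicate (q - x) true)).set .a1
          (List.replicate (c + min x q) true)).set .fl (flag (b && decide (x ≤ q))))
        (6 * x + 1) := by
    intro x
    induction x with
    | zero =>
      intro q c b s hd hst ha hfl
      refine (Run.whileR_false (by simp [hd, unary])).conv ?_ (by simp)
      refine Store.ext' ⟨by simp, by simp, fun r => ?_⟩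
      simp only [unary, List.replicate_zero, List.nil_append, List.singleton_append] at hd
      simp only [Store.set_reg]
      split_ifs <;> simp_all
    | succ x ih =>
      intro q c b s hd hst ha hfl
      simp only [unary, List.replicate_succ, List.cons_append, List.append_assoc] at hd
      cases q with
      | zero =>
        refine (Run.whileR_true (by simp [hd]) (.cons (.pop _ _) (.cons (.ifR_false (by simp [hst])
          (.pop _ _)) .nil)) (ih 0 c false _ (by simp [hd, unary]) (by simp [hst])
          (by simp [ha]) (by simp [hfl]))).conv ?_ (by omega)
        refine Store.ext' ⟨by simp, by simp, fun r => ?_⟩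
        simp only [Store.set_reg]
        split_ifs <;> simp_all
      | succ q =>
        refine (Run.whileR_true (by simp [hd]) (.cons (.pop _ _) (.cons (.ifR_true
          (by simp [hst, List.replicate_succ])
          (.cons (.pop _ _) (.cons (.push _ _ _) .nil))) .nil)) (ih q (c + 1) b _
          (by simp [hd, unary]) (by simp [hst])
          (by simp [ha, List.replicate_succ]) (by simp [hfl]))).conv ?_ (by omega)
        refine Store.ext' ⟨by simp, by simp, fun r => ?_⟩
        simp only [Store.set_reg]
        split_ifs <;> simp_all
        omega
  have h1 := key x q 0 true (s.set .fl (true :: s.reg .fl)) (by simp [hd]) (by simp [hst])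
    (by simp [ha]) (by simp [hfl])
  clear key
  by_cases hxq : x < q
  · obtain ⟨c, rfl⟩ := Nat.exists_eq_add_of_lt hxq
    rw [show x + c + 1 - x = c + 1 by omega, show 0 + min x (x + c + 1) = x by omega,
      show (true && decide (x ≤ x + c + 1)) = true by simp; omega] at h1
    rw [show decide (x = x + c + 1) = false by simp; omega]
    refine (Run.cons (.push _ _ _) (.cons h1 (.cons (.pop _ _) (.cons (.ifR_true
      (by simp [List.replicate_succ]) (.pop _ _))
      (.cons (.move (u := List.replicate x true) (w := List.replicate (c + 1) true) (by simp)
        (by simp) (by simp)) .nil))))).conv ?_ ?_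
    · clear h1
      refine Store.ext' ⟨by simp, by simp, fun r => ?_⟩
      cases r <;> simp [hst, ha, hfl]
      omega
    · simp only [List.length_replicate]; omega
  · rw [show q - x = 0 by omega, show 0 + min x q = q by omega,
      show (true && decide (x ≤ q)) = decide (x = q) by simp; omega] at h1
    refine (Run.cons (.push _ _ _) (.cons h1 (.cons (.pop _ _) (.cons (.ifR_false (by simp) .nil)
      (.cons (.move (u := List.replicate q true) (w := []) (by simp)
        (by simp) (by simp)) .nil))))).conv ?_ ?_
    · clear h1
      refine Store.ext' ⟨by simp, by simp, fun r => ?_⟩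
      cases r <;> simp [hst, ha, hfl]
    · simp only [List.length_replicate]; omega

/-- Move the unary number at the front of `d` to `nx`. -/
def readState : Prog m k := block [whileR .d isOne (block [pop .d, push .nx true]), pop .d]

theorem Run.readState {x : ℕ} {rest : List Bool} {s : Store m k}
    (hd : s.reg .d = unary x ++ rest) (hn : s.reg .nx = []) :
    Run readState s ((s.set .d rest).set .nx (List.replicate x true)) (4 * x + 2) := by
  have key : ∀ (x c : ℕ) (s : Store m k),
      s.reg .d = unary x ++ rest → s.reg .nx = List.replicate c true →
      Run (whileR .d isOne (block [UniversalLearner.pop .d, UniversalLearner.push .nx true])) s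
        ((s.set .d (false :: rest)).set .nx (List.replicate (c + x) true))
        (4 * x + 1) := by
    intro x
    induction x with
    | zero =>
      intro c s hd hn
      refine (Run.whileR_false (by simp [hd, unary])).conv ?_ (by simp)
      refine Store.ext' ⟨by simp, by simp, fun r => ?_⟩
      simp only [unary, List.replicate_zero, List.nil_append, List.singleton_append] at hd
      simp only [Store.set_reg]
      split_ifs <;> simp_all
    | succ x ih =>
      intro c s hd hn
      simp only [unary, List.replicate_succ, List.cons_append, List.append_assoc] at hd
      refine (Run.whileR_true (by simp [hd]) (.cons (.pop _ _) (.cons (.push _ _ _) .nil))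
        (ih (c + 1) _ (by simp [hd, unary]) (by simp [hn, List.replicate_succ]))).conv ?_ (by omega)
      refine Store.ext' ⟨by simp, by simp, fun r => ?_⟩
      simp only [Store.set_reg]
      split_ifs <;> simp_all
      omega
  refine (Run.cons (key x 0 s hd (by simpa using hn)) (.cons (.pop _ _) .nil)).conv ?_ (by omega)
  refine Store.ext' ⟨by simp, by simp, fun r => ?_⟩
  simp only [Store.set_reg]
  split_ifs <;> simp_all

/-- Compare the symbol at the front of `d` with the scanned symbol of tape `j`; `fl` is cleared
if they differ. -/
def cmpHead (j : Fin (k + 1)) : Prog m k :=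
  ifR .d isOne
    (block [pop .d, ifR .d isOne (block [pop .d, ifT j isOne (block []) (pop .fl)])
      (block [pop .d, ifT j isZero (block []) (pop .fl)])])
    (block [pop .d, pop .d, ifT j Option.isNone (block []) (pop .fl)])

theorem Run.cmpHead {j : Fin (k + 1)} {o : Option Bool} {rest : List Bool} {b : Bool}
    {s : Store m k} (hd : s.reg .d = symbolBits o ++ rest) (hfl : s.reg .fl = flag b) :
    Run (cmpHead j) s ((s.set .d rest).set .fl (flag (b && decide ((s.sim j).head = o)))) 6 := by
  have hT : ∀ (c : Option Bool → Bool) (s : Store m k), s.reg .fl = flag b →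
      Run (ifT j c (block []) (UniversalLearner.pop .fl)) s
        (s.set .fl (flag (b && c (s.sim j).head))) 2 := by
    intro c s hfl
    cases hc : c (s.sim j).head
    · exact (Run.ifT_false hc (.pop _ _)).conv (by simp [hfl]) le_rfl
    · exact (Run.ifT_true hc .nil).conv (by rw [Store.set_self]; simp [hfl]) (by omega)
  have h0 : ∀ h : Option Bool, isOne h = decide (h = some true) := by decide
  have h1 : ∀ h : Option Bool, isZero h = decide (h = some false) := by decide
  have h2 : ∀ h : Option Bool, Option.isNone h = decide (h = none) := by decide
  rcases o with _ | _ | _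
  · simp only [symbolBits, List.cons_append, List.nil_append] at hd
    exact (Run.ifR_false (by simp [hd]) (.cons (.pop _ _) (.cons (.pop _ _)
      (.cons (hT _ _ (by simp [hfl])) .nil)))).conv (by simp [hd, h2]) (by omega)
  · simp only [symbolBits, List.cons_append, List.nil_append] at hd
    exact (Run.ifR_true (by simp [hd]) (.cons (.pop _ _) (.cons (.ifR_false (by simp [hd])
      (.cons (.pop _ _) (.cons (hT _ _ (by simp [hfl])) .nil))) .nil))).conv
      (by simp [hd, h1]) (by omega)
  · simp only [symbolBits, List.cons_append, List.nil_append] at hd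
    exact (Run.ifR_true (by simp [hd]) (.cons (.pop _ _) (.cons (.ifR_true (by simp [hd])
      (.cons (.pop _ _) (.cons (hT _ _ (by simp [hfl])) .nil))) .nil))).conv
      (by simp [hd, h0]) (by omega)

theorem Run.cmpHeads {g : Fin (k + 1) → Option Bool} {js : List (Fin (k + 1))}
    {rest : List Bool} {b : Bool} {s : Store m k}
    (hd : s.reg .d = (js.map g).flatMap symbolBits ++ rest) (hfl : s.reg .fl = flag b) :
    Run (block (js.map UniversalLearner.cmpHead)) s ((s.set .d rest).set .fl
      (flag (b && decide (∀ j ∈ js, (s.sim j).head = g j)))) (6 * js.length) := by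
  induction js generalizing b s with
  | nil =>
    refine Run.nil.conv ?_ (by simp)
    refine Store.ext' ⟨by simp, by simp, fun r => ?_⟩
    simp only [Store.set_reg]
    split_ifs <;> simp_all
  | cons j js ih =>
    simp only [List.map_cons, List.flatMap_cons, List.append_assoc] at hd
    refine (Run.cons (.cmpHead hd hfl) (ih (by simp) (by simp; rfl))).conv ?_ ?_
    · refine Store.ext' ⟨by simp, by simp, fun r => ?_⟩
      simp only [Store.set_reg, Store.set_sim, List.forall_mem_cons, Bool.decide_and,
        Bool.and_assoc]
      split_ifs <;> rfl
    · simp only [List.length_cons]; omega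

/-- Write the symbol at the front of `d` on tape `j`. -/
def writeHead (j : Fin (k + 1)) : Prog m k :=
  ifR .d isOne
    (block [pop .d, ifR .d isOne (block [pop .d, actT j (fun _ => some true) none])
      (block [pop .d, actT j (fun _ => some false) none])])
    (block [pop .d, pop .d, actT j (fun _ => none) none])

theorem Run.writeHead {j : Fin (k + 1)} {o : Option Bool} {rest : List Bool}
    {s : Store m k} (hd : s.reg .d = symbolBits o ++ rest) :
    Run (writeHead j) s
      ((s.set .d rest).setSim (Function.update s.sim j ((s.sim j).write o))) 5 := by
  rcases o with _ | _ | _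
  · simp only [symbolBits, List.cons_append, List.nil_append] at hd
    exact (Run.ifR_false (by simp [hd]) (.cons (.pop _ _) (.cons (.pop _ _)
      (.cons (.actT _ _ _ _) .nil)))).conv (by simp [hd, moveHead]) (by omega)
  · simp only [symbolBits, List.cons_append, List.nil_append] at hd
    exact (Run.ifR_true (by simp [hd]) (.cons (.pop _ _) (.cons (.ifR_false (by simp [hd])
      (.cons (.pop _ _) (.cons (.actT _ _ _ _) .nil))) .nil))).conv
      (by simp [hd, moveHead]) (by omega)
  · simp only [symbolBits, List.cons_append, List.nil_append] at hd
    exact (Run.ifR_true (by simp [hd]) (.cons (.pop _ _) (.cons (.ifR_true (by simp [hd])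
      (.cons (.pop _ _) (.cons (.actT _ _ _ _) .nil))) .nil))).conv
      (by simp [hd, moveHead]) (by omega)

/-- Carry out the head move at the front of `d` on tape `j`. -/
def moveHeadT (j : Fin (k + 1)) : Prog m k :=
  ifR .d isOne
    (block [pop .d, ifR .d isOne (block [pop .d, actT j id (some Dir.right)])
      (block [pop .d, actT j id (some Dir.left)])])
    (block [pop .d, pop .d, actT j id none])

theorem Run.moveHeadT {j : Fin (k + 1)} {o : Option Dir} {rest : List Bool}
    {s : Store m k} (hd : s.reg .d = moveBits o ++ rest) :
    Run (moveHeadT j) s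
      ((s.set .d rest).setSim (Function.update s.sim j (moveHead o (s.sim j)))) 5 := by
  rcases o with _ | _ | _
  · simp only [moveBits, List.cons_append, List.nil_append] at hd
    exact (Run.ifR_false (by simp [hd]) (.cons (.pop _ _) (.cons (.pop _ _)
      (.cons (.actT _ _ _ _) .nil)))).conv (by simp [hd]) (by omega)
  · simp only [moveBits, List.cons_append, List.nil_append] at hd
    exact (Run.ifR_true (by simp [hd]) (.cons (.pop _ _) (.cons (.ifR_false (by simp [hd])
      (.cons (.pop _ _) (.cons (.actT _ _ _ _) .nil))) .nil))).conv
      (by simp [hd]) (by omega)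
  · simp only [moveBits, List.cons_append, List.nil_append] at hd
    exact (Run.ifR_true (by simp [hd]) (.cons (.pop _ _) (.cons (.ifR_true (by simp [hd])
      (.cons (.pop _ _) (.cons (.actT _ _ _ _) .nil))) .nil))).conv
      (by simp [hd]) (by omega)

/-- Programs that treat the tapes one after the other, each consuming its part of `d`. -/
theorem Run.forTapes {α : Type} {P : Fin (k + 1) → Prog m k} {bits : α → List Bool}
    {f : α → Tape (Option Bool) → Tape (Option Bool)} {t : ℕ}
    (hP : ∀ (j : Fin (k + 1)) (o : α) (rest : List Bool) (s : Store m k),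
      s.reg .d = bits o ++ rest →
      Run (P j) s ((s.set .d rest).setSim (Function.update s.sim j (f o (s.sim j)))) t)
    {g : Fin (k + 1) → α} {js : List (Fin (k + 1))} (hjs : js.Nodup) {rest : List Bool}
    {s : Store m k} (hd : s.reg .d = (js.map g).flatMap bits ++ rest) :
    Run (block (js.map P)) s ((s.set .d rest).setSim
      fun j => if j ∈ js then f (g j) (s.sim j) else s.sim j) (t * js.length) := by
  induction js generalizing s with
  | nil =>
    refine Run.nil.conv ?_ (by simp)
    refine Store.ext' ⟨by simp, by simp, fun r => ?_⟩
    simp only [Store.set_reg, Store.setSim_reg]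
    split_ifs <;> simp_all
  | cons j js ih =>
    simp only [List.map_cons, List.flatMap_cons, List.append_assoc] at hd
    rw [List.nodup_cons] at hjs
    refine (Run.cons (hP _ _ _ _ hd) (ih hjs.2 (by simp))).conv ?_ ?_
    · refine Store.ext' ⟨by simp, ?_, fun r => ?_⟩
      · funext i
        by_cases hi : i = j
        · subst hi; simp [hjs.1]
        · simp [hi]
      · simp only [Store.set_reg, Store.setSim_reg]
        split_ifs <;> simp_all
    · simp only [List.length_cons]; ring_nf; omega

/-- Discard a prefix of `d`. -/
theorem Run.popN {v rest : List Bool} {s : Store m k} (hd : s.reg .d = v ++ rest) :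
    Run (block (List.replicate v.length (UniversalLearner.pop .d))) s (s.set .d rest)
      v.length := by
  induction v generalizing s with
  | nil => exact Run.nil.conv (by rw [Store.set_self (by simpa using hd)]) (by simp)
  | cons x v ih =>
    exact (Run.cons (.pop _ _) (ih (by simp [hd]))).conv (by simp) (by simp; omega)

/-- Treat the quintuple at the front of `d`: if no quintuple has been carried out yet (`fnd` is
empty) and it matches the configuration, carry it out. -/
def tryRule : Prog m k :=
  block [cmpState, block ((List.finRange (k + 1)).map cmpHead), readState,
    ifR .fnd Option.isSome (pop .fl) (block []),
    ifR .fl Option.isSome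
      (block [pop .fl, push .fnd true, clear .st, move .nx .st,
        block ((List.finRange (k + 1)).map writeHead),
        block ((List.finRange (k + 1)).map moveHeadT)])
      (block [clear .nx, block (List.replicate (4 * (k + 1)) (pop .d))])]

theorem Run.tryRule {r : Rule k} {q : ℕ} {f : Bool} {rest : List Bool} {s : Store m k}
    (hd : s.reg .d = r.encode ++ rest) (hst : s.reg .st = List.replicate q true)
    (ha : s.reg .a1 = []) (hfl : s.reg .fl = []) (hnx : s.reg .nx = [])
    (hf : s.reg .fnd = flag f) :
    Run tryRule s (if f = false ∧ r.state = q ∧ r.read = (fun j => (s.sim j).head) then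
      (((s.set .d rest).set .st (List.replicate r.next true)).set .fnd [true]).setSim
        fun j => moveHead (r.move j) ((s.sim j).write (r.write j)) else s.set .d rest)
      (30 * (k + 1) + 30 * (r.state + r.next + q + 1)) := by
  simp only [Rule.encode, List.append_assoc, List.ofFn_eq_map] at hd
  have hsl : ((List.map r.write (List.finRange (k + 1))).flatMap symbolBits ++
      (List.map r.move (List.finRange (k + 1))).flatMap moveBits).length = 4 * (k + 1) := by
    have h1 : ∀ o, (symbolBits o).length = 2 := by decide
    have h2 : ∀ o, (moveBits o).length = 2 := by rintro (_ | _ | _) <;> rfl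
    simp [List.length_flatMap, Function.comp_def, h1, h2]
    omega
  have hA := Run.cmpState hd hst ha hfl
  have hB := fun s' => Run.cmpHeads (m := m) (b := decide (r.state = q))
    (g := r.read) (js := List.finRange (k + 1)) (s := s')
    (rest := unary r.next ++ ((List.map r.write (List.finRange (k + 1))).flatMap symbolBits ++
      ((List.map r.move (List.finRange (k + 1))).flatMap moveBits ++ rest)))
  have hC := fun s' => Run.readState (m := m) (k := k) (s := s') (x := r.next)
    (rest := (List.map r.write (List.finRange (k + 1))).flatMap symbolBits ++
      ((List.map r.move (List.finRange (k + 1))).flatMap moveBits ++ rest))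
  have hread : (∀ j, (s.sim j).head = r.read j) ↔ r.read = fun j => (s.sim j).head :=
    ⟨fun h => funext fun j => (h j).symm, fun h j => by rw [h]⟩
  by_cases hit : f = false ∧ r.state = q ∧ r.read = (fun j => (s.sim j).head)
  · obtain ⟨rfl, h1, h2⟩ := hit
    have hW := fun s' rest => Run.forTapes (m := m) (bits := symbolBits)
      (f := fun o t => t.write o) (fun j o rest s h => Run.writeHead h) (g := r.write)
      (List.nodup_finRange (k + 1)) (rest := rest) (s := s')
    have hM := fun s' rest => Run.forTapes (m := m) (bits := moveBits)
      (f := fun o t => moveHead o t) (fun j o rest s h => Run.moveHeadT h) (g := r.move)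
      (List.nodup_finRange (k + 1)) (rest := rest) (s := s')
    refine (Run.cons hA (.cons (hB _ (by simp) (by simp)) (.cons (hC _ (by simp) (by simp [hnx])) (.cons (.ifR_false (by simp [hf]) .nil)
      (.cons (.ifR_true ?_ (.cons (.pop _ _) (.cons (.push _ _ _)
      (.cons (.clear (u := List.replicate q true) (by simp [hst])) (.cons
        (.move (u := List.replicate r.next true) (w := []) (by simp) (by simp) (by simp))
        (.cons (hW _ ((List.map r.move (List.finRange (k + 1))).flatMap moveBits ++ rest) ?_)
          (.cons (hM _ rest ?_) .nil)))))) ) .nil))))).conv ?_ ?_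
    · simp [h1, hread.2 h2]
    · simp
    · simp
    · rw [if_pos ⟨rfl, h1, h2⟩]
      refine Store.ext' ⟨by simp, by simp, fun r => ?_⟩
      cases r <;> simp [ha, hfl, hf, hnx]
    · simp only [List.length_replicate, List.length_finRange]; omega
  · have hfl' : ∃ b, s.reg .fl = b := ⟨_, rfl⟩
    have hD : ∀ s' : Store m k, s'.reg .fnd = flag f → s'.reg .fl = flag (decide (r.state = q) &&
        decide (∀ j ∈ List.finRange (k + 1), (s.sim j).head = r.read j)) →
        Run (ifR .fnd Option.isSome (UniversalLearner.pop .fl) (block [])) s' (s'.set .fl []) 2 := by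
      intro s' hs1 hs2
      cases f
      · refine (Run.ifR_false (by simp [hs1]) .nil).conv ?_ (by omega)
        rw [Store.set_self]
        rw [hs2]
        have : ¬ (r.state = q ∧ ∀ j, (s.sim j).head = r.read j) := by
          rw [hread]; exact fun h => hit ⟨rfl, h⟩
        rw [← Bool.decide_and]
        simp only [List.mem_finRange, true_imp_iff, this, decide_false, flag_false]
      · exact (Run.ifR_true (by simp [hs1]) (.pop _ _)).conv (by simp [hs2]) le_rfl
    refine (Run.cons hA (.cons (hB _ (by simp) (by simp)) (.cons (hC _ (by simp) (by simp [hnx])) (.cons (hD _ (by simp [hf]) (by simp))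
      (.cons (.ifR_false (by simp) (.cons (.clear (u := List.replicate r.next true) (by simp))
        (.cons (hsl ▸ Run.popN (rest := rest) (by simp)) .nil))) .nil))))).conv ?_ ?_
    · rw [if_neg hit]
      refine Store.ext' ⟨by simp, by simp, fun r => ?_⟩
      cases r <;> simp [hst, ha, hfl, hf, hnx]
    · simp only [List.length_replicate, List.length_finRange]; omega

/-- Carry out one step of the machine described in `desc`; afterwards, `fnd` tells whether a
quintuple applied. -/
def attempt : Prog m k :=
  block [clear .fnd, dup .desc .d .t1, whileR .d Option.isSome tryRule]

theorem Rule.encode_ne_nil (r : Rule k) : r.encode ≠ [] := by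
  simp [Rule.encode, unary]

theorem Rule.state_le (r : Rule k) : r.state ≤ r.encode.length := by
  simp [Rule.encode, unary]

theorem Rule.next_le (r : Rule k) : r.next ≤ r.encode.length := by
  simp [Rule.encode, unary]; omega

theorem Machine.length_rules_le (M : Machine k) : M.rules.length ≤ M.encode.length := by
  obtain ⟨rs⟩ := M
  simp only [Machine.encode]
  induction rs with
  | nil => simp
  | cons r rs ih =>
    have := List.length_pos_of_ne_nil (Rule.encode_ne_nil r)
    simp only [List.length_cons, List.flatMap_cons, List.length_append]
    omega

theorem Machine.length_encode_le {M : Machine k} {r : Rule k} (hr : r ∈ M.rules) :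
    r.encode.length ≤ M.encode.length := by
  obtain ⟨rs⟩ := M
  simp only [Machine.encode] at hr ⊢
  induction rs with
  | nil => simp at hr
  | cons r' rs ih =>
    simp only [List.flatMap_cons, List.length_append]
    rcases List.mem_cons.1 hr with rfl | h
    · omega
    · have := ih h; omega

theorem Machine.step_cons (r : Rule k) (rs : List (Rule k)) (c : Config k) :
    Machine.step ⟨r :: rs⟩ c = if r.state = c.state ∧ r.read = (fun j => (c.tape j).head) then
      some ⟨r.next, fun j => moveHead (r.move j) ((c.tape j).write (r.write j))⟩
      else Machine.step ⟨rs⟩ c := by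
  simp only [Machine.step, List.find?_cons]
  by_cases h : r.state = c.state ∧ r.read = (fun j => (c.tape j).head)
  · rw [if_pos h, decide_eq_true h]; rfl
  · rw [if_neg h, decide_eq_false h]

/-- Once a quintuple has been carried out, the remaining ones are only consumed. -/
theorem Run.tryRules_found {rs : List (Rule k)} {q E : ℕ} {s : Store m k}
    (hE : ∀ r ∈ rs, r.state ≤ E ∧ r.next ≤ E) (hq : q ≤ E)
    (hd : s.reg .d = rs.flatMap Rule.encode) (hst : s.reg .st = List.replicate q true)
    (ha : s.reg .a1 = []) (hfl : s.reg .fl = []) (hnx : s.reg .nx = [])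
    (hf : s.reg .fnd = [true]) :
    Run (whileR .d Option.isSome UniversalLearner.tryRule) s (s.set .d [])
      (rs.length * (30 * (k + 1) + 90 * E + 31) + 1) := by
  induction rs generalizing s with
  | nil => exact (Run.whileR_false (by simp [hd])).conv (Store.set_self hd).symm (by simp)
  | cons r rs ih =>
    have h1 := Run.tryRule (f := true) (rest := rs.flatMap Rule.encode) hd hst ha hfl hnx hf
    rw [if_neg (by simp)] at h1
    refine (Run.whileR_true ?_ h1 (ih (fun r hr => hE r (List.mem_cons_of_mem _ hr))
      (by simp) (by simp [hst]) (by simp [ha]) (by simp [hfl]) (by simp [hnx])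
      (by simp [hf]))).conv (by simp) ?_
    · rw [hd]
      obtain ⟨b, l, h⟩ := List.exists_cons_of_ne_nil (Rule.encode_ne_nil r)
      simp [h]
    · have := hE r List.mem_cons_self
      rw [List.length_cons, Nat.add_mul]
      omega

/-- Trying all quintuples in their order amounts to one step of the machine, since the first match is
carried out. -/
theorem Run.tryRules {rs : List (Rule k)} {c : Config k} {E : ℕ} {s : Store m k}
    (hE : ∀ r ∈ rs, r.state ≤ E ∧ r.next ≤ E) (hq : c.state ≤ E) (hsim : s.sim = c.tape)
    (hd : s.reg .d = rs.flatMap Rule.encode) (hst : s.reg .st = List.replicate c.state true)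
    (ha : s.reg .a1 = []) (hfl : s.reg .fl = []) (hnx : s.reg .nx = [])
    (hf : s.reg .fnd = []) :
    Run (whileR .d Option.isSome UniversalLearner.tryRule) s
      ((((s.set .d []).set .st (List.replicate ((Machine.step ⟨rs⟩ c).getD c).state true)).set .fnd
        (flag (Machine.step ⟨rs⟩ c).isSome)).setSim ((Machine.step ⟨rs⟩ c).getD c).tape)
      (rs.length * (30 * (k + 1) + 90 * E + 31) + 1) := by
  induction rs generalizing s with
  | nil =>
    refine (Run.whileR_false (by simp [hd])).conv ?_ (by simp)
    refine Store.ext' ⟨by simp, by simp [Machine.step, hsim], fun r => ?_⟩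
    have hs0 : Machine.step (⟨[]⟩ : Machine k) c = none := rfl
    simp only [List.flatMap_nil] at hd
    rw [hs0]
    cases r <;> simp [hd, hst, hf]
  | cons r rs ih =>
    have hE' : ∀ r ∈ rs, r.state ≤ E ∧ r.next ≤ E := fun r hr => hE r (List.mem_cons_of_mem _ hr)
    have h1 := Run.tryRule (f := false) (rest := rs.flatMap Rule.encode) hd hst ha hfl hnx hf
    have hne : Option.isSome (s.reg .d).head? = true := by
      rw [hd]
      obtain ⟨b, l, h⟩ := List.exists_cons_of_ne_nil (Rule.encode_ne_nil r)
      simp [h]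
    have hEr := hE r List.mem_cons_self
    rw [Machine.step_cons]
    by_cases hit : r.state = c.state ∧ r.read = (fun j => (c.tape j).head)
    · rw [if_pos ⟨rfl, hsim ▸ hit⟩] at h1
      rw [if_pos hit]
      refine (Run.whileR_true hne h1 (Run.tryRules_found hE' hEr.2 (by simp) (by simp)
        (by simp [ha]) (by simp [hfl]) (by simp [hnx]) (by simp))).conv ?_ ?_
      · refine Store.ext' ⟨by simp, by simp [hsim], fun r => ?_⟩
        cases r <;> simp
      · rw [List.length_cons, Nat.add_mul]
        omega
    · rw [if_neg (fun h => hit (hsim ▸ h.2))] at h1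
      rw [if_neg hit]
      refine (Run.whileR_true hne h1 (ih hE' (by simp [hsim]) (by simp) (by simp [hst])
        (by simp [ha]) (by simp [hfl]) (by simp [hnx])
        (by simp [hf]))).conv (by simp) ?_
      rw [List.length_cons, Nat.add_mul]
      omega

/-- One step costs quadratic time in the length of the description: there are at most `E`
quintuples, whose unary states are at most `E`. -/
theorem Run.attempt {M : Machine k} {c : Config k} {E : ℕ} {f : Bool} {s : Store m k}
    (hE : M.encode.length ≤ E) (hq : c.state ≤ E) (hsim : s.sim = c.tape)
    (hdesc : s.reg .desc = M.encode) (hd : s.reg .d = []) (ht : s.reg .t1 = [])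
    (hst : s.reg .st = List.replicate c.state true)
    (ha : s.reg .a1 = []) (hfl : s.reg .fl = []) (hnx : s.reg .nx = [])
    (hf : s.reg .fnd = flag f) :
    Run attempt s
      (((s.set .st (List.replicate ((M.step c).getD c).state true)).set .fnd
        (flag (M.step c).isSome)).setSim ((M.step c).getD c).tape)
      (200 * (k + 1) * (E + 1) ^ 2) := by
  have hr : ∀ r ∈ M.rules, r.state ≤ E ∧ r.next ≤ E := fun r hr =>
    ⟨(Rule.state_le r).trans ((Machine.length_encode_le hr).trans hE),
      (Rule.next_le r).trans ((Machine.length_encode_le hr).trans hE)⟩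
  have h1 := fun s' => Run.tryRules (m := m) (c := c) (s := s') hr hq
  refine (Run.cons (.clear hf) (.cons (.dup (by simp) (by simp) (by simp) (w := [])
    (by simp [ht]) (by simp [hdesc]; rfl) (by simp [hd])) (.cons (h1 _ (by simp [hsim])
    (by simp [Machine.encode]) (by simp [hst]) (by simp [ha]) (by simp [hfl]) (by simp [hnx])
    (by simp)) .nil))).conv ?_ ?_
  · refine Store.ext' ⟨by simp, by simp, fun r => ?_⟩
    cases r <;> simp [hd]
  · have h2 := (Machine.length_rules_le M).trans hE
    have h3 : (flag f).length ≤ 1 := by cases f <;> simp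
    have h4 : M.rules.length * (30 * (k + 1) + 90 * E + 31) ≤
        E * (30 * (k + 1) + 90 * E + 31) := Nat.mul_le_mul_right _ h2
    have h5 : M.encode.length ≤ E := hE
    nlinarith [Nat.zero_le (k * E), Nat.zero_le (k * E ^ 2), Nat.zero_le (E ^ 2)]

/-- Run the machine described in `desc` for as many steps as `clk` is long. -/
def simulate : Prog m k :=
  block [dup .clk .ck .t1, whileR .ck Option.isSome (block [pop .ck, attempt])]

theorem Machine.state_step_le {M : Machine k} {c : Config k} {E : ℕ} (hE : M.encode.length ≤ E)
    (hc : c.state ≤ E) : ((M.step c).getD c).state ≤ E := by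
  rcases h : M.step c with _ | c'
  · exact hc
  · simp only [Machine.step, Option.map_eq_some_iff] at h
    obtain ⟨r, hr, rfl⟩ := h
    exact (Rule.next_le r).trans
      ((Machine.length_encode_le (List.mem_of_find?_eq_some hr)).trans hE)

theorem Run.attempts {M : Machine k} {E : ℕ} (hE : M.encode.length ≤ E) (v : List Bool)
    {c : Config k} (x : Bool) {f : Bool} {s : Store m k} (hq : c.state ≤ E) (hsim : s.sim = c.tape)
    (hdesc : s.reg .desc = M.encode) (hd : s.reg .d = []) (ht : s.reg .t1 = [])
    (hst : s.reg .st = List.replicate c.state true)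
    (ha : s.reg .a1 = []) (hfl : s.reg .fl = []) (hnx : s.reg .nx = [])
    (hf : s.reg .fnd = flag f) (hck : s.reg .ck = x :: v) :
    Run (whileR .ck Option.isSome (block [UniversalLearner.pop .ck, UniversalLearner.attempt])) s
      ((((s.set .ck []).set .st (List.replicate
        ((fun c => (M.step c).getD c)^[v.length + 1] c).state true)).set .fnd
        (flag (M.step ((fun c => (M.step c).getD c)^[v.length] c)).isSome)).setSim
        ((fun c => (M.step c).getD c)^[v.length + 1] c).tape)
      ((v.length + 1) * (200 * (k + 1) * (E + 1) ^ 2 + 2) + 1) := by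
  induction v generalizing c x f s with
  | nil =>
    refine (Run.whileR_true (by simp [hck]) (.cons (.pop _ _) (.cons (.attempt hE hq (f := f)
      (by simp [hsim]) (by simp [hdesc]) (by simp [hd]) (by simp [ht]) (by simp [hst])
      (by simp [ha]) (by simp [hfl]) (by simp [hnx]) (by simp [hf])) .nil))
      (.whileR_false (by simp [hck]))).conv ?_ ?_
    · refine Store.ext' ⟨by simp, by simp, fun r => ?_⟩
      cases r <;> simp [hck]
    · simp only [List.length_nil]; omega
  | cons y v ih =>
    refine (Run.whileR_true (by simp [hck]) (.cons (.pop _ _) (.cons (.attempt hE hq (f := f)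
      (by simp [hsim]) (by simp [hdesc]) (by simp [hd]) (by simp [ht]) (by simp [hst])
      (by simp [ha]) (by simp [hfl]) (by simp [hnx]) (by simp [hf])) .nil))
      (ih (c := (M.step c).getD c) y (f := (M.step c).isSome) (Machine.state_step_le hE hq)
        (by simp) (by simp [hdesc]) (by simp [hd]) (by simp [ht]) (by simp)
        (by simp [ha]) (by simp [hfl]) (by simp [hnx]) (by simp) (by simp [hck]))).conv ?_ ?_
    · refine Store.ext' ⟨by simp, by simp, fun r => ?_⟩
      cases r <;> simp
    · simp only [List.length_cons]
      rw [Nat.add_mul (v.length + 1) 1]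
      omega

/-- With `T + 1` steps on the clock, `fnd` tells in the end whether the machine was still running
after `T` steps; if it was not, the last step has changed nothing. -/
theorem Run.simulate {M : Machine k} {E T : ℕ} (hE : M.encode.length ≤ E) (w : List Bool)
    {f : Bool} {s : Store m k} (hsim : s.sim = (Machine.init k w).tape)
    (hdesc : s.reg .desc = M.encode) (hd : s.reg .d = []) (ht : s.reg .t1 = [])
    (hst : s.reg .st = []) (ha : s.reg .a1 = []) (hfl : s.reg .fl = []) (hnx : s.reg .nx = [])
    (hf : s.reg .fnd = flag f) (hck : s.reg .ck = [])
    (hclk : s.reg .clk = List.replicate (T + 1) true) :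
    Run simulate s
      (((s.set .st (List.replicate (M.run w (T + 1)).state true)).set .fnd
        (flag (M.step (M.run w T)).isSome)).setSim (M.run w (T + 1)).tape)
      ((T + 1) * (216 * (k + 1) * (E + 1) ^ 2) + 3) := by
  have h1 := fun s' => Run.attempts (m := m) hE (List.replicate T true) (c := Machine.init k w)
    true (f := f) (s := s') (by simp [Machine.init])
  refine (Run.cons (.dup (by simp) (by simp) (by simp) ht hclk hck)
    (.cons (h1 _ (by simp [hsim]) (by simp [hdesc]) (by simp [hd]) (by simp [ht])
    (by simp [hst, Machine.init]) (by simp [ha]) (by simp [hfl]) (by simp [hnx]) (by simp [hf])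
    (by simp [List.replicate_succ])) .nil)).conv ?_ ?_
  · simp only [List.length_replicate]
    refine Store.ext' ⟨by simp, by simp [Machine.run], fun r => ?_⟩
    cases r <;> simp [hck, Machine.run]
  · simp only [List.length_replicate]
    have : 1 ≤ (k + 1) * (E + 1) ^ 2 := Nat.one_le_iff_ne_zero.2 (by positivity)
    nlinarith [Nat.mul_le_mul_left (T + 1) this]

/-! ### Validation of descriptions -/

/-- Report that the description is not valid. -/
def fail : Prog m k := block [clear .d, ifR .bad Option.isSome (block []) (push .bad true)]

/-- `P` removes from the front of `d` what `f` removes, and reports failure if `f` fails, in time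
linear in the length of `d` with factor `c`. -/
def Checks (P : Prog m k) (f : List Bool → Option (List Bool)) (c : ℕ) : Prop :=
  (∀ u v, f u = some v → v.length ≤ u.length) ∧
    ∀ (s : Store m k) (b : Bool), s.reg .bad = flag b →
      Run P s (match f (s.reg .d) with
        | some v => s.set .d v
        | none => (s.set .d []).set .bad [true]) (c * ((s.reg .d).length + 1))

theorem Run.fail {s : Store m k} {b : Bool} (hb : s.reg .bad = flag b) :
    Run fail s ((s.set .d []).set .bad [true]) (2 * (s.reg .d).length + 4) := by
  cases b
  · exact (Run.cons (.clear rfl) (.cons (.ifR_false (by simp [hb]) (.push _ _ _)) .nil)).conv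
      (by simp [hb]) (by omega)
  · exact (Run.cons (.clear rfl) (.cons (.ifR_true (by simp [hb]) .nil) .nil)).conv
      (by rw [Store.set_self (r := .bad)]; simp [hb]) (by omega)

theorem Checks.nil : Checks (block [] : Prog m k) some 1 :=
  ⟨by simp, fun s _ _ => Run.nil.conv (Store.set_self rfl).symm (by omega)⟩

theorem Checks.cons {P : Prog m k} {Ps : List (Prog m k)} {f g : List Bool → Option (List Bool)}
    {c c' : ℕ} (hP : Checks P f c) (hPs : Checks (block Ps) g c') :
    Checks (block (P :: Ps)) (fun u => (f u).bind g) (c + c') := by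
  refine ⟨fun u v h => ?_, fun s b hb => ?_⟩
  · obtain ⟨w, hw, h⟩ := Option.bind_eq_some_iff.1 h
    exact (hPs.1 _ _ h).trans (hP.1 _ _ hw)
  · have h1 := hP.2 s b hb
    rcases hf : f (s.reg .d) with _ | v
    · simp only [hf] at h1
      have h2 := hPs.2 _ true (h1 |> fun _ => show ((s.set .d []).set .bad [true]).reg .bad =
        flag true by simp)
      refine (Run.cons h1 h2).conv ?_ ?_
      · rcases hg : g [] with _ | v
        · simp [hg, hf]
          refine Store.ext' ⟨by simp, by simp, fun r => ?_⟩
          cases r <;> simp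
        · have hv := hPs.1 _ _ hg
          have : v = [] := by simpa using hv
          subst this
          simp [hg, hf]
          refine Store.ext' ⟨by simp, by simp, fun r => ?_⟩
          cases r <;> simp
      · simp; nlinarith
    · simp only [hf] at h1
      have h2 := hPs.2 (s.set .d v) b (by simp [hb])
      refine (Run.cons h1 h2).conv ?_ ?_
      · simp only [Store.set_reg, if_true]
        rcases hg : g v with _ | w
        · simp [hf, hg]
        · simp [hf, hg]
      · have := hP.1 _ _ hf
        simp
        nlinarith

/-- Remove a unary number from the front of a word. -/
def dropUnary (u : List Bool) : Option (List Bool) :=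
  match u.dropWhile id with
  | false :: v => some v
  | _ => none

/-- Check for a unary number. -/
def chkUnary : Prog m k :=
  block [whileR .d isOne (pop .d), ifR .d isZero (pop .d) fail]

theorem checks_chkUnary : Checks (chkUnary : Prog m k) dropUnary 7 := by
  have hlen : ∀ u : List Bool, (u.dropWhile id).length ≤ u.length := fun u =>
    (List.dropWhile_sublist id).length_le
  refine ⟨fun u v h => ?_, fun s b hb => ?_⟩
  · have h1 := hlen u
    unfold dropUnary at h
    split at h
    · rename_i h2
      simp only [Option.some.injEq] at h
      subst h
      rw [h2, List.length_cons] at h1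
      omega
    · simp at h
  · have key : ∀ (u : List Bool) (s : Store m k), s.reg .d = u →
        Run (whileR .d isOne (pop .d)) s (s.set .d (u.dropWhile id)) (2 * u.length + 1) := by
      intro u
      induction u with
      | nil =>
        intro s hs
        exact (Run.whileR_false (by simp [hs])).conv (Store.set_self hs).symm (by simp)
      | cons x u ih =>
        intro s hs
        cases x
        · exact (Run.whileR_false (by simp [hs])).conv (Store.set_self hs).symm (by simp)
        · exact (Run.whileR_true (by simp [hs]) (.pop _ _) (ih _ (by simp [hs]))).conv
            (by simp) (by simp; omega)
    have h1 := key _ s rfl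
    have h2 := hlen (s.reg .d)
    unfold dropUnary
    rcases hu : (s.reg .d).dropWhile id with _ | ⟨_ | _, v⟩
    · rw [hu] at h1
      exact (Run.cons h1 (.cons (.ifR_false (by simp) (.fail (b := b) (by simp [hb])))
        .nil)).conv (by simp) (by simp; omega)
    · rw [hu] at h1
      exact (Run.cons h1 (.cons (.ifR_true (by simp) (.pop _ _)) .nil)).conv (by simp)
        (by omega)
    · exfalso
      have := List.head_dropWhile_not id (l := s.reg .d) (by simp [hu])
      simp [hu] at this

/-- Remove a pair of bits that stands for a symbol, or for a move, from the front of a word. -/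
def dropPair : List Bool → Option (List Bool)
  | true :: _ :: v => some v
  | false :: false :: v => some v
  | _ => none

/-- Check for a pair of bits that stands for a symbol, or for a move. -/
def chkPair : Prog m k :=
  ifR .d isOne (block [pop .d, ifR .d Option.isSome (pop .d) fail])
    (ifR .d isZero (block [pop .d, ifR .d isZero (pop .d) fail]) fail)

theorem checks_chkPair : Checks (chkPair : Prog m k) dropPair 8 := by
  refine ⟨fun u v h => ?_, fun s b hb => ?_⟩
  · unfold dropPair at h
    split at h <;> simp at h <;> subst h <;> simp <;> omega
  · rcases hd : s.reg .d with _ | ⟨_ | _, _ | ⟨y, v⟩⟩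
    · exact (Run.ifR_false (by simp [hd]) (.ifR_false (by simp [hd])
        (.fail hb))).conv (by simp [dropPair]) (by simp [hd])
    · exact (Run.ifR_false (by simp [hd]) (.ifR_true (by simp [hd])
        (.cons (.pop _ _) (.cons (.ifR_false (by simp [hd]) (.fail (b := b) (by simp [hb])))
        .nil)))).conv (by simp [dropPair, hd]) (by simp [hd])
    · cases y
      · exact (Run.ifR_false (by simp [hd]) (.ifR_true (by simp [hd])
          (.cons (.pop _ _) (.cons (.ifR_true (by simp [hd]) (.pop _ _))
          .nil)))).conv (by simp [dropPair, hd]) (by simp; omega)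
      · exact (Run.ifR_false (by simp [hd]) (.ifR_true (by simp [hd])
          (.cons (.pop _ _) (.cons (.ifR_false (by simp [hd]) (.fail (b := b) (by simp [hb])))
          .nil)))).conv (by simp [dropPair, hd]) (by simp [hd]; omega)
    · exact (Run.ifR_true (by simp [hd])
        (.cons (.pop _ _) (.cons (.ifR_false (by simp [hd]) (.fail (b := b) (by simp [hb])))
        .nil))).conv (by simp [dropPair, hd]) (by simp [hd])
    · exact (Run.ifR_true (by simp [hd])
        (.cons (.pop _ _) (.cons (.ifR_true (by simp [hd]) (.pop _ _))
        .nil))).conv (by simp [dropPair, hd]) (by simp; omega)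

/-- Remove `n` pairs of bits. -/
def dropPairs : ℕ → List Bool → Option (List Bool)
  | 0 => some
  | n + 1 => fun u => (dropPair u).bind (dropPairs n)

theorem checks_chkPairs (n : ℕ) :
    Checks (block (List.replicate n chkPair) : Prog m k) (dropPairs n) (8 * n + 1) := by
  induction n with
  | zero => exact Checks.nil
  | succ n ih =>
    have := checks_chkPair.cons ih
    rwa [show 8 + (8 * n + 1) = 8 * (n + 1) + 1 by ring] at this

/-- Remove a quintuple. -/
def dropRule (k : ℕ) (u : List Bool) : Option (List Bool) :=
  (dropUnary u).bind fun u => (dropPairs (k + 1) u).bind fun u => (dropUnary u).bind fun u =>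
    (dropPairs (2 * (k + 1)) u).bind some

/-- Check for a quintuple. -/
def chkRule : Prog m k :=
  block [chkUnary, block (List.replicate (k + 1) chkPair), chkUnary,
    block (List.replicate (2 * (k + 1)) chkPair)]

theorem checks_chkRule : Checks (chkRule : Prog m k) (dropRule k) (24 * k + 41) := by
  have := checks_chkUnary.cons ((checks_chkPairs (m := m) (k := k) (k + 1)).cons
    (checks_chkUnary.cons ((checks_chkPairs (2 * (k + 1))).cons .nil)))
  rwa [show 7 + (8 * (k + 1) + 1 + (7 + (8 * (2 * (k + 1)) + 1 + 1))) = 24 * k + 41 by ring]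
    at this

theorem dropUnary_eq_some {u v : List Bool} :
    dropUnary u = some v ↔ ∃ x, u = unary x ++ v := by
  induction u with
  | nil => simp [dropUnary, unary]
  | cons b u ih =>
    cases b
    · simp only [dropUnary, List.dropWhile_cons, id, Bool.false_eq_true, if_false,
        Option.some.injEq]
      constructor
      · rintro rfl; exact ⟨0, by simp [unary]⟩
      · rintro ⟨_ | x, h⟩
        · simpa [unary] using h
        · simp [unary, List.replicate_succ] at h
    · have : dropUnary (true :: u) = dropUnary u := by simp [dropUnary]
      rw [this, ih]
      constructor
      · rintro ⟨x, rfl⟩; exact ⟨x + 1, by simp [unary, List.replicate_succ]⟩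
      · rintro ⟨_ | x, h⟩
        · simp [unary] at h
        · exact ⟨x, by simpa [unary, List.replicate_succ] using h⟩

theorem dropPairs_eq_some {n : ℕ} {u v : List Bool} :
    dropPairs n u = some v ↔ ∃ l : List (Option Bool), l.length = n ∧
      u = l.flatMap symbolBits ++ v := by
  have h1 : ∀ {u v : List Bool}, dropPair u = some v ↔ ∃ o, u = symbolBits o ++ v := by
    intro u v
    constructor
    · intro h
      unfold dropPair at h
      split at h
      · rename_i b v'
        simp only [Option.some.injEq] at h
        exact ⟨some b, by simp [symbolBits, h]⟩
      · simp only [Option.some.injEq] at h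
        exact ⟨none, by simp [symbolBits, h]⟩
      · simp at h
    · rintro ⟨_ | b, rfl⟩ <;> rfl
  induction n generalizing u with
  | zero => simp [dropPairs, List.length_eq_zero_iff]
  | succ n ih =>
    simp only [dropPairs, Option.bind_eq_some_iff, h1, ih]
    constructor
    · rintro ⟨w, ⟨o, rfl⟩, l, rfl, rfl⟩
      exact ⟨o :: l, rfl, by simp⟩
    · rintro ⟨_ | ⟨o, l⟩, h, rfl⟩
      · simp at h
      · exact ⟨l.flatMap symbolBits ++ v, ⟨o, by simp⟩, l, by simpa using h, rfl⟩

theorem dropRule_eq_some {u v : List Bool} :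
    dropRule k u = some v ↔ ∃ r : Rule k, u = r.encode ++ v := by
  simp only [dropRule, Option.bind_eq_some_iff, dropUnary_eq_some, dropPairs_eq_some]
  constructor
  · rintro ⟨_, ⟨x, rfl⟩, _, ⟨l, hl, rfl⟩, _, ⟨y, rfl⟩, _, ⟨l', hl', rfl⟩, h⟩
    simp only [Option.some.injEq] at h
    subst h
    let dir : Option Bool → Option Dir := fun o => o.map fun b => if b then .right else .left
    have hdir : ∀ o, moveBits (dir o) = symbolBits o := by rintro (_ | _ | _) <;> rfl
    refine ⟨⟨x, fun i => l[i], y, fun i => l'[(i : ℕ)]'(by omega),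
      fun i => dir (l'[(k + 1 + i : ℕ)]'(by omega))⟩, ?_⟩
    have e1 : List.ofFn (fun i : Fin (k + 1) => l[i]) = l :=
      List.ext_getElem (by simp [hl]) (fun i _ _ => List.getElem_ofFn _)
    have e2 : List.ofFn (fun i : Fin (k + 1) => l'[(i : ℕ)]'(by omega)) = l'.take (k + 1) :=
      List.ext_getElem (by simp [hl']) (fun i _ _ => by
        rw [List.getElem_ofFn, List.getElem_take])
    have e3 : List.ofFn (fun i : Fin (k + 1) => dir (l'[(k + 1 + i : ℕ)]'(by omega))) =
        (l'.drop (k + 1)).map dir :=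
      List.ext_getElem (by simp [hl']; omega) (fun i _ _ => by
        rw [List.getElem_ofFn, List.getElem_map, List.getElem_drop])
    have e4 : ((l'.drop (k + 1)).map dir).flatMap moveBits =
        (l'.drop (k + 1)).flatMap symbolBits := by
      rw [List.flatMap_map]; simp [hdir]
    simp only [Rule.encode, e1, e2, e3, e4, List.append_assoc]
    rw [← List.append_assoc (List.flatMap symbolBits (l'.take _)), ← List.flatMap_append,
      List.take_append_drop]
  · rintro ⟨r, rfl⟩
    let sym : Option Dir → Option Bool := fun o => o.map fun d => decide (d = .right)
    have hsym : ∀ o, symbolBits (sym o) = moveBits o := by rintro (_ | _ | _) <;> rfl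
    refine ⟨_, ⟨r.state, by rw [Rule.encode, List.append_assoc]⟩, _, ⟨List.ofFn r.read, by simp, by rw [List.append_assoc]⟩, _,
      ⟨r.next, by rw [List.append_assoc]⟩, _, ⟨List.ofFn r.write ++ (List.ofFn r.move).map sym, by simp; omega, ?_⟩, rfl⟩
    rw [List.flatMap_append, List.flatMap_map]
    simp only [hsym, List.append_assoc]

/-- Replace the word in `desc` by `[]` if it does not describe a machine. -/
def validate : Prog m k :=
  block [dup .desc .d .t1, whileR .d Option.isSome chkRule,
    ifR .bad Option.isSome (block [pop .bad, clear .desc]) (block [])]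

open Classical in
/-- The machine without quintuples, which stands for the words that describe none, has the
description `[]`. -/
theorem Machine.encode_decode (w : List Bool) :
    (Machine.decode k w).encode = if ∃ M : Machine k, M.encode = w then w else [] := by
  split_ifs with h
  · obtain ⟨M, rfl⟩ := h
    rw [Machine.decode_encode]
  · rw [Machine.decode, Function.extend_apply' _ _ _ h]
    rfl

/-- Descriptions can be parsed from left to right, one quintuple at a time. -/
theorem encode_append_valid (r : Rule k) (v : List Bool) :
    (∃ M : Machine k, M.encode = r.encode ++ v) ↔ ∃ M : Machine k, M.encode = v := by
  constructor
  · rintro ⟨⟨_ | ⟨r', rs⟩⟩, h⟩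
    · exact absurd (List.append_eq_nil_iff.1 h.symm).1 (Rule.encode_ne_nil r)
    · simp only [Machine.encode, List.flatMap_cons] at h
      exact ⟨⟨rs⟩, (Rule.encode_append_inj h).2⟩
  · rintro ⟨M, rfl⟩
    exact ⟨⟨r :: M.rules⟩, rfl⟩

open Classical in
theorem Run.chkRules {w : List Bool} {s : Store m k} (hd : s.reg .d = w)
    (hb : s.reg .bad = []) :
    Run (whileR .d Option.isSome UniversalLearner.chkRule) s
      ((s.set .d []).set .bad (flag !decide (∃ M : Machine k, M.encode = w)))
      (w.length * ((24 * k + 41) * (w.length + 1) + 1) + 2) := by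
  induction hn : w.length using Nat.strong_induction_on generalizing w s with
  | _ n ih =>
    subst hn
    rcases w with _ | ⟨x, w⟩
    · have : ∃ M : Machine k, M.encode = [] := ⟨⟨[]⟩, rfl⟩
      refine (Run.whileR_false (by simp [hd])).conv ?_ (by simp)
      refine Store.ext' ⟨by simp, by simp, fun r => ?_⟩
      cases r <;> simp [hd, hb, this]
    · have h1 := (checks_chkRule (m := m) (k := k)).2 s false (by simp [hb])
      rw [hd] at h1
      rcases hr : dropRule k (x :: w) with _ | v
      · simp only [hr] at h1
        have hv : ¬ ∃ M : Machine k, M.encode = x :: w := by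
          rintro ⟨⟨_ | ⟨r', rs⟩⟩, h⟩
          · simp [Machine.encode] at h
          · have : dropRule k (x :: w) = some (Machine.encode ⟨rs⟩) :=
              dropRule_eq_some.2 ⟨r', h.symm⟩
            simp [this] at hr
        refine (Run.whileR_true (by simp [hd]) h1 (.whileR_false (by simp))).conv
          (by simp [hv]) ?_
        simp only [List.length_cons]
        nlinarith [Nat.zero_le (w.length * ((24 * k + 41) * (w.length + 1 + 1) + 1))]
      · simp only [hr] at h1
        obtain ⟨r, h2⟩ := dropRule_eq_some.1 hr
        have hlt : v.length < (x :: w).length := by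
          rw [h2, List.length_append]
          have := List.length_pos_of_ne_nil (Rule.encode_ne_nil r)
          omega
        refine (Run.whileR_true (by simp [hd]) h1 (ih _ hlt (w := v) (by simp) (by simp [hb])
          rfl)).conv ?_ ?_
        · rw [h2]
          simp only [encode_append_valid]
          refine Store.ext' ⟨by simp, by simp, fun r => ?_⟩
          cases r <;> simp
        · have h3 : v.length + 1 ≤ (x :: w).length := hlt
          set n := (x :: w).length
          have h4 : v.length * ((24 * k + 41) * (v.length + 1) + 1) ≤
              v.length * ((24 * k + 41) * (n + 1) + 1) := by gcongr
          have h5 : (v.length + 1) * ((24 * k + 41) * (n + 1) + 1) ≤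
              n * ((24 * k + 41) * (n + 1) + 1) := Nat.mul_le_mul_right _ h3
          rw [Nat.add_mul] at h5
          omega

theorem Run.validate {w : List Bool} {s : Store m k} (hw : s.reg .desc = w) (hd : s.reg .d = [])
    (ht : s.reg .t1 = []) (hb : s.reg .bad = []) :
    Run validate s (s.set .desc (Machine.decode k w).encode)
      (60 * (k + 1) * (w.length + 1) ^ 2) := by
  classical
  have ht' : ∀ x, 14 * x + 2 + (x * ((24 * k + 41) * (x + 1) + 1) + 2 + (1 + (2 * x + 1) + 1)) ≤
      60 * (k + 1) * (x + 1) ^ 2 := by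
    intro x
    nlinarith [Nat.zero_le (k * x), Nat.zero_le (k * x ^ 2)]
  have h1 := fun s' => Run.chkRules (m := m) (k := k) (w := w) (s := s')
  rw [Machine.encode_decode]
  by_cases hv : ∃ M : Machine k, M.encode = w
  · rw [if_pos hv, Store.set_self hw]
    refine (Run.cons (.dup (by simp) (by simp) (by simp) ht hw hd) (.cons (h1 _ (by simp)
      (by simp [hb])) (.cons (.ifR_false (by simp [hv]) .nil) .nil))).conv ?_ ?_
    · refine Store.ext' ⟨by simp, by simp, fun r => ?_⟩
      cases r <;> simp [hd, hb, hv]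
    · refine le_trans ?_ (ht' _); omega
  · rw [if_neg hv]
    refine (Run.cons (.dup (by simp) (by simp) (by simp) ht hw hd) (.cons (h1 _ (by simp)
      (by simp [hb])) (.cons (.ifR_true (by simp [hv]) (.cons (.pop _ _) (.cons (.clear (u := w)
      (by simp [hw])) .nil))) .nil))).conv ?_ ?_
    · refine Store.ext' ⟨by simp, by simp, fun r => ?_⟩
      cases r <;> simp [hd, hb, hv]
    · refine le_trans ?_ (ht' _); omega

/-! ### Loading, reading and erasing the tapes of the simulated machine -/

/-- Repetition as long as the scanned symbol of a tape of the simulated machine satisfies `c`. -/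
def whileT (j : Fin (k + 1)) (c : Option Bool → Bool) (F : Prog m k) : Prog m k :=
  Frag.loop (.inr (.inl j)) c F

theorem Run.whileT_false {F : Prog m k} {s : Store m k} {j : Fin (k + 1)}
    {c : Option Bool → Bool} (hc : c (s.sim j).head = false) :
    Run (whileT j c F) s s 1 :=
  Frag.exec_loop_false (by simpa [Store.phys] using hc)

theorem Run.whileT_true {F : Prog m k} {s s₁ s₂ : Store m k} {t₁ t₂ : ℕ} {j : Fin (k + 1)}
    {c : Option Bool → Bool} (hc : c (s.sim j).head = true)
    (h₁ : Run F s s₁ t₁) (h₂ : Run (whileT j c F) s₁ s₂ t₂) :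
    Run (whileT j c F) s s₂ (1 + t₁ + t₂) :=
  Frag.exec_loop_true (by simpa [Store.phys] using hc) h₁ h₂

/-- Put a bit in front of the word on the first tape. -/
def pushBit (b : Bool) : Prog m k :=
  block [actT 0 id (some Dir.left), actT 0 (fun _ => some b) none]

theorem init_tape (w : List Bool) :
    (Machine.init k w).tape = fun j => if j = 0 then stackTape w else stackTape [] := rfl

theorem Run.pushBit {b : Bool} {v : List Bool} {s : Store m k}
    (hs : s.sim = (Machine.init k v).tape) :
    Run (pushBit b) s (s.setSim (Machine.init k (b :: v)).tape) 2 := by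
  refine (Run.cons (.actT _ _ _ _) (.cons (.actT _ _ _ _) .nil)).conv ?_ le_rfl
  refine Store.ext' ⟨by simp, ?_, fun r => by simp⟩
  funext j
  by_cases hj : j = 0
  · subst hj; simp [hs, init_tape, moveHead, stackTape_push]
  · simp [hs, init_tape, hj]

/-- Put a fixed word in front of the word on the first tape. -/
def pushBits (x : List Bool) : Prog m k := block (x.reverse.map pushBit)

theorem Run.pushBits {x v : List Bool} {s : Store m k}
    (hs : s.sim = (Machine.init k v).tape) :
    Run (pushBits x) s (s.setSim (Machine.init k (x ++ v)).tape) (2 * x.length) := by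
  have key : ∀ (y v : List Bool) (s : Store m k), s.sim = (Machine.init k v).tape →
      Run (block (y.map UniversalLearner.pushBit)) s
        (s.setSim (Machine.init k (y.reverse ++ v)).tape) (2 * y.length) := by
    intro y
    induction y with
    | nil =>
      intro v s hs
      exact Run.nil.conv (Store.ext' ⟨by simp, by simp [hs], fun r => by simp⟩) (by simp)
    | cons b y ih =>
      intro v s hs
      refine (Run.cons (.pushBit hs) (ih (b :: v) _ (by simp))).conv
        (Store.ext' ⟨by simp, by simp, fun r => by simp⟩) ?_
      simp only [List.length_cons]; omega
  simpa [UniversalLearner.pushBits] using key x.reverse v s hs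

/-- Put the word in `u`, reversed, in front of the word on the first tape. -/
def load : Prog m k :=
  whileR .u Option.isSome (ifR .u isOne (block [pop .u, pushBit true])
    (block [pop .u, pushBit false]))

theorem Run.load {w v : List Bool} {s : Store m k} (hu : s.reg .u = w)
    (hs : s.sim = (Machine.init k v).tape) :
    Run load s ((s.set .u []).setSim (Machine.init k (w.reverse ++ v)).tape)
      (5 * w.length + 1) := by
  induction w generalizing v s with
  | nil =>
    refine (Run.whileR_false (by simp [hu])).conv ?_ (by simp)
    exact Store.ext' ⟨by simp, by simp [hs], fun r => by cases r <;> simp [hu]⟩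
  | cons b w ih =>
    cases b
    · refine (Run.whileR_true (by simp [hu]) (.ifR_false (by simp [hu]) (.cons (.pop _ _)
        (.cons (.pushBit (by simp [hs]; rfl)) .nil))) (ih (by simp [hu]) (by simp; rfl))).conv
        (Store.ext' ⟨by simp, by simp, fun r => by cases r <;> simp⟩) ?_
      simp only [List.length_cons]; omega
    · refine (Run.whileR_true (by simp [hu]) (.ifR_true (by simp [hu]) (.cons (.pop _ _)
        (.cons (.pushBit (by simp [hs]; rfl)) .nil))) (ih (by simp [hu]) (by simp; rfl))).conv
        (Store.ext' ⟨by simp, by simp, fun r => by cases r <;> simp⟩) ?_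
      simp only [List.length_cons]; omega

/-- All symbols of the tape are within distance `b` of the head. -/
def Fits (b : ℕ) (t : Tape (Option Bool)) : Prop :=
  ∃ L R, L.length ≤ b ∧ R.length ≤ b ∧ t = Tape.mk₂ L R

theorem Fits.mono {b c : ℕ} {t : Tape (Option Bool)} (h : Fits b t) (hbc : b ≤ c) : Fits c t := by
  obtain ⟨L, R, hL, hR, rfl⟩ := h
  exact ⟨L, R, hL.trans hbc, hR.trans hbc, rfl⟩

theorem Fits.step {b : ℕ} {t : Tape (Option Bool)} (h : Fits b t) (hb : 1 ≤ b) (o : Option Bool)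
    (d : Option Dir) : Fits (b + 1) (moveHead d (t.write o)) := by
  obtain ⟨L, R, hL, hR, rfl⟩ := h
  rcases d with _ | _ | _ <;> simp only [moveHead, mk₂_write, mk₂_left, mk₂_right]
  · exact ⟨_, _, by omega, by simp; omega, rfl⟩
  · exact ⟨_, _, by simp; omega, by simp; omega, rfl⟩
  · exact ⟨_, _, by simp; omega, by simp; omega, rfl⟩

theorem fits_run (M : Machine k) (w : List Bool) (t : ℕ) (j : Fin (k + 1)) :
    Fits (w.length + 1 + t) ((M.run w t).tape j) := by
  induction t generalizing j with
  | zero =>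
    simp only [Machine.run, Function.iterate_zero, id, init_tape]
    split_ifs
    · exact ⟨[], w.map some, by simp, by simp, rfl⟩
    · exact ⟨[], [], by simp, by simp, rfl⟩
  | succ t ih =>
    have hr : M.run w (t + 1) = (M.step (M.run w t)).getD (M.run w t) := by
      simp [Machine.run, Function.iterate_succ_apply']
    rw [hr]
    rcases h : M.step (M.run w t) with _ | c
    · exact (ih j).mono (by omega)
    · simp only [Machine.step, Option.map_eq_some_iff] at h
      obtain ⟨r, hr, rfl⟩ := h
      exact (ih j).step (by omega) _ _

theorem fits_stackTape_nil (b : ℕ) : Fits b (stackTape []) := ⟨[], [], by simp, by simp, rfl⟩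

/-- Move the word at the head of the last tape to `p`. -/
def readOut : Prog m k :=
  block [whileT (Fin.last k) Option.isSome (block [ifT (Fin.last k) isOne (push .t2 true)
    (push .t2 false), actT (Fin.last k) id (some Dir.right)]), move .t2 .p]

theorem length_readWord_le {b : ℕ} {t : Tape (Option Bool)} (h : Fits b t) :
    (readWord t).length ≤ b := by
  obtain ⟨L, R, hL, hR, rfl⟩ := h
  rw [readWord_mk₂]
  exact (List.reduceOption_length_le _).trans
    ((List.takeWhile_sublist _).length_le.trans hR)

theorem readWord_some {L R : List (Option Bool)} (x : Bool) :
    readWord (Tape.mk₂ L (some x :: R)) = x :: readWord (Tape.mk₂ (some x :: L) R) := by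
  simp [readWord_mk₂, List.reduceOption_cons_of_some]

theorem readWord_none {L R : List (Option Bool)} :
    readWord (Tape.mk₂ L (none :: R)) = [] := by
  simp [readWord_mk₂]

theorem readWord_nil {L : List (Option Bool)} : readWord (Tape.mk₂ L []) = [] := by
  simp [readWord_mk₂]

theorem Run.readOut {b : ℕ} {s : Store m k} (hs : ∀ j, Fits b (s.sim j)) (ht : s.reg .t2 = [])
    (hp : s.reg .p = []) :
    ∃ tp, (∀ j, Fits (2 * b) (tp j)) ∧
      Run readOut s ((s.set .p (readWord (s.sim (Fin.last k)))).setSim tp) (11 * b + 2) := by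
  have key : ∀ (R L : List (Option Bool)) (v : List Bool) (s : Store m k),
      s.sim (Fin.last k) = Tape.mk₂ L R → s.reg .t2 = v →
      ∃ t', Fits (L.length + R.length) t' ∧
        Run (whileT (Fin.last k) Option.isSome (block [ifT (Fin.last k) isOne
          (UniversalLearner.push .t2 true) (UniversalLearner.push .t2 false),
          UniversalLearner.actT (Fin.last k) id (some Dir.right)])) s
          ((s.set .t2 ((readWord (Tape.mk₂ L R)).reverse ++ v)).setSim
            (Function.update s.sim (Fin.last k) t')) (5 * R.length + 1) := by
    intro R
    induction R with
    | nil =>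
      intro L v s hs hv
      refine ⟨Tape.mk₂ L [], ⟨L, [], by simp, by simp, rfl⟩,
        (Run.whileT_false (by rw [hs, mk₂_head]; rfl)).conv ?_ (by simp)⟩
      refine Store.ext' ⟨by simp, by simp [← hs], fun r => ?_⟩
      cases r <;> simp [readWord_nil, hv]
    | cons x R ih =>
      intro L v s hs hv
      rcases x with _ | x
      · refine ⟨Tape.mk₂ L (none :: R), ⟨L, none :: R, by simp, by simp, rfl⟩,
          (Run.whileT_false (by rw [hs, mk₂_head]; rfl)).conv ?_ (by simp)⟩
        refine Store.ext' ⟨by simp, by simp [← hs], fun r => ?_⟩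
        cases r <;> simp [readWord_none, hv]
      · have hb : Run (ifT (Fin.last k) isOne (UniversalLearner.push .t2 true)
            (UniversalLearner.push .t2 false)) s (s.set .t2 (x :: v)) 3 := by
          cases x
          · exact (Run.ifT_false (by rw [hs, mk₂_head]; rfl) (.push _ _ _)).conv
              (by rw [hv]) le_rfl
          · exact (Run.ifT_true (by rw [hs, mk₂_head]; rfl) (.push _ _ _)).conv
              (by rw [hv]) le_rfl
        have ha := Run.actT (Fin.last k) id (some Dir.right) (s.set .t2 (x :: v))
        obtain ⟨t', ht', h⟩ := ih (some x :: L) (x :: v)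
          ((s.set .t2 (x :: v)).setSim (Function.update s.sim (Fin.last k)
            (Tape.mk₂ (some x :: L) R)))
          (by simp) (by simp)
        refine ⟨t', ht'.mono (by simp; omega), (Run.whileT_true (by rw [hs, mk₂_head]; rfl)
          (.cons hb (.cons (ha.conv ?_ le_rfl) .nil)) h).conv ?_ ?_⟩
        · simp [hs, moveHead, mk₂_right]
        · refine Store.ext' ⟨by simp, by simp, fun r => ?_⟩
          cases r <;> simp [readWord_some]
        · simp only [List.length_cons]; omega
  obtain ⟨L, R, hL, hR, h⟩ := hs (Fin.last k)
  obtain ⟨t', ht', hr⟩ := key R L [] s h ht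
  refine ⟨Function.update s.sim (Fin.last k) t', fun j => ?_,
    (Run.cons hr (.cons (.move (by simp) (by simp; rfl) (by simp [hp]; rfl)) .nil)).conv ?_ ?_⟩
  · by_cases hj : j = Fin.last k
    · subst hj; rw [Function.update_self]; exact ht'.mono (by omega)
    · rw [Function.update_of_ne hj]; exact (hs j).mono (by omega)
  · refine Store.ext' ⟨by simp, by simp, fun r => ?_⟩
    cases r <;> simp [ht, h]
  · have := length_readWord_le (hs (Fin.last k))
    rw [h] at this
    simp; omega

/-- Clear `fl` if the word at the head of the last tape differs from `y`. -/
def compareAnswer : List Bool → Prog m k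
  | [] => ifT (Fin.last k) Option.isNone (block []) (pop .fl)
  | b :: y => block [ifT (Fin.last k) (fun o => o == some b) (block []) (pop .fl),
      actT (Fin.last k) id (some Dir.right), compareAnswer y]

theorem Run.compareAnswer {y : List Bool} {e : Bool} {b : ℕ} {s : Store m k} (hb : 1 ≤ b)
    (hs : ∀ j, Fits b (s.sim j)) (hf : s.reg .fl = flag e) :
    ∃ tp, (∀ j, Fits (b + y.length) (tp j)) ∧ Run (compareAnswer y) s
      ((s.set .fl (flag (e && decide (readWord (s.sim (Fin.last k)) = y)))).setSim tp)
      (3 * y.length + 2) := by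
  have hT : ∀ (c : Option Bool → Bool) (s : Store m k) (e : Bool), s.reg .fl = flag e →
      Run (ifT (Fin.last k) c (block []) (UniversalLearner.pop .fl)) s
        (s.set .fl (flag (e && c (s.sim (Fin.last k)).head))) 2 := by
    intro c s e hfl
    cases hc : c (s.sim (Fin.last k)).head
    · exact (Run.ifT_false hc (.pop _ _)).conv (by simp [hfl]) le_rfl
    · exact (Run.ifT_true hc .nil).conv (by rw [Store.set_self]; simp [hfl]) (by omega)
  induction y generalizing e b s with
  | nil =>
    refine ⟨s.sim, by simpa using hs, (hT _ _ e hf).conv ?_ (by simp)⟩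
    have : Option.isNone (s.sim (Fin.last k)).head =
        decide (readWord (s.sim (Fin.last k)) = []) := by
      obtain ⟨L, R, hL, hR, h⟩ := hs (Fin.last k)
      rw [h, mk₂_head]
      rcases R with _ | ⟨_ | x, R⟩
      · simp [readWord_nil, List.headI]; rfl
      · simp [readWord_none]
      · simp [readWord_some]
    refine Store.ext' ⟨by simp, by simp, fun r => ?_⟩
    cases r <;> simp [this]
  | cons x y ih =>
    have h1 := hT (fun o => o == some x) s e hf
    have h2 := Run.actT (Fin.last k) id (some Dir.right)
      (s.set .fl (flag (e && (s.sim (Fin.last k)).head == some x)))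
    simp only [Store.set_sim, id] at h2
    obtain ⟨tp, htp, h3⟩ := ih (e := e && (s.sim (Fin.last k)).head == some x) (b := b + 1)
      (s := (s.set .fl (flag (e && (s.sim (Fin.last k)).head == some x))).setSim
        (Function.update s.sim (Fin.last k) (moveHead (some Dir.right)
          ((s.sim (Fin.last k)).write (s.sim (Fin.last k)).head)))) (by omega)
      (fun j => by
        by_cases hj : j = Fin.last k
        · subst hj
          simp only [Store.setSim_sim, Function.update_self]
          exact (hs _).step hb _ _
        · simp only [Store.setSim_sim]
          rw [Function.update_of_ne hj]
          exact (hs j).mono (by omega)) (by simp)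
    refine ⟨tp, fun j => (htp j).mono (by simp; omega),
      (Run.cons h1 (.cons h2 (.cons h3 .nil))).conv ?_ ?_⟩
    · have hw : decide (readWord (s.sim (Fin.last k)) = x :: y) =
          ((s.sim (Fin.last k)).head == some x && decide (readWord (moveHead (some Dir.right)
            ((s.sim (Fin.last k)).write (s.sim (Fin.last k)).head)) = y)) := by
        obtain ⟨L, R, hL, hR, h⟩ := hs (Fin.last k)
        rw [h, mk₂_head, mk₂_write]
        simp only [moveHead, mk₂_right, List.headI_cons, List.tail_cons]
        rcases R with _ | ⟨_ | z, R⟩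
        · rw [readWord_nil]; rfl
        · rw [readWord_none]; rfl
        · simp only [readWord_some, List.headI_cons, List.tail_cons, List.cons.injEq,
            Bool.decide_and]
          congr 1
      refine Store.ext' ⟨by simp, by simp, fun r => ?_⟩
      rw [hw]
      cases r <;> simp [Bool.and_assoc]
    · simp only [List.length_cons]; omega

/-- Compare the word at the head of the last tape with `y`; the result is left in `fl`. -/
def checkAnswer (y : List Bool) : Prog m k := block [push .fl true, compareAnswer y]

theorem Run.checkAnswer {b : ℕ} {y : List Bool} {s : Store m k} (hs : ∀ j, Fits b (s.sim j))
    (hb : 1 ≤ b) (hf : s.reg .fl = []) :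
    ∃ tp, (∀ j, Fits (b + y.length) (tp j)) ∧
      Run (checkAnswer y) s
        ((s.set .fl (flag (decide (readWord (s.sim (Fin.last k)) = y)))).setSim tp)
        (3 * y.length + 4) := by
  obtain ⟨tp, htp, h⟩ := Run.compareAnswer (y := y) (e := true) (s := s.set .fl [true]) hb
    (by simpa using hs) (by simp)
  have h : Run (UniversalLearner.compareAnswer y) (s.set .fl [true]) (((s.set .fl [true]).set .fl
    (flag (true && decide (readWord (s.sim (Fin.last k)) = y)))).setSim tp) _ := h
  refine ⟨tp, htp, (Run.cons ((Run.push .fl true s).conv (by rw [hf]) le_rfl)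
    (.cons h .nil)).conv ?_ ?_⟩
  · refine Store.ext' ⟨by simp, by simp, fun r => ?_⟩
    cases r <;> simp
  · omega

/-- Erase tape `j`, which fits into the length of `big`: first everything from the head on to the
right, then everything to the left. On the way back the head starts at distance `|big|` to the right
of its first position, which is why `big` is loaded twice. -/
def eraseTape (j : Fin (k + 1)) : Prog m k :=
  block [dup .big .ck .t1,
    whileR .ck Option.isSome (block [pop .ck, actT j (fun _ => none) (some Dir.right)]),
    dup .big .ck .t1, dup .big .ck .t1,
    whileR .ck Option.isSome (block [pop .ck, actT j (fun _ => none) (some Dir.left)])]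

theorem mk₂_none (L : List (Option Bool)) : Tape.mk₂ L [none] = Tape.mk₂ L [] := by
  simp only [Tape.mk₂]
  congr 1
  exact listBlank_none_cons

theorem erase_right (n : ℕ) (L R : List (Option Bool)) :
    (fun t : Tape (Option Bool) => (t.write none).move Dir.right)^[n] (Tape.mk₂ L R) =
      Tape.mk₂ (List.replicate n none ++ L) (R.drop n) := by
  induction n generalizing L R with
  | zero => simp
  | succ n ih =>
    rw [Function.iterate_succ_apply, mk₂_write, mk₂_right, ih]
    simp only [List.headI_cons, List.tail_cons, List.replicate_succ', List.append_assoc,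
      List.drop_tail]
    rfl

theorem erase_left (n : ℕ) (L : List (Option Bool)) (x : Option Bool) (hn : L.length < n) :
    (fun t : Tape (Option Bool) => (t.write none).move Dir.left)^[n] (Tape.mk₂ L [x]) =
      stackTape [] := by
  have h0 : (Tape.mk₂ [] [none] : Tape (Option Bool)) = stackTape [] := by
    rw [mk₂_none]; rfl
  have h1 : ∀ (L : List (Option Bool)) (x : Option Bool),
      ((Tape.mk₂ L [x]).write none).move Dir.left = Tape.mk₂ L.tail [L.headI] := by
    intro L x
    rw [mk₂_write, List.tail_cons, mk₂_none, mk₂_left]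
  induction n generalizing L x with
  | zero => simp at hn
  | succ n ih =>
    rw [Function.iterate_succ_apply, h1]
    rcases L with _ | ⟨y, L⟩
    · change (fun t : Tape (Option Bool) => (t.write none).move Dir.left)^[n]
        (Tape.mk₂ [] [none]) = _
      rw [Function.iterate_fixed _ n, h0]
      rw [h1]; rfl
    · exact ih _ _ (by simpa using hn)

theorem Run.repeatAct {j : Fin (k + 1)} {o : Option Bool → Option Bool} {d : Option Dir}
    {v : List Bool} {s : Store m k} (hv : s.reg .ck = v) :
    Run (whileR .ck Option.isSome (block [UniversalLearner.pop .ck, UniversalLearner.actT j o d])) s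
      ((s.set .ck []).setSim (Function.update s.sim j
        ((fun t => moveHead d (t.write (o t.head)))^[v.length] (s.sim j)))) (3 * v.length + 1) := by
  induction v generalizing s with
  | nil =>
    refine (Run.whileR_false (by simp [hv])).conv ?_ (by simp)
    exact Store.ext' ⟨by simp, by simp, fun r => by cases r <;> simp [hv]⟩
  | cons x v ih =>
    refine (Run.whileR_true (by simp [hv]) (.cons (.pop _ _) (.cons (.actT _ _ _ _) .nil))
      (ih (by simp [hv]))).conv ?_ ?_
    · exact Store.ext' ⟨by simp, by simp, fun r => by cases r <;> simp⟩
    · simp only [List.length_cons]; omega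

theorem Run.eraseTape {j : Fin (k + 1)} {b : ℕ} {v : List Bool} {s : Store m k}
    (hs : Fits b (s.sim j)) (hv : s.reg .big = v) (hb : b < v.length) (hck : s.reg .ck = [])
    (ht : s.reg .t1 = []) :
    Run (eraseTape j) s (s.setSim (Function.update s.sim j (stackTape [])))
      (60 * (v.length + 1)) := by
  obtain ⟨L, R, hL, hR, h⟩ := hs
  have e1 : (fun t : Tape (Option Bool) => moveHead (some Dir.right) (t.write none))^[v.length]
      (s.sim j) = Tape.mk₂ (List.replicate v.length none ++ L) [none] := by
    rw [h, mk₂_none, ← List.drop_eq_nil_of_le (hR.trans hb.le)]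
    exact erase_right _ _ _
  have e2 : (fun t : Tape (Option Bool) => moveHead (some Dir.left) (t.write none))^[v.length +
      v.length] (Tape.mk₂ (List.replicate v.length none ++ L) [none]) = stackTape [] := by
    exact erase_left _ _ _ (by simp; omega)
  refine (Run.cons (.dup (by simp) (by simp) (by simp) ht hv hck) (.cons
    (.repeatAct (v := v) (by simp)) (.cons (.dup (by simp) (by simp) (by simp) (u := v) (w := [])
    (by simp [ht]) (by simp [hv]) (by simp)) (.cons (.dup (by simp) (by simp) (by simp) (u := v)
    (w := v) (by simp [ht]) (by simp [hv]) (by simp)) (.cons (.repeatAct (v := v ++ v)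
    (by simp)) .nil))))).conv ?_ ?_
  · refine Store.ext' ⟨by simp, ?_, fun r => ?_⟩
    · simp only [Store.setSim_sim, Store.set_sim, Function.update_self, Function.update_idem,
        List.length_append, e1, e2]
    · cases r <;> simp [hck]
  · simp only [List.length_append]; omega

/-- Erase all tapes of the simulated machine. -/
def eraseTapes : Prog m k := block ((List.finRange (k + 1)).map eraseTape)

theorem Run.eraseTapes {b : ℕ} {v : List Bool} {s : Store m k}
    (hs : ∀ j, Fits b (s.sim j)) (hv : s.reg .big = v) (hb : b < v.length)
    (hck : s.reg .ck = []) (ht : s.reg .t1 = []) :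
    Run eraseTapes s (s.setSim (Machine.init k []).tape) (60 * (k + 1) * (v.length + 1)) := by
  have key : ∀ (js : List (Fin (k + 1))) (s : Store m k), (∀ j, Fits b (s.sim j)) →
      s.reg .big = v → s.reg .ck = [] → s.reg .t1 = [] →
      Run (block (js.map UniversalLearner.eraseTape)) s
        (s.setSim fun j => if j ∈ js then stackTape [] else s.sim j)
        (60 * (v.length + 1) * js.length) := by
    intro js
    induction js with
    | nil =>
      intro s hs hv hck ht
      exact Run.nil.conv (Store.ext' ⟨by simp, by simp, by simp⟩) (by simp)
    | cons j js ih =>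
      intro s hs hv hck ht
      refine (Run.cons (.eraseTape (hs j) hv hb hck ht) (ih _ (fun i => ?_) (by simpa using hv)
        (by simpa using hck) (by simpa using ht))).conv ?_ ?_
      · by_cases hi : i = j
        · subst hi; simpa using fits_stackTape_nil b
        · simpa [hi] using hs i
      · refine Store.ext' ⟨by simp, ?_, by simp⟩
        funext i
        by_cases hi : i = j
        · subst hi; simp
        · simp [hi]
      · simp only [List.length_cons]; ring_nf; omega
  refine (key _ s hs hv hck ht).conv (Store.ext' ⟨by simp, ?_, by simp⟩) ?_
  · funext j
    simp [init_tape]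
  · simp only [List.length_finRange]
    exact le_of_eq (by ring)

/-! ### The enumeration of words -/

/-- The successor, in the order of the enumeration, of a word that is written in reverse. -/
def incr : List Bool → List Bool
  | [] => [false]
  | false :: v => true :: v
  | true :: v => false :: incr v

theorem bits_eq_nil {i : ℕ} (h : i.bits = []) : i = 0 := by
  rw [← Nat.size_eq_zero, ← Nat.size_eq_bits_len, h]
  rfl

theorem bits_incr {i : ℕ} {w : List Bool} (h : i.bits = w ++ [true]) :
    (i + 1).bits = incr w ++ [true] := by
  induction w generalizing i with
  | nil =>
    obtain ⟨a, rfl | rfl⟩ := Nat.even_or_odd' i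
    · rcases eq_or_ne a 0 with rfl | ha
      · simp at h
      · simp [Nat.bit0_bits a ha] at h
    · rw [Nat.bit1_bits] at h
      have : a = 0 := bits_eq_nil (by simpa using h)
      subst this
      change (2 * 1).bits = _
      rw [Nat.bit0_bits 1 one_ne_zero, Nat.one_bits]
      rfl
  | cons b w ih =>
    obtain ⟨a, rfl | rfl⟩ := Nat.even_or_odd' i
    · rcases eq_or_ne a 0 with rfl | ha
      · simp at h
      · rw [Nat.bit0_bits a ha, List.cons_append, List.cons.injEq] at h
        rw [← h.1, Nat.bit1_bits, h.2]
        rfl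
    · rw [Nat.bit1_bits, List.cons_append, List.cons.injEq] at h
      rw [← h.1, show 2 * a + 1 + 1 = 2 * (a + 1) by ring, Nat.bit0_bits _ (by omega), ih h.2]
      rfl

theorem bits_eq_append {i : ℕ} (hi : 1 ≤ i) : ∃ w, i.bits = w ++ [true] := by
  induction i using Nat.strong_induction_on with
  | _ i ih =>
    obtain ⟨a, rfl | rfl⟩ := Nat.even_or_odd' i
    · obtain ⟨w, hw⟩ := ih a (by omega) (by omega)
      exact ⟨false :: w, by rw [Nat.bit0_bits a (by omega), hw]; rfl⟩
    · rcases Nat.eq_zero_or_pos a with rfl | ha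
      · exact ⟨[], by simp⟩
      · obtain ⟨w, hw⟩ := ih a (by omega) ha
        exact ⟨true :: w, by rw [Nat.bit1_bits a, hw]; rfl⟩

/-- Adding one carries through the digits below the leading one; if the carry reaches the leading
digit, the word becomes longer by one digit. -/
theorem reverse_nthWord_succ {i : ℕ} (hi : 1 ≤ i) :
    (nthWord (i + 1)).reverse = incr (nthWord i).reverse := by
  obtain ⟨w, hw⟩ := bits_eq_append hi
  simp [nthWord, bits_incr hw, hw]

theorem length_nthWord_le (i : ℕ) : (nthWord i).length ≤ Nat.log 2 i := by
  have h : i.bits.length ≤ Nat.log 2 i + 1 := by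
    rw [Nat.size_eq_bits_len, Nat.size_le]
    exact Nat.lt_pow_succ_log_self one_lt_two i
  simp [nthWord]
  omega

theorem nthWord_zero : nthWord 0 = [] := by simp [nthWord]

theorem nthWord_one : nthWord 1 = [] := by simp [nthWord]

/-- Advance the word in `r`, which is written in reverse. -/
def advance (r : Reg) : Prog m k :=
  block [whileR r isOne (block [pop r, push .t1 false]),
    ifR r isZero (block [pop r, push r true]) (push r false), move .t1 r]

theorem incr_eq (w : List Bool) :
    incr w = List.replicate (w.takeWhile id).length false ++
      match w.dropWhile id with
      | [] => [false]
      | _ :: v => true :: v := by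
  induction w with
  | nil => rfl
  | cons b w ih =>
    cases b
    · rfl
    · simp only [incr, ih, List.takeWhile_cons, id, if_true, List.length_cons,
        List.replicate_succ, List.dropWhile_cons, List.cons_append]

theorem dropWhile_cons_eq {w v : List Bool} {b : Bool} (h : w.dropWhile id = b :: v) :
    b = false := by
  have := List.head_dropWhile_not id (l := w) (by simp [h])
  simpa [h] using this

theorem Run.advance {r : Reg} {w : List Bool} {s : Store m k} (hr : r ≠ .t1) (hw : s.reg r = w)
    (ht : s.reg .t1 = []) : Run (advance r) s (s.set r (incr w)) (10 * w.length + 12) := by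
  have key : ∀ (w : List Bool) (c : ℕ) (s : Store m k), s.reg r = w →
      s.reg .t1 = List.replicate c false →
      Run (whileR r isOne (block [UniversalLearner.pop r, UniversalLearner.push .t1 false])) s
        ((s.set r (w.dropWhile id)).set .t1
          (List.replicate (c + (w.takeWhile id).length) false)) (4 * w.length + 1) := by
    intro w
    induction w with
    | nil =>
      intro c s hw ht
      refine (Run.whileR_false (by simp [hw])).conv ?_ (by simp)
      refine Store.ext' ⟨by simp, by simp, fun r' => ?_⟩
      by_cases h1 : r' = .t1
      · simp [h1, ht]
      · by_cases h2 : r' = r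
        · simp [h2, hr, hw]
        · simp [h1, h2]
    | cons b w ih =>
      intro c s hw ht
      cases b
      · refine (Run.whileR_false (by simp [hw])).conv ?_ (by simp)
        refine Store.ext' ⟨by simp, by simp, fun r' => ?_⟩
        by_cases h1 : r' = .t1
        · simp [h1, ht]
        · by_cases h2 : r' = r
          · simp [h2, hr, hw]
          · simp [h1, h2]
      · refine (Run.whileR_true (by simp [hw]) (.cons (.pop _ _) (.cons (.push _ _ _) .nil))
          (ih (c + 1) _ (by simp [hw, hr]) (by simp [ht, hr.symm, List.replicate_succ]))).conv
          ?_ ?_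
        · refine Store.ext' ⟨by simp, by simp, fun r' => ?_⟩
          by_cases h1 : r' = .t1
          · simp [h1]; omega
          · by_cases h2 : r' = r
            · simp [h2, hr]
            · simp [h1, h2]
        · simp only [List.length_cons]; omega
  have hlen : (w.takeWhile id).length ≤ w.length := (List.takeWhile_sublist _).length_le
  have h1 := key w 0 s hw (by simpa using ht)
  have heq := incr_eq w
  have hfin : ∀ v, incr w = List.replicate (w.takeWhile id).length false ++ v → ∀ v' v'',
      (((((s.set r v').set .t1 (List.replicate (0 + (w.takeWhile id).length) false)).set r
        v'').set r v).set .t1 []).set r ((List.replicate (0 + (w.takeWhile id).length)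
          false).reverse ++ v) = s.set r (incr w) := by
    intro v hv v' v''
    refine Store.ext' ⟨by simp, by simp, fun r' => ?_⟩
    by_cases h1 : r' = r
    · simp [h1, hv]
    · by_cases h2 : r' = .t1
      · simp [h2, hr.symm, ht]
      · simp [h1, h2]
  rcases hdw : w.dropWhile id with _ | ⟨b, v⟩
  · rw [hdw] at heq h1
    refine (Run.cons h1 (.cons (.ifR_false (by simp [hr]) (.push _ _ _)) (.cons
      (.move hr.symm (u := List.replicate (0 + (w.takeWhile id).length) false)
        (w := [false]) (by simp [hr.symm]) (by simp [hr])) .nil))).conv ?_ ?_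
    · rw [← hfin _ heq [] [false]]; simp [hr]
    · simp only [List.length_replicate]; omega
  · obtain rfl := dropWhile_cons_eq hdw
    rw [hdw] at heq h1
    refine (Run.cons h1 (.cons (.ifR_true (by simp [hr]) (.cons (.pop _ _)
      (.cons (.push _ _ _) .nil))) (.cons
      (.move hr.symm (u := List.replicate (0 + (w.takeWhile id).length) false)
        (w := true :: v) (by simp [hr.symm]) (by simp [hr])) .nil))).conv ?_ ?_
    · rw [← hfin _ heq (false :: v) v]; simp [hr]
    · simp only [List.length_replicate]; omega

/-- Split the encoded predictor in `arg`: afterwards `er` holds, in reverse, the description of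
the machine, and `arg` the word that is hard-wired. The first `1` is skipped without advancing `er`,
since the words with numbers `0` and `1` are both empty. -/
def splitPredictor : Prog m k :=
  block [ifR .arg isOne (pop .arg) (block []),
    whileR .arg isOne (block [pop .arg, advance .er]), pop .arg]

theorem Run.splitPredictor {p : List Bool} {s : Store m k} (hp : s.reg .arg = p)
    (he : s.reg .er = []) (ht : s.reg .t1 = []) :
    Run splitPredictor s
      ((s.set .arg (p.drop ((p.takeWhile id).length + 1))).set .er
        (nthWord (p.takeWhile id).length).reverse)
      (p.length * (10 * Nat.log 2 p.length + 14) + 4) := by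
  have key : ∀ (N : ℕ) (v : List Bool) (i : ℕ) (s : Store m k), 1 ≤ i → i + v.length ≤ N →
      s.reg .arg = v → s.reg .er = (nthWord i).reverse → s.reg .t1 = [] →
      Run (whileR .arg isOne (block [UniversalLearner.pop .arg, UniversalLearner.advance .er])) s
        ((s.set .arg (v.dropWhile id)).set .er
          (nthWord (i + (v.takeWhile id).length)).reverse)
        (v.length * (10 * Nat.log 2 N + 14) + 1) := by
    intro N v
    induction v with
    | nil =>
      intro i s hi hN hv he ht
      refine (Run.whileR_false (by simp [hv])).conv ?_ (by simp)
      exact Store.ext' ⟨by simp, by simp, fun r => by cases r <;> simp [hv, he]⟩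
    | cons b v ih =>
      intro i s hi hN hv he ht
      cases b
      · refine (Run.whileR_false (by simp [hv])).conv ?_ (by simp)
        exact Store.ext' ⟨by simp, by simp, fun r => by cases r <;> simp [hv, he]⟩
      · rw [List.length_cons] at hN
        refine (Run.whileR_true (by simp [hv]) (.cons (.pop _ _) (.cons (.advance
          (w := (nthWord i).reverse) (by simp) (by simp [he]) (by simp [ht])) .nil))
          (ih (i + 1) _ (by omega) (by omega) (by simp [hv])
            (by simp [reverse_nthWord_succ hi]) (by simp [ht]))).conv ?_ ?_
        · refine Store.ext' ⟨by simp, by simp, fun r => ?_⟩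
          cases r <;> simp
          rw [show i + 1 + (v.takeWhile id).length = i + ((v.takeWhile id).length + 1) by ring]
        · have h1 := (length_nthWord_le i).trans (Nat.log_mono_right (by omega : i ≤ N))
          rw [List.length_reverse, List.length_cons, Nat.add_mul v.length 1]
          omega
  rcases p with _ | ⟨_ | _, v⟩
  · refine (Run.cons (.ifR_false (by simp [hp]) .nil) (.cons (.whileR_false (by simp [hp]))
      (.cons (.pop _ _) .nil))).conv ?_ (by simp)
    exact Store.ext' ⟨by simp, by simp, fun r => by cases r <;> simp [hp, he, nthWord_zero]⟩
  · refine (Run.cons (.ifR_false (by simp [hp]) .nil) (.cons (.whileR_false (by simp [hp]))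
      (.cons (.pop _ _) .nil))).conv ?_ (by omega)
    exact Store.ext' ⟨by simp, by simp, fun r => by cases r <;> simp [hp, he, nthWord_zero]⟩
  · refine (Run.cons (.ifR_true (by simp [hp]) (.pop _ _)) (.cons (key (v.length + 1) v 1 _ le_rfl
      (by omega) (by simp [hp]) (by simp [he, nthWord_one]) (by simp [ht]))
      (.cons (.pop _ _) .nil))).conv ?_ ?_
    · have hd : ∀ v : List Bool, (v.dropWhile id).tail = v.drop ((v.takeWhile id).length + 1) := by
        intro v
        induction v with
        | nil => rfl
        | cons b v ih => cases b <;> simp [ih]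
      refine Store.ext' ⟨by simp, by simp, fun r => ?_⟩
      cases r <;> simp [hd, add_comm 1]
    · rw [List.length_cons, Nat.add_mul v.length 1]
      omega

/-! ### Training and evaluating -/

/-- Put the word in `a` in front of the word on the first tape of the simulated machine. -/
def loadFrom (a : Reg) : Prog m k := block [dup a .hc .t1, move .hc .u, load]

theorem Run.loadFrom {a : Reg} {w v : List Bool} {s : Store m k} (ha : a ≠ .hc ∧ a ≠ .t1)
    (hw : s.reg a = w) (hs : s.sim = (Machine.init k v).tape) (hhc : s.reg .hc = [])
    (ht : s.reg .t1 = []) (hu : s.reg .u = []) :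
    Run (loadFrom a) s (s.setSim (Machine.init k (w ++ v)).tape) (25 * w.length + 4) := by
  refine (Run.cons (.dup ha.2.symm (by simp) ha.1 ht hw hhc) (.cons (.move (by simp) (u := w)
    (w := []) (by simp) (by simp [hu])) (.cons (.load (w := w.reverse) (by simp)
    (by simpa using hs)) .nil))).conv ?_ ?_
  · exact Store.ext' ⟨by simp, by simp, fun r => by cases r <;> simp [hhc, hu]⟩
  · simp only [List.length_reverse]; omega

/-- Put the reversal of the word in `a`, if it describes a machine, into `desc`. -/
def descFrom (a : Reg) : Prog m k := block [dup a .hc .t1, move .hc .desc, validate]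

theorem Run.descFrom {a : Reg} {w : List Bool} {s : Store m k} (ha : a ≠ .hc ∧ a ≠ .t1)
    (hw : s.reg a = w) (hhc : s.reg .hc = []) (ht : s.reg .t1 = []) (hde : s.reg .desc = [])
    (hd : s.reg .d = []) (hb : s.reg .bad = []) :
    Run (descFrom a) s (s.set .desc (Machine.decode k w.reverse).encode)
      (90 * ((k + 1) * (w.length + 1) ^ 2)) := by
  refine (Run.cons (.dup ha.2.symm (by simp) ha.1 ht hw hhc) (.cons (.move (by simp) (u := w)
    (w := []) (by simp) (by simp [hde])) (.cons (.validate (w := w.reverse) (by simp)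
    (by simp [hd]) (by simp [ht]) (by simp [hb])) .nil))).conv ?_ ?_
  · exact Store.ext' ⟨by simp, by simp, fun r => by cases r <;> simp [hhc]⟩
  · simp only [List.length_reverse]
    nlinarith [Nat.zero_le (k * w.length), Nat.zero_le (k * w.length ^ 2)]

theorem Machine.length_encode_decode_le (w : List Bool) :
    (Machine.decode k w).encode.length ≤ w.length := by
  rw [Machine.encode_decode]
  split_ifs <;> simp

/-- Simulate, and forget the final state. -/
def runSim : Prog m k := block [simulate, clear .st]

theorem Machine.state_run_le {M : Machine k} {E : ℕ} (hE : M.encode.length ≤ E) (w : List Bool)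
    (t : ℕ) : (M.run w t).state ≤ E := by
  induction t with
  | zero => exact Nat.zero_le _
  | succ t ih =>
    have hr : M.run w (t + 1) = (M.step (M.run w t)).getD (M.run w t) := by
      simp [Machine.run, Function.iterate_succ_apply']
    rw [hr]
    exact Machine.state_step_le hE ih

theorem Run.runSim {M : Machine k} {E T : ℕ} (hE : M.encode.length ≤ E) (w : List Bool)
    {s : Store m k} (hsim : s.sim = (Machine.init k w).tape)
    (hdesc : s.reg .desc = M.encode) (hd : s.reg .d = []) (ht : s.reg .t1 = [])
    (hst : s.reg .st = []) (ha : s.reg .a1 = []) (hfl : s.reg .fl = []) (hnx : s.reg .nx = [])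
    (hf : s.reg .fnd = []) (hck : s.reg .ck = [])
    (hclk : s.reg .clk = List.replicate (T + 1) true) :
    Run runSim s ((s.set .fnd (flag (M.output w T).isNone)).setSim (M.run w (T + 1)).tape)
      (230 * ((k + 1) * ((T + 1) * (E + 1) ^ 2))) := by
  have hout : (M.output w T).isNone = (M.step (M.run w T)).isSome := by
    rw [Machine.output]
    rcases M.step (M.run w T) <;> simp
  refine (Run.cons (.simulate (f := false) hE w hsim hdesc hd ht hst ha hfl hnx hf hck hclk)
    (.cons (.clear (u := List.replicate (M.run w (T + 1)).state true) (by simp)) .nil)).conv ?_ ?_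
  · rw [hout]
    exact Store.ext' ⟨by simp, by simp, fun r => by cases r <;> simp [hst]⟩
  · have := Machine.state_run_le hE w (T + 1)
    simp only [List.length_replicate]
    have h1 : (E + 1) ≤ ((k + 1) * ((T + 1) * (E + 1) ^ 2)) := by
      calc E + 1 = 1 * (1 * (E + 1) ^ 1) := by ring
        _ ≤ _ := Nat.mul_le_mul (by omega) (Nat.mul_le_mul (by omega)
          (Nat.pow_le_pow_right (by omega) (by omega)))
    have h2 : (T + 1) * (216 * (k + 1) * (E + 1) ^ 2) =
        216 * ((k + 1) * ((T + 1) * (E + 1) ^ 2)) := by ring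
    omega

/-- The situation between two rounds of the learner: all auxiliary registers are empty, the clock is
set to `T + 1` steps, `w` is the word of the training samples and `Bs` is the list of the blocks of the
holdout samples, `W` is the total width of the codes, and `B` bounds the contents of the registers. -/
structure Ready (s : Store m k) (T W B : ℕ) (w : List Bool) (Bs : List (List Bool)) : Prop where
  sim : s.sim = (Machine.init k []).tape
  t1 : s.reg .t1 = []
  t2 : s.reg .t2 = []
  desc : s.reg .desc = []
  d : s.reg .d = []
  bad : s.reg .bad = []
  st : s.reg .st = []
  a1 : s.reg .a1 = []
  nx : s.reg .nx = []
  fl : s.reg .fl = []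
  fnd : s.reg .fnd = []
  ck : s.reg .ck = []
  er : s.reg .er = []
  arg : s.reg .arg = []
  u : s.reg .u = []
  hc : s.reg .hc = []
  clk : s.reg .clk = List.replicate (T + 1) true
  tr : s.reg .tr = w
  inp : s.reg .inp = Bs.flatten
  lt_big : 2 * (w.length + T + 2) + W < (s.reg .big).length
  big_le : (s.reg .big).length ≤ B
  inp_le : Bs.flatten.length ≤ B

/-- Run the machine described, in reverse, by `wr` on the training samples, and leave its output
in `p`; `has` tells whether there is one. -/
def train : Prog m k :=
  block [descFrom .wr, loadFrom .tr, runSim,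
    ifR .fnd Option.isSome (pop .fnd) (block [readOut, push .has true]), eraseTapes, clear .desc]

/-- A machine that has halted stays in its configuration, so the output can be read one step
later. -/
theorem Machine.run_succ_of_output {M : Machine k} {w p : List Bool} {T : ℕ}
    (h : M.output w T = some p) : readWord ((M.run w (T + 1)).tape (Fin.last k)) = p := by
  have hr : M.run w (T + 1) = (M.step (M.run w T)).getD (M.run w T) := by
    simp [Machine.run, Function.iterate_succ_apply']
  rw [Machine.output] at h
  rcases hs : M.step (M.run w T) with _ | c
  · rw [hr, hs]
    simpa [hs] using h
  · simp [hs] at h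

/-- The time of a round is governed by the simulation; `Nat.log 2 B` bounds the length of the
description. -/
theorem Run.train {s : Store m k} {T W B : ℕ} {tr : List Bool} {Bs : List (List Bool)}
    (h : Ready s T W B tr Bs) {i : ℕ} (hwr : s.reg .wr = (nthWord i).reverse)
    (hi : Nat.log 2 i ≤ Nat.log 2 B) (hp : s.reg .p = []) (hhas : s.reg .has = []) :
    Run train s ((s.set .p (((nthMachine k i).output tr T).getD [])).set .has
      (flag ((nthMachine k i).output tr T).isSome))
      (500 * ((k + 1) * ((B + 1) * (Nat.log 2 B + 1) ^ 2))) := by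
  set Λ := Nat.log 2 B
  set M := nthMachine k i with hM
  set X := (B + 1) * (Λ + 1) ^ 2 with hX
  have hΛ : (nthWord i).length ≤ Λ := (length_nthWord_le i).trans hi
  have hE : M.encode.length ≤ Λ := (Machine.length_encode_decode_le _).trans hΛ
  have hBX : B + 1 ≤ X := Nat.le_mul_of_pos_right _ (by positivity)
  have hΛX : (Λ + 1) ^ 2 ≤ X := Nat.le_mul_of_pos_left _ (by positivity)
  have hXY : X ≤ (k + 1) * X := Nat.le_mul_of_pos_left _ (by positivity)
  have hΛ2 : Λ + 1 ≤ (Λ + 1) ^ 2 := Nat.le_self_pow (by norm_num) _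
  have hlt := h.lt_big
  have hle := h.big_le
  have hT1 : (T + 1) * (Λ + 1) ^ 2 ≤ X := Nat.mul_le_mul_right _ (by omega)
  have hT2 : (k + 1) * ((T + 1) * (Λ + 1) ^ 2) ≤ (k + 1) * X := Nat.mul_le_mul_left _ hT1
  have hbig : (k + 1) * ((s.reg .big).length + 1) ≤ (k + 1) * X :=
    Nat.mul_le_mul_left _ (by omega)
  have hdl : (k + 1) * ((nthWord i).reverse.length + 1) ^ 2 ≤ (k + 1) * X :=
    Nat.mul_le_mul_left _ ((Nat.pow_le_pow_left (by simpa using hΛ) 2).trans hΛX)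
  have hfit := fits_run M tr (T + 1)
  have h1 := Run.descFrom (m := m) (k := k) (a := .wr) ⟨by simp, by simp⟩ hwr h.hc h.t1 h.desc
    h.d h.bad
  rw [List.reverse_reverse] at h1
  have h3 := Run.runSim (m := m) (s := (s.set .desc M.encode).setSim (Machine.init k tr).tape)
    (T := T) hE tr (by simp) (by simp) (by simp [h.d]) (by simp [h.t1]) (by simp [h.st])
    (by simp [h.a1]) (by simp [h.fl]) (by simp [h.nx]) (by simp [h.fnd]) (by simp [h.ck])
    (by simp [h.clk])
  have h2 := Run.loadFrom (m := m) (k := k) (a := .tr) (w := tr) (v := [])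
    (s := s.set .desc M.encode) ⟨by simp, by simp⟩
    (by simp [h.tr]) (by simp [h.sim]) (by simp [h.hc]) (by simp [h.t1]) (by simp [h.u])
  rw [List.append_nil] at h2
  rcases ho : M.output tr T with _ | p
  · rw [ho] at h3
    refine (Run.cons h1 (.cons h2 (.cons h3 (.cons (.ifR_true (by simp) (.pop _ _))
      (.cons (.eraseTapes (v := s.reg .big) (by simpa using hfit) (by simp) (by omega)
        (by simp [h.ck]) (by simp [h.t1])) (.cons (.clear (u := M.encode) (by simp))
        .nil)))))).conv ?_ ?_
    · refine Store.ext' ⟨by simp, by simp [h.sim], fun r => ?_⟩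
      cases r <;> simp [hp, hhas, h.fnd, h.desc]
    · rw [Nat.mul_assoc 60]; omega
  · rw [ho] at h3
    obtain ⟨tp, htp, h4⟩ := Run.readOut (m := m) (k := k)
      (s := (((s.set .desc M.encode).setSim (Machine.init k tr).tape).set .fnd []).setSim
        (M.run tr (T + 1)).tape) hfit (by simp [h.t2]) (by simp [hp])
    rw [Store.setSim_sim, Machine.run_succ_of_output ho] at h4
    refine (Run.cons h1 (.cons h2 (.cons h3 (.cons (.ifR_false (by simp) (.cons h4
      (.cons (.push _ _ _) .nil)))
      (.cons (.eraseTapes (v := s.reg .big) (by simpa using htp) (by simp) (by omega)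
        (by simp [h.ck]) (by simp [h.t1])) (.cons (.clear (u := M.encode) (by simp))
        .nil)))))).conv ?_ ?_
    · refine Store.ext' ⟨by simp, by simp [h.sim], fun r => ?_⟩
      cases r <;> simp [hhas, h.fnd, h.desc]
    · rw [Nat.mul_assoc 60]; omega

/-- Count in `err` the blocks of the holdout samples that are equal to `c`. -/
def countBlocks (c : List Bool) : Prog m k :=
  block [dup .inp .hc .t1, whileR .hc Option.isSome (block [push .fl true,
    block (c.map fun b => block [ifR .hc (fun o => o == some b) (block []) (pop .fl), pop .hc]),
    ifR .fl Option.isSome (block [pop .fl, push .err true]) (block [])])]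

theorem Run.matchBlock {c b rest : List Bool} {e : Bool} {s : Store m k}
    (hl : b.length = c.length) (hh : s.reg .hc = b ++ rest) (hf : s.reg .fl = flag e) :
    Run (block (c.map fun b => block [ifR .hc (fun o => o == some b) (block [])
      (UniversalLearner.pop .fl), UniversalLearner.pop .hc])) s
      ((s.set .hc rest).set .fl (flag (e && decide (b = c)))) (3 * c.length) := by
  induction c generalizing b e s with
  | nil =>
    obtain rfl : b = [] := by simpa using hl
    exact Run.nil.conv (Store.ext' ⟨by simp, by simp, fun r => by
      cases r <;> simp_all⟩) (by simp)
  | cons x c ih =>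
    rcases b with _ | ⟨y, b⟩
    · simp at hl
    · have h1 : Run (ifR .hc (fun o => o == some x) (block []) (UniversalLearner.pop .fl)) s
          (s.set .fl (flag (e && (y == x)))) 2 := by
        by_cases hyx : y = x
        · exact (Run.ifR_true (by simp [hh, hyx]) .nil).conv
            (by rw [Store.set_self]; simp [hf, hyx]) (by omega)
        · have hb : (y == x) = false := by simpa using hyx
          refine (Run.ifR_false (by simpa [hh] using hyx) (.pop _ _)).conv ?_ (by omega)
          rw [hb, hf]; simp
      refine (Run.cons (.cons h1 (.cons (.pop _ _) .nil)) (ih (b := b) (e := e && (y == x))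
        (by simpa using hl) (by simp [hh]) (by simp))).conv ?_ ?_
      · refine Store.ext' ⟨by simp, by simp, fun r => ?_⟩
        have : decide (y :: b = x :: c) = (y == x && decide (b = c)) := by
          simp only [List.cons.injEq, Bool.decide_and]
          congr 1
        rw [this]
        cases r <;> simp [Bool.and_assoc]
      · simp only [List.length_cons]; omega

theorem Run.countBlocks {c : List Bool} (hc : c ≠ []) {Bs : List (List Bool)}
    (hBs : ∀ b ∈ Bs, b.length = c.length) {s : Store m k} (hinp : s.reg .inp = Bs.flatten)
    (hhc : s.reg .hc = []) (ht : s.reg .t1 = []) (hf : s.reg .fl = []) :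
    Run (countBlocks c) s (s.set .err (List.replicate (Bs.count c) true ++ s.reg .err))
      (26 * (Bs.flatten.length + 1)) := by
  have hc0 := List.length_pos_of_ne_nil hc
  have key : ∀ (Bs : List (List Bool)) (n : ℕ) (s : Store m k), (∀ b ∈ Bs, b.length = c.length) →
      s.reg .hc = Bs.flatten → s.reg .fl = [] →
      Run (whileR .hc Option.isSome (block [UniversalLearner.push .fl true,
        block (c.map fun b => block [ifR .hc (fun o => o == some b) (block [])
          (UniversalLearner.pop .fl), UniversalLearner.pop .hc]),
        ifR .fl Option.isSome (block [UniversalLearner.pop .fl, UniversalLearner.push .err true])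
          (block [])])) s
        ((s.set .hc []).set .err (List.replicate (Bs.count c) true ++ s.reg .err))
        (10 * Bs.flatten.length + 1) := by
    intro Bs
    induction Bs with
    | nil =>
      intro n s hBs hh hf
      refine (Run.whileR_false (by simp [hh])).conv ?_ (by simp)
      exact Store.ext' ⟨by simp, by simp, fun r => by cases r <;> simp [hh]⟩
    | cons b Bs ih =>
      intro n s hBs hh hf
      have hb := hBs b (by simp)
      rw [List.flatten_cons] at hh
      have hne : b ≠ [] := by rintro rfl; simp at hb; omega
      have hhead : Option.isSome (s.reg .hc).head? = true := by
        obtain ⟨x, l, rfl⟩ := List.exists_cons_of_ne_nil hne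
        simp [hh]
      have hm := Run.matchBlock (m := m) (k := k) (e := true) (rest := Bs.flatten)
        (s := s.set .fl [true]) hb (by simp [hh]) (by simp)
      have hih := fun s' => ih n s' (fun b hb => hBs b (by simp [hb]))
      by_cases hbc : b = c
      · refine (Run.whileR_true hhead (.cons ((Run.push .fl true s).conv (by rw [hf]) le_rfl)
          (.cons hm (.cons (.ifR_true (by simp [hbc]) (.cons (.pop _ _) (.cons (.push _ _ _)
            .nil))) .nil))) (hih _ (by simp) (by simp [hbc]))).conv ?_ ?_
        · refine Store.ext' ⟨by simp, by simp, fun r => ?_⟩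
          cases r <;> simp [hf, hbc, List.replicate_succ']
        · rw [List.flatten_cons, List.length_append]; omega
      · refine (Run.whileR_true hhead (.cons ((Run.push .fl true s).conv (by rw [hf]) le_rfl)
          (.cons hm (.cons (.ifR_false (by simp [hbc]) .nil) .nil)))
            (hih _ (by simp) (by simp [hbc]))).conv ?_ ?_
        · refine Store.ext' ⟨by simp, by simp, fun r => ?_⟩
          cases r <;> simp [hf, hbc]
        · rw [List.flatten_cons, List.length_append]; omega
  refine (Run.cons (.dup (by simp) (by simp) (by simp) ht hinp hhc) (.cons (key Bs 0 _ hBs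
    (by simp) (by simp [hf])) .nil)).conv ?_ ?_
  · exact Store.ext' ⟨by simp, by simp, fun r => by cases r <;> simp [hhc]⟩
  · omega

/-- Run the predictor on the point with code `c.1`, and count the holdout samples with the code
`c` in `err` if it does not answer `c.2`. -/
def evalCode (c : List Bool × List Bool) : Prog m k :=
  block [loadFrom .arg, pushBits c.1, runSim,
    ifR .fnd Option.isSome (pop .fnd) (checkAnswer c.2), eraseTapes,
    ifR .fl Option.isSome (pop .fl) (countBlocks (true :: (c.1 ++ c.2)))]

theorem Run.evalCode {s : Store m k} {T W B : ℕ} {tr a : List Bool} {Bs : List (List Bool)}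
    {c : List Bool × List Bool} {M : Machine k}
    (h : Ready ((s.set .desc []).set .arg []) T W B tr Bs)
    (hM : M.encode.length ≤ Nat.log 2 B) (hdesc : s.reg .desc = M.encode) (harg : s.reg .arg = a)
    (ha : a.length ≤ tr.length + T + 2) (hc : c.1.length + c.2.length ≤ W)
    (hBs : ∀ b ∈ Bs, b.length = c.1.length + c.2.length + 1) :
    Run (evalCode c) s
      (s.set .err (List.replicate (if M.output (c.1 ++ a) T = some c.2 then 0 else
        Bs.count (true :: (c.1 ++ c.2))) true ++ s.reg .err))
      (500 * ((k + 1) * ((B + 1) * (Nat.log 2 B + 1) ^ 2))) := by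
  set Λ := Nat.log 2 B
  set X := (B + 1) * (Λ + 1) ^ 2 with hX
  have hBX : B + 1 ≤ X := Nat.le_mul_of_pos_right _ (by positivity)
  have hΛX : (Λ + 1) ^ 2 ≤ X := Nat.le_mul_of_pos_left _ (by positivity)
  have hXY : X ≤ (k + 1) * X := Nat.le_mul_of_pos_left _ (by positivity)
  have hlt := h.lt_big
  have hle := h.big_le
  have hinp := h.inp_le
  obtain ⟨hsim, ht1, ht2, -, hd, hbad, hst, ha1, hnx, hfl, hfnd, hck, her, -, hu, hhc, hclk, -,
    hinp', -, -, -⟩ := h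
  simp only [Store.set_reg, Store.set_sim, reduceCtorEq, if_false] at *
  have hT1 : (T + 1) * (Λ + 1) ^ 2 ≤ X := Nat.mul_le_mul_right _ (by omega)
  have hT2 : (k + 1) * ((T + 1) * (Λ + 1) ^ 2) ≤ (k + 1) * X := Nat.mul_le_mul_left _ hT1
  have hbig : (k + 1) * ((s.reg .big).length + 1) ≤ (k + 1) * X :=
    Nat.mul_le_mul_left _ (by omega)
  have hfit := fits_run M (c.1 ++ a) (T + 1)
  rw [List.length_append] at hfit
  have h1 := Run.loadFrom (m := m) (k := k) (a := .arg) (w := a) (v := [])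
    (s := s) ⟨by simp, by simp⟩ harg hsim hhc ht1 hu
  rw [List.append_nil] at h1
  have h2 := Run.pushBits (m := m) (k := k) (x := c.1) (v := a)
    (s := s.setSim (Machine.init k a).tape) (by simp)
  have h3 := Run.runSim (m := m) (s := (s.setSim (Machine.init k a).tape).setSim
    (Machine.init k (c.1 ++ a)).tape)
    (T := T) hM (c.1 ++ a) (by simp) (by simp [hdesc]) (by simp [hd]) (by simp [ht1])
    (by simp [hst]) (by simp [ha1]) (by simp [hfl]) (by simp [hnx]) (by simp [hfnd])
    (by simp [hck]) (by simp [hclk])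
  have h6 : ∀ s' : Store m k, s'.reg .inp = Bs.flatten → s'.reg .hc = [] → s'.reg .t1 = [] →
      s'.reg .fl = [] → Run (UniversalLearner.countBlocks (true :: (c.1 ++ c.2))) s'
        (s'.set .err (List.replicate (Bs.count (true :: (c.1 ++ c.2))) true ++ s'.reg .err))
        (26 * (Bs.flatten.length + 1)) := fun s' =>
    Run.countBlocks (by simp) (fun b hb => by rw [hBs b hb]; simp)
  rcases ho : M.output (c.1 ++ a) T with _ | p
  · rw [ho] at h3
    refine (Run.cons h1 (.cons h2 (.cons h3 (.cons (.ifR_true (by simp) (.pop _ _))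
      (.cons (.eraseTapes (v := s.reg .big) (by simpa using hfit) (by simp) (by omega)
        (by simp [hck]) (by simp [ht1])) (.cons (.ifR_false (by simp [hfl]) (h6 _ (by simp [hinp'])
        (by simp [hhc]) (by simp [ht1]) (by simp [hfl]))) .nil)))))).conv ?_ ?_
    · refine Store.ext' ⟨by simp, by simp [hsim], fun r => ?_⟩
      cases r <;> simp [hfnd]
    · rw [Nat.mul_assoc 60]; omega
  · rw [ho] at h3
    obtain ⟨tp, htp, h4⟩ := Run.checkAnswer (m := m) (k := k) (y := c.2)
      (s := ((((s.setSim (Machine.init k a).tape).setSim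
        (Machine.init k (c.1 ++ a)).tape).set .fnd []).setSim
        (M.run (c.1 ++ a) (T + 1)).tape)) hfit (by omega) (by simp [hfl])
    have h4 : Run _ _ ((Store.set _ .fl (flag (decide (readWord ((M.run (c.1 ++ a)
      (T + 1)).tape (Fin.last k)) = c.2)))).setSim tp) _ := h4
    rw [Machine.run_succ_of_output ho] at h4
    by_cases hpc : p = c.2
    · refine (Run.cons h1 (.cons h2 (.cons h3 (.cons (.ifR_false (by simp) h4)
        (.cons (.eraseTapes (v := s.reg .big) (by simpa using htp) (by simp) (by omega)
          (by simp [hck]) (by simp [ht1])) (.cons (.ifR_true (by simp [hpc]) (.pop _ _))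
          .nil)))))).conv ?_ ?_
      · refine Store.ext' ⟨by simp, by simp [hsim], fun r => ?_⟩
        cases r <;> simp [hfnd, hpc, hfl]
      · rw [Nat.mul_assoc 60]; omega
    · refine (Run.cons h1 (.cons h2 (.cons h3 (.cons (.ifR_false (by simp) h4)
        (.cons (.eraseTapes (v := s.reg .big) (by simpa using htp) (by simp) (by omega)
          (by simp [hck]) (by simp [ht1])) (.cons (.ifR_false (by simp [hpc]) (h6 _
            (by simp [hinp']) (by simp [hhc]) (by simp [ht1]) (by simp [hpc]))) .nil)))))).conv ?_ ?_
      · refine Store.ext' ⟨by simp, by simp [hsim], fun r => ?_⟩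
        cases r <;> simp [hfnd, hpc, hfl]
      · rw [Nat.mul_assoc 60]; omega

/-! ### The rounds of the learner -/

theorem Ready.of_eq {s s' : Store m k} {T W B : ℕ} {w : List Bool} {Bs : List (List Bool)}
    (h : Ready s T W B w Bs) (hsim : s'.sim = s.sim)
    (hr : ∀ r, r ≠ .err → r ≠ .p → r ≠ .has → r ≠ .best → r ≠ .out → r ≠ .wr → r ≠ .kk →
      s'.reg r = s.reg r) : Ready s' T W B w Bs := by
  obtain ⟨h1, h2, h3, h4, h5, h6, h7, h8, h9, h10, h11, h12, h13, h14, h15, h16, h17, h18, h19,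
    h20, h21, h22⟩ := h
  constructor <;> first
    | assumption
    | (rw [hsim]; assumption)
    | (rw [hr] <;> first | assumption | simp)

/-- The number of holdout blocks with code `c` on which the encoded predictor `p` errs. -/
noncomputable def codeErrors (k T : ℕ) (Bs : List (List Bool)) (p : List Bool)
    (c : List Bool × List Bool) : ℕ :=
  if predict k p c.1 T = some c.2 then 0 else Bs.count (true :: (c.1 ++ c.2))

/-- The number of holdout blocks on which an encoded predictor errs; all of them, if there is
none. -/
noncomputable def errors (k T : ℕ) (Bs : List (List Bool)) (codes : List (List Bool × List Bool)) :
    Option (List Bool) → ℕ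
  | none => Bs.length
  | some p => (codes.map (codeErrors k T Bs p)).sum

theorem errors_le {T B : ℕ} {Bs : List (List Bool)} {codes : List (List Bool × List Bool)}
    (hB : Bs.length ≤ B) (f : Option (List Bool)) :
    errors k T Bs codes f ≤ (codes.length + 1) * B := by
  rcases f with _ | p
  · exact hB.trans (Nat.le_mul_of_pos_left _ (by omega))
  · refine (List.sum_le_card_nsmul _ B ?_).trans ?_
    · intro x hx
      obtain ⟨c, -, rfl⟩ := List.mem_map.1 hx
      rw [codeErrors]
      split_ifs
      · exact Nat.zero_le _
      · exact (List.count_le_length).trans hB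
    · simp only [List.length_map, smul_eq_mul]
      exact Nat.mul_le_mul_right _ (by omega)

/-- Count in `err` the holdout samples on which the predictor in `p` errs, one code at a time. -/
def evaluate (codes : List (List Bool × List Bool)) : Prog m k :=
  block [dup .p .arg .t1, splitPredictor, descFrom .er, clear .er,
    block (codes.map evalCode), clear .arg, clear .desc]

theorem Run.evalCodes {codes : List (List Bool × List Bool)} {s : Store m k} {T W B : ℕ}
    {w p : List Bool} {Bs : List (List Bool)} (h : Ready ((s.set .desc []).set .arg []) T W B w Bs)
    (hE : Nat.log 2 (p.takeWhile id).length ≤ Nat.log 2 B)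
    (hdesc : s.reg .desc = (nthMachine k (p.takeWhile id).length).encode)
    (harg : s.reg .arg = p.drop ((p.takeWhile id).length + 1))
    (hp : p.length ≤ w.length + T + 2) (hc : ∀ c ∈ codes, c.1.length + c.2.length = W)
    (hBs : ∀ b ∈ Bs, b.length = W + 1) :
    Run (block (codes.map UniversalLearner.evalCode)) s
      (s.set .err (List.replicate (codes.map (codeErrors k T Bs p)).sum true ++ s.reg .err))
      (codes.length * (500 * ((k + 1) * ((B + 1) * (Nat.log 2 B + 1) ^ 2)))) := by
  induction codes generalizing s with
  | nil => exact Run.nil.conv (Store.set_self (by simp)).symm (by simp)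
  | cons c codes ih =>
    have hcW := hc c (by simp)
    have hM : (nthMachine k (p.takeWhile id).length).encode.length ≤ Nat.log 2 B :=
      (Machine.length_encode_decode_le _).trans ((length_nthWord_le _).trans hE)
    have hev : Run (UniversalLearner.evalCode c) s
        (s.set .err (List.replicate (codeErrors k T Bs p c) true ++ s.reg .err)) _ :=
      Run.evalCode h hM hdesc harg ((List.drop_sublist _ _).length_le.trans hp) hcW.le
        (fun b hb => by rw [hcW]; exact hBs b hb)
    refine (Run.cons hev (ih (h.of_eq (by simp) fun r h1 _ _ _ _ _ _ => by simp [h1])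
      (by simp [hdesc]) (by simp [harg]) fun c hc' => hc c (by simp [hc']))).conv ?_ ?_
    · refine Store.ext' ⟨by simp, by simp, fun r => ?_⟩
      cases r <;> simp [← List.append_assoc, List.replicate_append_replicate, Nat.add_comm]
    · rw [List.length_cons]
      exact le_of_eq (by ring)

theorem length_output_le {M : Machine k} {w p : List Bool} {T : ℕ} (h : M.output w T = some p) :
    p.length ≤ w.length + T + 1 := by
  have h1 := length_readWord_le (fits_run M w T (Fin.last k))
  rw [Machine.output] at h
  split_ifs at h
  rw [Option.some.injEq] at h
  rw [← h]
  omega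

/-- The cost of evaluating a predictor is that of one simulation for each code. -/
theorem Run.evaluate {codes : List (List Bool × List Bool)} {s : Store m k} {T W B : ℕ}
    {w p : List Bool} {Bs : List (List Bool)} (h : Ready s T W B w Bs) (hp' : s.reg .p = p)
    (herr : s.reg .err = []) (hp : p.length ≤ w.length + T + 2)
    (hc : ∀ c ∈ codes, c.1.length + c.2.length = W) (hBs : ∀ b ∈ Bs, b.length = W + 1) :
    Run (evaluate codes) s (s.set .err (List.replicate (errors k T Bs codes (some p)) true))
      ((codes.length + 1) * (500 * ((k + 1) * ((B + 1) * (Nat.log 2 B + 1) ^ 2)))) := by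
  have hlt := h.lt_big
  have hle := h.big_le
  have hpB : p.length ≤ B := by omega
  have hlog : Nat.log 2 p.length ≤ Nat.log 2 B := Nat.log_mono_right hpB
  have heB : Nat.log 2 (p.takeWhile id).length ≤ Nat.log 2 B :=
    Nat.log_mono_right ((List.takeWhile_sublist _).length_le.trans hpB)
  have hel : (nthWord (p.takeWhile id).length).length ≤ Nat.log 2 B :=
    (length_nthWord_le _).trans heB
  have hEl : (nthMachine k (p.takeWhile id).length).encode.length ≤ Nat.log 2 B :=
    (Machine.length_encode_decode_le _).trans hel
  have h1 := Run.descFrom (m := m) (k := k) (a := .er) (s := (s.set .arg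
    (p.drop ((p.takeWhile id).length + 1))).set .er (nthWord (p.takeWhile id).length).reverse)
    ⟨by simp, by simp⟩ (by simp; rfl) (by simp [h.hc]) (by simp [h.t1]) (by simp [h.desc])
    (by simp [h.d]) (by simp [h.bad])
  rw [List.reverse_reverse] at h1
  set e := (p.takeWhile id).length with he
  set a := p.drop (e + 1) with ha
  have hal : a.length ≤ p.length := (List.drop_sublist _ _).length_le
  have h2 := Run.evalCodes (m := m) (k := k) (codes := codes) (p := p) (Bs := Bs) (T := T) (W := W)
    (B := B) (w := w) (s := (s.set .arg a).set .desc (nthMachine k e).encode)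
    (h.of_eq (by simp) fun r _ _ _ _ _ _ _ => by cases r <;> simp [h.desc, h.arg]) heB
    (by simp; rfl) (by simp; rfl) hp hc hBs
  set Λ := Nat.log 2 B
  set X := (B + 1) * (Λ + 1) ^ 2 with hX
  have hBX : B + 1 ≤ X := Nat.le_mul_of_pos_right _ (by positivity)
  have hΛX : (Λ + 1) ^ 2 ≤ X := Nat.le_mul_of_pos_left _ (by positivity)
  have hXY : X ≤ (k + 1) * X := Nat.le_mul_of_pos_left _ (by positivity)
  have hΛ2 : Λ + 1 ≤ (Λ + 1) ^ 2 := Nat.le_self_pow (by norm_num) _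
  have hdl : (k + 1) * ((nthWord e).reverse.length + 1) ^ 2 ≤ (k + 1) * X :=
    Nat.mul_le_mul_left _ ((Nat.pow_le_pow_left (by simpa using hel) 2).trans hΛX)
  have hsp : p.length * (10 * Nat.log 2 p.length + 14) ≤ 14 * X := by
    calc _ ≤ (B + 1) * (14 * (Λ + 1) ^ 2) := Nat.mul_le_mul (by omega) (by omega)
      _ = _ := by rw [hX]; ring
  refine (Run.cons (.dup (u := p) (w := []) (by simp) (by simp) (by simp) h.t1 hp' h.arg)
    (.cons ((Run.splitPredictor (p := p) (by simp) (by simp [h.er]) (by simp [h.t1])).conv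
      (s₂ := (s.set .arg a).set .er (nthWord e).reverse) ?_ le_rfl)
    (.cons h1 (.cons ((Run.clear (u := (nthWord e).reverse) (by simp)).conv
      (s₂ := (s.set .arg a).set .desc (nthMachine k e).encode) ?_ le_rfl)
    (.cons h2 (.cons (.clear (u := a) (by simp)) (.cons
      (.clear (u := (nthMachine k e).encode) (by simp)) .nil))))))).conv ?_ ?_
  · refine Store.ext' ⟨by simp, by simp, fun r => ?_⟩
    cases r <;> simp [ha, he]
  · refine Store.ext' ⟨by simp, by simp, fun r => ?_⟩
    cases r <;> simp [h.er, nthMachine]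
  · refine Store.ext' ⟨by simp, by simp, fun r => ?_⟩
    cases r <;> simp [h.desc, h.arg, herr, errors]
  · rw [Nat.add_mul codes.length, Nat.one_mul]
    simp only [List.length_reverse] at *
    omega

/-- Replace the best predictor so far by the one in `p`, unless the latter has more errors. -/
def update : Prog m k :=
  block [dup .best .hc .t1, dup .err .ck .t1,
    whileR .ck Option.isSome (block [pop .ck, ifR .hc Option.isSome (pop .hc) (push .fl true)]),
    clear .hc,
    ifR .fl Option.isSome (clear .fl)
      (block [clear .best, move .err .best, clear .out, dup .p .out .t1]),
    clear .err, clear .p]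

theorem Run.update {s : Store m k} {b e E : ℕ} {p o : List Bool}
    (hb : s.reg .best = List.replicate b true) (he : s.reg .err = List.replicate e true)
    (hp : s.reg .p = p) (ho : s.reg .out = o) (hhc : s.reg .hc = []) (hck : s.reg .ck = [])
    (hfl : s.reg .fl = []) (ht : s.reg .t1 = []) (hbE : b ≤ E) (heE : e ≤ E) (hpE : p.length ≤ E)
    (hoE : o.length ≤ E) :
    Run update s ((((s.set .best (List.replicate (if e ≤ b then e else b) true)).set .out
      (if e ≤ b then p else o)).set .err []).set .p []) (100 * (E + 1)) := by
  have key : ∀ (e b f : ℕ) (s : Store m k), s.reg .ck = List.replicate e true →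
      s.reg .hc = List.replicate b true → s.reg .fl = List.replicate f true →
      Run (whileR .ck Option.isSome (block [UniversalLearner.pop .ck,
        ifR .hc Option.isSome (UniversalLearner.pop .hc) (UniversalLearner.push .fl true)])) s
        (((s.set .ck []).set .hc (List.replicate (b - e) true)).set .fl
          (List.replicate (f + (e - b)) true)) (5 * e + 1) := by
    intro e
    induction e with
    | zero =>
      intro b f s h1 h2 h3
      refine (Run.whileR_false (by simp [h1])).conv ?_ (by simp)
      exact Store.ext' ⟨by simp, by simp, fun r => by cases r <;> simp [h1, h2, h3]⟩
    | succ e ih =>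
      intro b f s h1 h2 h3
      rcases b with _ | b
      · refine (Run.whileR_true (by simp [h1]) (.cons (.pop _ _) (.cons (.ifR_false (by simp [h2])
          (.push _ _ _)) .nil)) (ih 0 (f + 1) _ (by simp [h1]) (by simp [h2])
          (by simp [h3, List.replicate_succ]))).conv ?_ (by omega)
        refine Store.ext' ⟨by simp, by simp, fun r => ?_⟩
        cases r <;> simp [show f + 1 + e = f + (e + 1) by omega]
      · refine (Run.whileR_true (by simp [h1]) (.cons (.pop _ _) (.cons (.ifR_true (by simp [h2])
          (.pop _ _)) .nil)) (ih b f _ (by simp [h1]) (by simp [h2])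
          (by simp [h3]))).conv ?_ (by omega)
        refine Store.ext' ⟨by simp, by simp, fun r => ?_⟩
        cases r <;> simp
  have h1 := Run.dup (m := m) (k := k) (a := .best) (b := .hc) (t := .t1) (by simp) (by simp)
    (by simp) ht hb hhc
  have h2 := Run.dup (m := m) (k := k) (a := .err) (b := .ck) (t := .t1) (u := List.replicate e true)
    (w := []) (s := s.set .hc (List.replicate b true ++ [])) (by simp) (by simp)
    (by simp) (by simp [ht]) (by simp [he]) (by simp [hck])
  have h3 := key e b 0 ((s.set .hc (List.replicate b true ++ [])).set .ck
    (List.replicate e true ++ [])) (by simp) (by simp) (by simp [hfl])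
  by_cases heb : e ≤ b
  · refine (Run.cons h1 (.cons h2 (.cons h3 (.cons (.clear (u := List.replicate (b - e) true)
      (by simp)) (.cons (.ifR_false (by simp [heb]) (.cons (.clear (by simp [hb]; rfl))
      (.cons (.move (by simp) (u := List.replicate e true) (w := []) (by simp [he]) (by simp))
      (.cons (.clear (u := o) (by simp [ho])) (.cons (.dup (u := p) (w := []) (by simp) (by simp)
      (by simp) (by simp [ht]) (by simp [hp]) (by simp)) .nil)))))
      (.cons (.clear (u := []) (by simp)) (.cons (.clear (u := p) (by simp [hp]))
        .nil))))))).conv ?_ ?_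
    · refine Store.ext' ⟨by simp, by simp, fun r => ?_⟩
      cases r <;> simp [heb, hhc, hck, hfl]
    · simp only [List.length_replicate, List.length_nil]; omega
  · have h0 : b - e = 0 := by omega
    refine (Run.cons h1 (.cons h2 (.cons h3 (.cons (.clear (u := [])
      (by simp [h0])) (.cons (.ifR_true (by simp [List.head?_replicate]; omega) (.clear
      (u := List.replicate (e - b) true) (by simp)))
      (.cons (.clear (u := List.replicate e true) (by simp [he])) (.cons (.clear (u := p)
        (by simp [hp])) .nil))))))).conv ?_ ?_
    · refine Store.ext' ⟨by simp, by simp, fun r => ?_⟩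
      cases r <;> simp [heb, hhc, hck, hfl, hb, ho]
    · simp only [List.length_replicate, List.length_nil]; omega

/-- Train the machine described by `wr`, evaluate its predictor, and go on to the next machine. -/
def trial (codes : List (List Bool × List Bool)) : Prog m k :=
  block [train, ifR .has Option.isSome (block [pop .has, evaluate codes]) (dup .mm .err .t1),
    update, advance .wr]

/-- Keep the best number of errors so far and its predictor, or replace them by those of the
`i`-th machine. -/
noncomputable def better (k T : ℕ) (w : List Bool) (Bs : List (List Bool))
    (codes : List (List Bool × List Bool)) (x : ℕ × List Bool) (i : ℕ) : ℕ × List Bool :=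
  if errors k T Bs codes ((nthMachine k i).output w T) ≤ x.1 then
    (errors k T Bs codes ((nthMachine k i).output w T), ((nthMachine k i).output w T).getD [])
  else x

theorem Run.trial {codes : List (List Bool × List Bool)} {s : Store m k} {T W B i b : ℕ}
    {w o : List Bool} {Bs : List (List Bool)} (h : Ready s T W B w Bs) (hi1 : 1 ≤ i) (hi : i ≤ B)
    (hwr : s.reg .wr = (nthWord i).reverse) (hp : s.reg .p = []) (hhas : s.reg .has = [])
    (herr : s.reg .err = []) (hmm : s.reg .mm = List.replicate Bs.length true)
    (hbest : s.reg .best = List.replicate b true) (ho : s.reg .out = o) (hB : Bs.length ≤ B)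
    (hbB : b ≤ (codes.length + 1) * B) (hoB : o.length ≤ B)
    (hc : ∀ c ∈ codes, c.1.length + c.2.length = W) (hBs : ∀ b ∈ Bs, b.length = W + 1) :
    Run (trial codes) s (((s.set .best (List.replicate (better k T w Bs codes (b, o) i).1 true)).set
      .out (better k T w Bs codes (b, o) i).2).set .wr (nthWord (i + 1)).reverse)
      (2000 * (codes.length + 1) * ((k + 1) * ((B + 1) * (Nat.log 2 B + 1) ^ 2))) := by
  have hlt := h.lt_big
  have hle := h.big_le
  have hilog : Nat.log 2 i ≤ Nat.log 2 B := Nat.log_mono_right hi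
  have hil := (length_nthWord_le i).trans hilog
  set N := codes.length + 1 with hN
  set Λ := Nat.log 2 B
  set X := (B + 1) * (Λ + 1) ^ 2 with hX
  have hBX : B + 1 ≤ X := Nat.le_mul_of_pos_right _ (by positivity)
  have hΛX : (Λ + 1) ^ 2 ≤ X := Nat.le_mul_of_pos_left _ (by positivity)
  have hXY : X ≤ (k + 1) * X := Nat.le_mul_of_pos_left _ (by positivity)
  have hΛ2 : Λ + 1 ≤ (Λ + 1) ^ 2 := Nat.le_self_pow (by norm_num) _
  have hYN : (k + 1) * X ≤ N * ((k + 1) * X) := Nat.le_mul_of_pos_left _ (by omega)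
  have hNB : N * B + N ≤ N * ((k + 1) * X) := by
    rw [← Nat.mul_succ]; exact Nat.mul_le_mul_left _ (by omega)
  have h1 := Run.train h hwr hilog hp hhas
  change Run _ _ _ (500 * ((k + 1) * X)) at h1
  set f := (nthMachine k i).output w T with hf
  have hfl : (f.getD []).length ≤ w.length + T + 1 := by
    rcases hf' : f with _ | p
    · simp
    · exact length_output_le (hf.symm.trans hf')
  have hadv : ∀ s' : Store m k, s'.reg .wr = (nthWord i).reverse → s'.reg .t1 = [] →
      Run (UniversalLearner.advance .wr) s' (s'.set .wr (nthWord (i + 1)).reverse)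
        (10 * Λ + 12) := fun s' h1 h2 => by
    refine (Run.advance (by simp) h1 h2).conv (by rw [reverse_nthWord_succ hi1]) ?_
    rw [List.length_reverse]; omega
  have h2 : Run (ifR .has Option.isSome (block [UniversalLearner.pop .has,
      UniversalLearner.evaluate codes]) (UniversalLearner.dup .mm .err .t1))
      ((s.set .p (f.getD [])).set .has (flag f.isSome))
      ((s.set .p (f.getD [])).set .err (List.replicate (errors k T Bs codes f) true))
      (502 * (N * ((k + 1) * X))) := by
    rcases f with _ | p
    · refine (Run.ifR_false (by simp) (.dup (u := List.replicate Bs.length true) (w := [])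
        (by simp) (by simp) (by simp) (by simp [h.t1]) (by simp [hmm])
        (by simp [herr]))).conv ?_ ?_
      · refine Store.ext' ⟨by simp, by simp, fun r => ?_⟩
        cases r <;> simp [errors, hhas]
      · rw [List.length_replicate]; omega
    · have h3 := Run.evaluate (codes := codes) (p := p) (s := s.set .p p) (T := T) (W := W)
        (B := B) (w := w) (Bs := Bs) (h.of_eq (by simp) fun r _ h2 _ _ _ _ _ => by simp [h2])
        (by simp) (by simp [herr]) (hfl.trans (by omega)) hc hBs
      change Run _ _ _ (N * (500 * ((k + 1) * X))) at h3
      refine (Run.ifR_true (by simp) (.cons ((Run.pop _ _).conv (s₂ := s.set .p p) ?_ le_rfl)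
        (.cons h3 .nil))).conv ?_ ?_
      · refine Store.ext' ⟨by simp, by simp, fun r => ?_⟩
        cases r <;> simp [hhas]
      · simp
      · rw [Nat.mul_left_comm N]; omega
  have h3 := Run.update (s := (s.set .p (f.getD [])).set .err
    (List.replicate (errors k T Bs codes f) true)) (b := b) (e := errors k T Bs codes f)
    (E := N * B + B) (p := f.getD []) (o := o)
    (by simp [hbest]) (by simp) (by simp) (by simp [ho]) (by simp [h.hc]) (by simp [h.ck])
    (by simp [h.fl]) (by simp [h.t1]) (by omega) ((errors_le hB f).trans (Nat.le_add_right _ _))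
    (by omega) (by omega)
  refine (Run.cons h1 (.cons h2 (.cons h3 (.cons (hadv _ (by simp [hwr]) (by simp [h.t1]))
    .nil)))).conv ?_ ?_
  · refine Store.ext' ⟨by simp, by simp, fun r => ?_⟩
    rw [better, ← hf]
    cases r <;> simp [hp, herr] <;> split_ifs <;> rfl
  · rw [Nat.mul_assoc 2000]; omega

/-- As many rounds as `kk` tells, one for each machine. -/
def mainLoop (codes : List (List Bool × List Bool)) : Prog m k :=
  whileR .kk Option.isSome (block [pop .kk, trial codes])

theorem better_fst_le {T B : ℕ} {w : List Bool} {Bs : List (List Bool)}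
    {codes : List (List Bool × List Bool)} (hB : Bs.length ≤ B) {x : ℕ × List Bool}
    (hx : x.1 ≤ (codes.length + 1) * B) (i : ℕ) :
    (better k T w Bs codes x i).1 ≤ (codes.length + 1) * B := by
  rw [better]
  split_ifs
  · exact errors_le hB _
  · exact hx

theorem length_better_snd_le {T B : ℕ} {w : List Bool} {Bs : List (List Bool)}
    {codes : List (List Bool × List Bool)} (hB : w.length + T + 1 ≤ B) {x : ℕ × List Bool}
    (hx : x.2.length ≤ B) (i : ℕ) : (better k T w Bs codes x i).2.length ≤ B := by
  rw [better]
  split_ifs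
  · rcases hf : (nthMachine k i).output w T with _ | p
    · simp
    · exact (length_output_le hf).trans hB
  · exact hx

theorem Run.mainLoop {codes : List (List Bool × List Bool)} {T W B K i b : ℕ} {s : Store m k}
    {w o : List Bool} {Bs : List (List Bool)} (h : Ready s T W B w Bs) (hi1 : 1 ≤ i)
    (hi : i + K ≤ B + 1) (hkk : s.reg .kk = List.replicate K true)
    (hwr : s.reg .wr = (nthWord i).reverse) (hp : s.reg .p = []) (hhas : s.reg .has = [])
    (herr : s.reg .err = []) (hmm : s.reg .mm = List.replicate Bs.length true)
    (hbest : s.reg .best = List.replicate b true) (ho : s.reg .out = o) (hB : Bs.length ≤ B)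
    (hbB : b ≤ (codes.length + 1) * B) (hoB : o.length ≤ B)
    (hc : ∀ c ∈ codes, c.1.length + c.2.length = W) (hBs : ∀ b ∈ Bs, b.length = W + 1) :
    ∃ s', Run (mainLoop codes) s s'
      (K * (2002 * (codes.length + 1) * ((k + 1) * ((B + 1) * (Nat.log 2 B + 1) ^ 2))) + 1) ∧
      s'.reg .out = ((List.range' i K).foldl (better k T w Bs codes) (b, o)).2 := by
  induction K generalizing i b o s with
  | zero =>
    exact ⟨s, (Run.whileR_false (by simp [hkk])).mono (by omega), by simp [ho]⟩
  | succ K ih =>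
    have hlt := h.lt_big
    have hle := h.big_le
    have h' : Ready (s.set .kk (List.replicate K true)) T W B w Bs :=
      h.of_eq (by simp) fun r _ _ _ _ _ _ h7 => by simp [h7]
    have h1 := Run.trial (i := i) (b := b) (o := o) h' hi1 (by omega) (by simp [hwr])
      (by simp [hp]) (by simp [hhas]) (by simp [herr]) (by simp [hmm]) (by simp [hbest])
      (by simp [ho]) hB hbB hoB hc hBs
    obtain ⟨s', h2, h3⟩ := ih (i := i + 1) (b := (better k T w Bs codes (b, o) i).1)
      (o := (better k T w Bs codes (b, o) i).2)
      (s := (((s.set .kk (List.replicate K true)).set .best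
        (List.replicate (better k T w Bs codes (b, o) i).1 true)).set .out
        (better k T w Bs codes (b, o) i).2).set .wr (nthWord (i + 1)).reverse)
      (h.of_eq (by simp) fun r _ _ _ h4 h5 h6 h7 => by simp [h4, h5, h6, h7]) (by omega)
      (by omega) (by simp) (by simp) (by simp [hp]) (by simp [hhas]) (by simp [herr])
      (by simp [hmm]) (by simp) (by simp) (better_fst_le hB hbB i)
      (length_better_snd_le (by omega) hoB i)
    refine ⟨s', (Run.whileR_true (by simp [hkk]) (.cons ((Run.pop _ _).conv
      (s₂ := s.set .kk (List.replicate K true)) (by simp [hkk]) le_rfl) (.cons h1 .nil))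
      h2).mono ?_, by rw [h3]; rfl⟩
    have : 1 ≤ (codes.length + 1) * ((k + 1) * ((B + 1) * (Nat.log 2 B + 1) ^ 2)) :=
      Nat.succ_le_of_lt (by positivity)
    rw [Nat.add_mul K 1, Nat.mul_assoc 2002, Nat.mul_assoc 2000]
    omega

/-! ### The time bound -/

/-- Put `1`s in front of the word on the first tape of the machine that computes the time bound, as
many as `u` has. -/
def loadTime : Prog m k :=
  whileR .u Option.isSome (block [pop .u, Frag.act1 (.inl 0) id (some Dir.left),
    Frag.act1 (.inl 0) (fun _ => some true) none])

theorem Run.act1 (j : Fin (m + 1)) (o : Option Bool → Option Bool) (d : Option Dir)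
    (s : Store m k) :
    Run (Frag.act1 (.inl j) o d) s
      (s.setAux (Function.update s.aux j (moveHead d ((s.aux j).write (o (s.aux j).head))))) 1 := by
  have h : (s.setAux (Function.update s.aux j
      (moveHead d ((s.aux j).write (o (s.aux j).head))))).phys =
      Function.update s.phys (.inl j) (moveHead d ((s.aux j).write (o (s.aux j).head))) := by
    funext i
    rcases i with i | i
    · by_cases hi : i = j
      · subst hi; rw [Function.update_self]; exact Function.update_self _ _ _
      · rw [Function.update_of_ne fun h => hi (Sum.inl_injective h)]
        exact Function.update_of_ne hi _ _
    · rw [Function.update_of_ne Sum.inr_ne_inl]; rfl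
  unfold Run
  rw [h]
  exact Frag.exec_act1 (.inl j) o d s.phys

theorem Run.loadTime {n : ℕ} {v : List Bool} {s : Store m k}
    (hu : s.reg .u = List.replicate n true) (hs : s.aux = (Machine.init m v).tape) :
    Run loadTime s ((s.set .u []).setAux (Machine.init m (List.replicate n true ++ v)).tape)
      (4 * n + 1) := by
  induction n generalizing v s with
  | zero =>
    refine (Run.whileR_false (by simp [hu])).conv ?_ (by simp)
    exact Store.ext' ⟨by simp [hs], by simp, fun r => by cases r <;> simp [hu]⟩
  | succ n ih =>
    refine (Run.whileR_true (by simp [hu]) (.cons (.pop _ _) (.cons (.act1 _ _ _ _)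
      (.cons (.act1 _ _ _ _) .nil))) (ih (v := true :: v) (by simp [hu]) ?_)).conv ?_ (by omega)
    · funext j
      by_cases hj : j = 0
      · subst hj; simp [hs, init_tape, moveHead, stackTape_push]
      · simp [hs, init_tape, hj]
    · refine Store.ext' ⟨?_, by simp, fun r => by cases r <;> simp⟩
      simp [List.replicate_succ', List.append_assoc]

theorem Run.ofMachine (M : Machine m) {w : List Bool} {t : ℕ}
    (hM : (M.step (M.run w t)).isNone) {s : Store m k} (hs : s.aux = (Machine.init m w).tape) :
    Run (Frag.ofMachine M Sum.inl) s (s.setAux (M.run w t).tape) (t + 1) := by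
  have h := Frag.exec_ofMachine (ι := Idx m k) M Sum.inl_injective w t hM s.phys
    fun j => congrFun hs j
  have hp : (s.setAux (M.run w t).tape).phys =
      Frag.place (Sum.inl : Fin (m + 1) → Idx m k) (M.run w t).tape s.phys := by
    funext i
    rcases i with i | i
    · rw [Frag.place_apply Sum.inl_injective]; rfl
    · rw [Frag.place_apply_of_ne _ _ (by simp)]; rfl
  unfold Run
  rw [hp]
  exact h

/-- Move the word at the head of the last tape of the machine that computes the time bound to `t2`,
in reverse order. -/
def readTime : Prog m k :=
  Frag.loop (.inl (Fin.last m)) Option.isSome (block [Frag.ite (.inl (Fin.last m)) isOne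
    (push .t2 true) (push .t2 false), Frag.act1 (.inl (Fin.last m)) id (some Dir.right)])

theorem exists_mk₂ (t : Tape (Option Bool)) : ∃ L R, t = Tape.mk₂ L R := by
  obtain ⟨x, l, r⟩ := t
  obtain ⟨L, rfl⟩ : ∃ L, ListBlank.mk L = l := Quot.exists_rep l
  obtain ⟨R, rfl⟩ : ∃ L, ListBlank.mk L = r := Quot.exists_rep r
  exact ⟨L, x :: R, by simp [Tape.mk₂, Tape.mk']⟩

theorem Run.readTime (s : Store m k) :
    ∃ tp, Run readTime s ((s.set .t2 ((readWord (s.aux (Fin.last m))).reverse ++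
      s.reg .t2)).setAux tp) (5 * (readWord (s.aux (Fin.last m))).length + 1) := by
  obtain ⟨L, R, hLR⟩ := exists_mk₂ (s.aux (Fin.last m))
  rw [hLR]
  induction R generalizing L s with
  | nil =>
    have h0 : Option.isSome (s.phys (.inl (Fin.last m))).head = false := by
      change Option.isSome (s.aux (Fin.last m)).head = false
      rw [hLR, mk₂_head]; rfl
    refine ⟨s.aux, (show Run UniversalLearner.readTime s s 1 from Frag.exec_loop_false h0).conv ?_ (by simp)⟩
    exact Store.ext' ⟨by simp, by simp, fun r => by cases r <;> simp [readWord_nil]⟩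
  | cons x R ih =>
    rcases x with _ | b
    · have h0 : Option.isSome (s.phys (.inl (Fin.last m))).head = false := by
        change Option.isSome (s.aux (Fin.last m)).head = false
        rw [hLR, mk₂_head]; rfl
      refine ⟨s.aux, (show Run UniversalLearner.readTime s s 1 from Frag.exec_loop_false h0).conv ?_ (by simp)⟩
      exact Store.ext' ⟨by simp, by simp, fun r => by cases r <;> simp [readWord_none]⟩
    · have h0 : (s.aux (Fin.last m)).head = some b := by rw [hLR, mk₂_head]; rfl
      have h1 : Run (Frag.ite (.inl (Fin.last m)) isOne (UniversalLearner.push .t2 true)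
          (UniversalLearner.push .t2 false)) s (s.set .t2 (b :: s.reg .t2)) 3 := by
        cases b
        · exact Frag.exec_ite_false (show isOne (s.aux (Fin.last m)).head = false by
            rw [h0]; rfl) (Run.push .t2 false s)
        · exact Frag.exec_ite_true (show isOne (s.aux (Fin.last m)).head = true by
            rw [h0]; rfl) (Run.push .t2 true s)
      have h2 := Run.act1 (Fin.last m) id (some Dir.right) (s.set .t2 (b :: s.reg .t2))
      obtain ⟨tp, h3⟩ := ih (s := (s.set .t2 (b :: s.reg .t2)).setAux
        (Function.update s.aux (Fin.last m) (moveHead (some Dir.right) ((s.aux (Fin.last m)).write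
          (s.aux (Fin.last m)).head)))) (L := some b :: L) (by simp [hLR, moveHead, mk₂_right, mk₂_head, mk₂_write])
      refine ⟨tp, (show Run UniversalLearner.readTime s _ (1 + (3 + (1 + 0)) + _) from
        Frag.exec_loop_true (show Option.isSome (s.aux (Fin.last m)).head = true by rw [h0]; rfl)
        (Run.cons h1 (.cons h2 .nil)) h3).conv ?_ ?_⟩
      · refine Store.ext' ⟨by simp, by simp, fun r => ?_⟩
        cases r <;> simp [readWord_some]
      · rw [readWord_some, List.length_cons]; omega

/-- Replace the binary number in `t2`, most significant digit first, by its unary form in `clk`. -/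
def toUnary : Prog m k :=
  whileR .t2 Option.isSome (block [dup .clk .u .t1, move .u .clk,
    ifR .t2 isOne (push .clk true) (block []), pop .t2])

theorem Run.toUnary {u : List Bool} {x : ℕ} {s : Store m k} (ht : s.reg .t2 = u)
    (hclk : s.reg .clk = List.replicate x true) (hu : s.reg .u = []) (ht1 : s.reg .t1 = []) :
    Run toUnary s ((s.set .t2 []).set .clk
      (List.replicate (u.foldl (fun x b => 2 * x + b.toNat) x) true))
      (20 * (u.foldl (fun x b => 2 * x + b.toNat) x - x) + 10 * u.length + 1) ∧
    x ≤ u.foldl (fun x b => 2 * x + b.toNat) x := by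
  induction u generalizing x s with
  | nil =>
    refine ⟨(Run.whileR_false (by simp [ht])).conv ?_ (by simp), le_rfl⟩
    exact Store.ext' ⟨by simp, by simp, fun r => by cases r <;> simp [ht, hclk]⟩
  | cons b u ih =>
    have h1 := Run.dup (a := .clk) (b := .u) (t := .t1) (s := s) (by simp) (by simp) (by simp) ht1
      hclk hu
    have h2 := Run.move (a := .u) (b := .clk) (s := s.set .u (List.replicate x true ++ []))
      (u := List.replicate x true) (w := List.replicate x true) (by simp) (by simp) (by simp [hclk])
    have h3 : Run (ifR .t2 isOne (UniversalLearner.push .clk true) (block []))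
        (s.set .clk (List.replicate (2 * x) true))
        (s.set .clk (List.replicate (2 * x + b.toNat) true)) 3 := by
      cases b
      · exact (Run.ifR_false (by simp [ht]) .nil).conv rfl (by omega)
      · exact (Run.ifR_true (by simp [ht]) (.push _ _ _)).conv
          (by simp [List.replicate_succ]) (by omega)
    obtain ⟨h4, h5⟩ := ih (x := 2 * x + b.toNat)
      (s := (s.set .clk (List.replicate (2 * x + b.toNat) true)).set .t2 u)
      (by simp) (by simp) (by simp [hu]) (by simp [ht1])
    refine ⟨(Run.whileR_true (by simp [ht]) (.cons h1 (.cons (h2.conv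
      (s₂ := s.set .clk (List.replicate (2 * x) true)) ?_ le_rfl) (.cons h3 (.cons ((Run.pop _
      _).conv (s₂ := (s.set .clk (List.replicate (2 * x + b.toNat) true)).set .t2 u)
      (by simp [ht]) le_rfl) .nil)))) h4).conv ?_ ?_, ?_⟩
    · refine Store.ext' ⟨by simp, by simp, fun r => ?_⟩
      cases r <;> simp [hu, List.replicate_append_replicate, two_mul]
    · refine Store.ext' ⟨by simp, by simp, fun r => ?_⟩
      cases r <;> simp
    · simp only [List.length_replicate, List.length_cons, List.foldl_cons]
      omega
    · rw [List.foldl_cons]; omega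

theorem foldl_bits_reverse (n : ℕ) :
    n.bits.reverse.foldl (fun x b => 2 * x + b.toNat) 0 = n := by
  rw [List.foldl_reverse]
  induction n using Nat.binaryRec' with
  | zero => simp
  | bit b n hn ih =>
    rw [Nat.bits_append_bit n b hn, List.foldr_cons, ih, Nat.bit_val]

/-- Compute the time bound in unary from the number of samples in unary. -/
noncomputable def computeTime (M : Machine m) : Prog m k :=
  block [dup .nn .u .t1, loadTime, Frag.ofMachine M Sum.inl, readTime, toUnary, push .clk true]

theorem Run.computeTime {M : Machine m} {n t T : ℕ} {s : Store m k}
    (hM : M.output (List.replicate n true) t = some T.bits) (hn : n ≤ T)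
    (hnn : s.reg .nn = List.replicate n true) (hu : s.reg .u = []) (ht1 : s.reg .t1 = [])
    (ht2 : s.reg .t2 = []) (hclk : s.reg .clk = []) (hs : s.aux = (Machine.init m []).tape) :
    ∃ tp, Run (computeTime M) s ((s.set .clk (List.replicate (T + 1) true)).setAux tp)
      (60 * T + t + 10) := by
  have hT : T.bits.length ≤ T := by
    rw [Nat.size_eq_bits_len]
    exact Nat.size_le.2 Nat.lt_two_pow_self
  have h1 := Run.loadTime (n := n) (v := []) (s := s.set .u (List.replicate n true))
    (by simp) (by simp [hs])
  rw [List.append_nil] at h1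
  have hM1 : (M.step (M.run (List.replicate n true) t)).isNone := by
    by_contra h
    simp [Machine.output, h] at hM
  have hM2 : readWord ((M.run (List.replicate n true) t).tape (Fin.last m)) = T.bits := by
    rw [Machine.output, if_pos hM1] at hM
    simpa using hM
  have h2 := Run.ofMachine M hM1 (s := s.setAux (Machine.init m (List.replicate n true)).tape)
    (by simp)
  obtain ⟨tp, h3⟩ := Run.readTime (s.setAux (M.run (List.replicate n true) t).tape)
  simp only [Store.setAux_aux, Store.setAux_reg] at h3
  rw [hM2, ht2] at h3
  obtain ⟨h4, -⟩ := Run.toUnary (u := T.bits.reverse) (x := 0)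
    (s := ((s.set .t2 T.bits.reverse)).setAux tp) (by simp) (by simp [hclk]) (by simp [hu])
    (by simp [ht1])
  rw [foldl_bits_reverse] at h4
  have h0 := Run.dup (a := .nn) (b := .u) (t := .t1) (s := s) (by simp) (by simp) (by simp) ht1
    hnn hu
  rw [List.append_nil] at h0
  refine ⟨tp, (Run.cons h0 (.cons (h1.conv
    (s₂ := s.setAux (Machine.init m (List.replicate n true)).tape) ?_ le_rfl) (.cons (h2.conv
    (s₂ := s.setAux (M.run (List.replicate n true) t).tape) ?_ le_rfl) (.cons (h3.conv
    (s₂ := ((s.set .t2 T.bits.reverse)).setAux tp) ?_ le_rfl) (.cons h4 (.cons (.push _ _ _)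
    .nil)))))).conv ?_ ?_⟩
  · refine Store.ext' ⟨by simp, by simp, fun r => ?_⟩
    cases r <;> simp [hu]
  · exact Store.ext' ⟨by simp, by simp, fun r => by simp⟩
  · refine Store.ext' ⟨by simp, by simp, fun r => ?_⟩
    cases r <;> simp
  · refine Store.ext' ⟨by simp, by simp, fun r => ?_⟩
    cases r <;> simp [ht2, List.replicate_succ]
  · simp only [List.length_replicate, List.length_reverse]
    omega

/-! ### Counting and splitting the samples -/

/-- Put one `1` for each block of `V` bits of `inp` on `nn`. -/
def countSamples (V : ℕ) : Prog m k :=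
  block [whileR .inp Option.isSome (block [shiftN V .inp .t1, push .nn true]), move .t1 .inp]

theorem Run.countSamples {V : ℕ} (hV : 1 ≤ V) {Bs : List (List Bool)} (hBs : ∀ b ∈ Bs, b.length = V)
    {s : Store m k} (hinp : s.reg .inp = Bs.flatten) (hnn : s.reg .nn = [])
    (ht : s.reg .t1 = []) :
    Run (countSamples V) s (s.set .nn (List.replicate Bs.length true))
      (20 * Bs.flatten.length + 2) := by
  have key : ∀ (Bs : List (List Bool)) (c : ℕ) (v : List Bool) (s : Store m k),
      (∀ b ∈ Bs, b.length = V) → s.reg .inp = Bs.flatten → s.reg .nn = List.replicate c true →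
      s.reg .t1 = v →
      Run (whileR .inp Option.isSome (block [UniversalLearner.shiftN V .inp .t1,
        UniversalLearner.push .nn true])) s
        (((s.set .inp []).set .nn (List.replicate (c + Bs.length) true)).set .t1
          (Bs.flatten.reverse ++ v)) (8 * Bs.flatten.length + 1) := by
    intro Bs
    induction Bs with
    | nil =>
      intro c v s _ h1 h2 h3
      refine (Run.whileR_false (by simp [h1])).conv ?_ (by simp)
      exact Store.ext' ⟨by simp, by simp, fun r => by cases r <;> simp [h1, h2, h3]⟩
    | cons b Bs ih =>
      intro c v s hBs h1 h2 h3
      have hb := hBs b (by simp)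
      have hh : Option.isSome (s.reg .inp).head? = true := by
        rw [h1]
        rcases b with _ | ⟨x, b⟩
        · simp at hb; omega
        · simp
      refine (Run.whileR_true hh (.cons (.shiftN (v := b) (u := Bs.flatten) (w := v) (by simp) hb
        (by simp [h1]) h3) (.cons (.push _ _ _) .nil)) (ih (c + 1) (b.reverse ++ v) _
        (fun b hb => hBs b (by simp [hb])) (by simp) (by simp [h2, List.replicate_succ])
        (by simp))).conv ?_ ?_
      · refine Store.ext' ⟨by simp, by simp, fun r => ?_⟩
        cases r <;> simp [show c + 1 + Bs.length = c + (Bs.length + 1) by omega]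
      · rw [List.flatten_cons, List.length_append]; omega
  refine (Run.cons (key Bs 0 [] s hBs hinp (by simp [hnn]) ht) (.cons (.move (by simp)
    (u := Bs.flatten.reverse) (w := []) (by simp) (by simp)) .nil)).conv ?_ ?_
  · refine Store.ext' ⟨by simp, by simp, fun r => ?_⟩
    cases r <;> simp [hinp, ht]
  · rw [List.length_reverse]; omega

theorem Run.popReplicate (N : ℕ) (r : Reg) (s : Store m k) :
    Run (block (List.replicate N (UniversalLearner.pop r))) s (s.set r ((s.reg r).drop N)) N := by
  induction N generalizing s with
  | zero => exact Run.nil.conv (by rw [Store.set_self (by simp)]) (by simp)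
  | succ N ih =>
    exact (Run.cons (.pop _ _) (ih _)).conv (by simp) (by omega)

theorem Run.pushReplicate (N : ℕ) (r : Reg) (s : Store m k) :
    Run (block (List.replicate N (UniversalLearner.push r true))) s
      (s.set r (List.replicate N true ++ s.reg r)) (2 * N) := by
  induction N generalizing s with
  | zero => exact Run.nil.conv (by rw [Store.set_self (by simp)]) (by simp)
  | succ N ih =>
    exact (Run.cons (.push _ _ _) (ih _)).conv (by simp [List.replicate_succ']) (by omega)

/-- Compute the number of holdout samples, the hundredth part of that in `nn`, rounded up. -/
def countHoldout : Prog m k :=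
  block [dup .nn .u .t1,
    whileR .u Option.isSome (block [push .mm true, block (List.replicate 100 (pop .u))])]

theorem Run.countHoldout {n : ℕ} {s : Store m k} (hnn : s.reg .nn = List.replicate n true)
    (hu : s.reg .u = []) (ht : s.reg .t1 = []) (hmm : s.reg .mm = []) :
    Run countHoldout s (s.set .mm (List.replicate (n - 99 * n / 100) true)) (200 * n + 5) := by
  have key : ∀ (n c : ℕ) (s : Store m k), s.reg .u = List.replicate n true →
      s.reg .mm = List.replicate c true →
      Run (whileR .u Option.isSome (block [UniversalLearner.push .mm true,
        block (List.replicate 100 (UniversalLearner.pop .u))])) s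
        ((s.set .u []).set .mm (List.replicate (c + (n - 99 * n / 100)) true)) (103 * n + 1) := by
    intro n
    induction n using Nat.strong_induction_on with
    | _ n ih =>
      intro c s h1 h2
      rcases Nat.eq_zero_or_pos n with rfl | hn
      · refine (Run.whileR_false (by simp [h1])).conv ?_ (by simp)
        exact Store.ext' ⟨by simp, by simp, fun r => by cases r <;> simp [h1, h2]⟩
      · refine (Run.whileR_true (by simp [h1, List.head?_replicate]; omega) (.cons (.push _ _ _)
          (.cons (.popReplicate _ _ _) .nil)) (ih (n - 100) (by omega) (c + 1) _
          (by simp [h1]) (by simp [h2, List.replicate_succ]))).conv ?_ (by omega)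
        refine Store.ext' ⟨by simp, by simp, fun r => ?_⟩
        have : c + 1 + (n - 100 - 99 * (n - 100) / 100) = c + (n - 99 * n / 100) := by omega
        cases r <;> simp [this]
  have h0 := Run.dup (a := .nn) (b := .u) (t := .t1) (s := s) (by simp) (by simp) (by simp) ht
    hnn hu
  rw [List.append_nil] at h0
  refine (Run.cons h0 (.cons (key n 0 _ (by simp) (by simp [hmm])) .nil)).conv ?_ ?_
  · refine Store.ext' ⟨by simp, by simp, fun r => ?_⟩
    cases r <;> simp [hu]
  · rw [List.length_replicate]; omega

/-- Compute the number of training samples. -/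
def countTraining : Prog m k :=
  block [dup .nn .n2 .t1, dup .mm .u .t1, whileR .u Option.isSome (block [pop .u, pop .n2])]

theorem Run.countTraining {n c : ℕ} {s : Store m k} (hnn : s.reg .nn = List.replicate n true)
    (hmm : s.reg .mm = List.replicate c true) (hcn : c ≤ n) (hn2 : s.reg .n2 = [])
    (hu : s.reg .u = []) (ht : s.reg .t1 = []) :
    Run countTraining s (s.set .n2 (List.replicate (n - c) true)) (40 * n + 10) := by
  have key : ∀ (c a : ℕ) (s : Store m k), s.reg .u = List.replicate c true →
      s.reg .n2 = List.replicate a true →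
      Run (whileR .u Option.isSome (block [UniversalLearner.pop .u, UniversalLearner.pop .n2])) s
        ((s.set .u []).set .n2 (List.replicate (a - c) true)) (3 * c + 1) := by
    intro c
    induction c with
    | zero =>
      intro a s h1 h2
      refine (Run.whileR_false (by simp [h1])).conv ?_ (by simp)
      exact Store.ext' ⟨by simp, by simp, fun r => by cases r <;> simp [h1, h2]⟩
    | succ c ih =>
      intro a s h1 h2
      refine (Run.whileR_true (by simp [h1]) (.cons (.pop _ _)
        (.cons (.pop _ _) .nil)) (ih (a - 1) _ (by simp [h1]) (by simp [h2]))).conv ?_ (by omega)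
      refine Store.ext' ⟨by simp, by simp, fun r => ?_⟩
      cases r <;> simp [show a - 1 - c = a - (c + 1) by omega]
  have h0 := Run.dup (a := .nn) (b := .n2) (t := .t1) (s := s) (by simp) (by simp) (by simp) ht
    hnn hn2
  have h1 := Run.dup (a := .mm) (b := .u) (t := .t1) (s := s.set .n2 (List.replicate n true))
    (u := List.replicate c true) (w := []) (by simp) (by simp) (by simp) (by simp [ht])
    (by simp [hmm]) (by simp [hu])
  rw [List.append_nil] at h0 h1
  refine (Run.cons h0 (.cons h1 (.cons (key c n _ (by simp) (by simp)) .nil))).conv ?_ ?_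
  · refine Store.ext' ⟨by simp, by simp, fun r => ?_⟩
    cases r <;> simp [hu]
  · simp only [List.length_replicate]; omega

/-- Move as many blocks of `V` bits from `inp` to `tr` as `n2` tells. -/
def splitSamples (V : ℕ) : Prog m k :=
  block [whileR .n2 Option.isSome (block [pop .n2, shiftN V .inp .t1]), move .t1 .tr]

theorem Run.splitSamples {V : ℕ} {As Bs : List (List Bool)} (hAs : ∀ b ∈ As, b.length = V)
    {s : Store m k} (hinp : s.reg .inp = As.flatten ++ Bs.flatten)
    (hn2 : s.reg .n2 = List.replicate As.length true) (htr : s.reg .tr = [])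
    (ht : s.reg .t1 = []) :
    Run (splitSamples V) s (((s.set .n2 []).set .inp Bs.flatten).set .tr As.flatten)
      (11 * As.flatten.length + 2 * As.length + 2) := by
  have key : ∀ (As : List (List Bool)) (v : List Bool) (s : Store m k), (∀ b ∈ As, b.length = V) →
      s.reg .inp = As.flatten ++ Bs.flatten → s.reg .n2 = List.replicate As.length true →
      s.reg .t1 = v →
      Run (whileR .n2 Option.isSome (block [UniversalLearner.pop .n2,
        UniversalLearner.shiftN V .inp .t1])) s
        (((s.set .n2 []).set .inp Bs.flatten).set .t1 (As.flatten.reverse ++ v))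
        (5 * As.flatten.length + 2 * As.length + 1) := by
    intro As
    induction As with
    | nil =>
      intro v s _ h1 h2 h3
      refine (Run.whileR_false (by simp [h2])).conv ?_ (by simp)
      exact Store.ext' ⟨by simp, by simp, fun r => by cases r <;> simp [h1, h2, h3]⟩
    | cons b As ih =>
      intro v s hAs h1 h2 h3
      have hb := hAs b (by simp)
      refine (Run.whileR_true (by simp [h2]) (.cons (.pop _ _) (.cons (.shiftN (v := b)
        (u := As.flatten ++ Bs.flatten) (w := v) (by simp) hb (by simp [h1]) (by simp [h3])) .nil))
        (ih (b.reverse ++ v) _ (fun b hb => hAs b (by simp [hb])) (by simp) (by simp [h2])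
        (by simp))).conv ?_ ?_
      · refine Store.ext' ⟨by simp, by simp, fun r => ?_⟩
        cases r <;> simp
      · rw [List.flatten_cons, List.length_append, List.length_cons]; omega
  refine (Run.cons (key As [] s hAs hinp hn2 ht) (.cons (.move (by simp)
    (u := As.flatten.reverse) (w := []) (by simp) (by simp [htr])) .nil)).conv ?_ ?_
  · refine Store.ext' ⟨by simp, by simp, fun r => ?_⟩
    cases r <;> simp [ht]
  · rw [List.length_reverse]; omega

/-- Fill `big` with a word that is longer than everything on the simulated tapes. -/
def fillBig (W : ℕ) : Prog m k :=
  block [dup .tr .big .t1, dup .tr .big .t1, dup .clk .big .t1, dup .clk .big .t1,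
    block (List.replicate (W + 3) (push .big true))]

theorem Run.fillBig {W T : ℕ} {w : List Bool} {s : Store m k} (htr : s.reg .tr = w)
    (hclk : s.reg .clk = List.replicate (T + 1) true) (ht : s.reg .t1 = [])
    (hbig : s.reg .big = []) :
    ∃ v : List Bool, v.length = 2 * (w.length + T + 2) + W + 1 ∧
      Run (fillBig W) s (s.set .big v) (20 * (2 * (w.length + T + 2) + W + 1)) := by
  have h : ∀ (a : Reg) (u v : List Bool), a ≠ .big → a ≠ .t1 → s.reg a = u →
      Run (UniversalLearner.dup a .big .t1) (s.set .big v) (s.set .big (u ++ v))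
        (14 * u.length + 2) := fun a u v h1 h2 h3 =>
    (Run.dup (s := s.set .big v) (a := a) (b := .big) (t := .t1) (u := u) (w := v) h2.symm
      (by simp) h1 (by simp [ht]) (by simp [h1, h3]) (by simp)).conv (by simp) le_rfl
  have h1 := h .tr w [] (by simp) (by simp) htr
  rw [Store.set_self hbig] at h1
  refine ⟨_, ?_, (Run.cons h1 (.cons (h .tr w _ (by simp) (by simp) htr)
    (.cons (h .clk _ _ (by simp) (by simp) hclk) (.cons (h .clk _ _ (by simp) (by simp) hclk)
    (.cons ((Run.pushReplicate _ _ _).conv (by rw [Store.set_set]) le_rfl) .nil))))).conv rfl ?_⟩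
  · simp
    omega
  · simp only [List.length_replicate]
    omega

/-- Put as many `1`s on `kk` as the binary logarithm of the number `n` of samples tells. The loop runs
on `u = n - 1`, so that `u` is empty once the number under consideration, which is halved in each
round, is `1`. -/
def countMachines : Prog m k :=
  block [dup .nn .u .t1, pop .u, whileR .u Option.isSome (block [push .kk true, pop .u,
    whileR .u Option.isSome (block [pop .u, ifR .u Option.isSome (block [pop .u, push .ck true])
      (block [])]), move .ck .u])]

theorem Run.halve {n c : ℕ} {s : Store m k} (hu : s.reg .u = List.replicate n true)
    (hck : s.reg .ck = List.replicate c true) :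
    Run (whileR .u Option.isSome (block [UniversalLearner.pop .u,
      ifR .u Option.isSome (block [UniversalLearner.pop .u, UniversalLearner.push .ck true])
      (block [])])) s
      ((s.set .u []).set .ck (List.replicate (c + n / 2) true)) (6 * n + 1) := by
  induction n using Nat.strong_induction_on generalizing c s with
  | _ n ih =>
    rcases n with _ | _ | n
    · refine (Run.whileR_false (by simp [hu])).conv ?_ (by simp)
      exact Store.ext' ⟨by simp, by simp, fun r => by cases r <;> simp [hu, hck]⟩
    · refine (Run.whileR_true (by simp [hu]) (.cons (.pop _ _) (.cons (.ifR_false (by simp [hu])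
        .nil) .nil)) (.whileR_false (by simp [hu]))).conv ?_ (by omega)
      exact Store.ext' ⟨by simp, by simp, fun r => by cases r <;> simp [hu, hck]⟩
    · refine (Run.whileR_true (by simp [hu]) (.cons (.pop _ _) (.cons (.ifR_true (by simp [hu])
        (.cons (.pop _ _) (.cons (.push _ _ _) .nil))) .nil)) (ih n (by omega) (c := c + 1)
        (by simp [hu]) (by simp [hck, List.replicate_succ]))).conv ?_ (by omega)
      refine Store.ext' ⟨by simp, by simp, fun r => ?_⟩
      cases r <;> simp [show c + 1 + n / 2 = c + (n + 1 + 1) / 2 by omega]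

theorem Run.countMachines {n : ℕ} {s : Store m k} (hnn : s.reg .nn = List.replicate n true)
    (hu : s.reg .u = []) (hck : s.reg .ck = []) (ht : s.reg .t1 = []) (hkk : s.reg .kk = []) :
    Run countMachines s (s.set .kk (List.replicate (Nat.log 2 n) true)) (100 * n + 10) := by
  have key : ∀ (n c : ℕ) (s : Store m k), s.reg .u = List.replicate n true → s.reg .ck = [] →
      s.reg .kk = List.replicate c true →
      Run (whileR .u Option.isSome (block [UniversalLearner.push .kk true,
        UniversalLearner.pop .u, whileR .u Option.isSome (block [UniversalLearner.pop .u,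
          ifR .u Option.isSome (block [UniversalLearner.pop .u, UniversalLearner.push .ck true])
          (block [])]), UniversalLearner.move .ck .u])) s
        ((s.set .u []).set .kk (List.replicate (c + Nat.log 2 (n + 1)) true)) (40 * n + 1) := by
    intro n
    induction n using Nat.strong_induction_on with
    | _ n ih =>
      intro c s h1 h2 h3
      rcases n with _ | n
      · refine (Run.whileR_false (by simp [h1])).conv ?_ (by simp)
        exact Store.ext' ⟨by simp, by simp, fun r => by cases r <;> simp [h1, h3]⟩
      · have hlog : Nat.log 2 (n + 1 + 1) = Nat.log 2 (n / 2 + 1) + 1 := by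
          rw [Nat.log_of_one_lt_of_le (by norm_num) (by omega)]
          congr 2; omega
        refine (Run.whileR_true (by simp [h1]) (.cons (.push _ _ _) (.cons (.pop _ _) (.cons
          (.halve (n := n) (c := 0) (by simp [h1]) (by simp [h2])) (.cons (.move (by simp)
          (u := List.replicate (n / 2) true) (w := []) (by simp) (by simp)) .nil))))
          (ih (n / 2) (by omega) (c + 1) _ (by simp) (by simp)
          (by simp [h3, List.replicate_succ]))).conv ?_ ?_
        · refine Store.ext' ⟨by simp, by simp, fun r => ?_⟩
          cases r <;> simp [hlog, h2, show c + 1 + Nat.log 2 (n / 2 + 1) =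
            c + (Nat.log 2 (n / 2 + 1) + 1) by omega]
        · rw [List.length_replicate]; omega
  have h0 := Run.dup (a := .nn) (b := .u) (t := .t1) (s := s) (by simp) (by simp) (by simp) ht
    hnn hu
  rw [List.append_nil] at h0
  have hlog : Nat.log 2 n = Nat.log 2 (n - 1 + 1) := by
    rcases n with _ | n <;> simp
  refine (Run.cons h0 (.cons (.pop _ _) (.cons (key (n - 1) 0 _ (by simp) (by simp [hck])
    (by simp [hkk])) .nil))).conv ?_ ?_
  · refine Store.ext' ⟨by simp, by simp, fun r => ?_⟩
    cases r <;> simp [hu, ← hlog]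
  · rw [List.length_replicate]; omega

/-! ### The universal learner -/

/-- The universal learner, for codes of total width `W` and the machine `M` that computes the time
bound. -/
noncomputable def learner (M : Machine m) (W : ℕ) (codes : List (List Bool × List Bool)) :
    Prog m k :=
  block [countSamples (W + 1), computeTime M, countHoldout, dup .mm .best .t1, countTraining,
    splitSamples (W + 1), fillBig W, countMachines, mainLoop codes]

/-- The store at the beginning: the input is in `inp`, and everything else is empty. -/
def initial (w : List Bool) : Store m k where
  aux := (Machine.init m []).tape
  sim := (Machine.init k []).tape
  reg r := if r = .inp then w else []

theorem initial_phys (w : List Bool) : (initial w : Store m k).phys =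
    fun j => if j = .inr (.inr .inp) then stackTape w else stackTape [] := by
  funext j
  rcases j with j | j | j
  · simp [Store.phys, initial, init_tape]
  · simp [Store.phys, initial, init_tape]
  · by_cases hj : j = .inp <;> simp [Store.phys, initial, hj]

/-- A bound on the number of symbols on each tape. -/
def spaceBound (W n T : ℕ) : ℕ := 2 * (n * (W + 1) + T + 2) + W + 1

/-- A bound on the number of steps, where `t` steps suffice to compute the time bound `T`. -/
def stepBound (k W N n T t : ℕ) : ℕ :=
  1000 * (spaceBound W n T + 1) + t + Nat.log 2 n * (2002 * N * ((k + 1) *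
    ((spaceBound W n T + 1) * (Nat.log 2 (spaceBound W n T) + 1) ^ 2)))

theorem length_flatten_of_forall {V : ℕ} {Bs : List (List Bool)} (h : ∀ b ∈ Bs, b.length = V) :
    Bs.flatten.length = Bs.length * V := by
  induction Bs with
  | nil => simp
  | cons b Bs ih =>
    rw [List.flatten_cons, List.length_append, ih fun b hb => h b (by simp [hb]), h b (by simp),
      List.length_cons, Nat.succ_mul, Nat.add_comm]

/-- The list `As` holds the blocks of the training samples, and `Bs` those of the holdout samples. The
least number of errors is initially that of a predictor that always errs. -/
theorem Run.learner {M : Machine m} {W n T t : ℕ} {codes : List (List Bool × List Bool)}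
    (hM : M.output (List.replicate n true) t = some T.bits) (hn : n ≤ T)
    (hc : ∀ c ∈ codes, c.1.length + c.2.length = W) {As Bs : List (List Bool)}
    (hAs : ∀ b ∈ As, b.length = W + 1) (hBs : ∀ b ∈ Bs, b.length = W + 1)
    (hAl : As.length = 99 * n / 100) (hl : As.length + Bs.length = n) :
    ∃ s', Run (learner M W codes) (initial (As.flatten ++ Bs.flatten) : Store m k) s'
      (stepBound k W (codes.length + 1) n T t) ∧
      s'.reg .out = ((List.range' 1 (Nat.log 2 n)).foldl (better k T As.flatten Bs codes)
        (Bs.length, [])).2 := by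
  set s : Store m k := initial (As.flatten ++ Bs.flatten) with hs
  have hs0 : ∀ r, r ≠ .inp → s.reg r = [] := fun r hr => by simp [hs, initial, hr]
  have hsim : s.sim = (Machine.init k []).tape := rfl
  have hsinp : s.reg .inp = As.flatten ++ Bs.flatten := by simp [hs, initial]
  have hBl : Bs.length = n - 99 * n / 100 := by omega
  have hAf := length_flatten_of_forall hAs
  have hBf := length_flatten_of_forall hBs
  have hABf : As.flatten.length + Bs.flatten.length = n * (W + 1) := by
    rw [hAf, hBf, ← Nat.add_mul, hl]
  have hnV : n ≤ n * (W + 1) := Nat.le_mul_of_pos_right _ (by omega)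
  obtain ⟨tp, h2⟩ := Run.computeTime (k := k) (s := s.set .nn (List.replicate n true)) hM hn
    (by simp) (by simp [hs0]) (by simp [hs0]) (by simp [hs0]) (by simp [hs0]) (by simp [hs, initial])
  have h1 := Run.countSamples (m := m) (k := k) (V := W + 1) (Bs := As ++ Bs) (s := s) (by omega)
    (fun b hb => (List.mem_append.1 hb).elim (hAs b) (hBs b)) (by simp [hsinp])
    (by simp [hs0]) (by simp [hs0])
  rw [List.length_append, hl, List.flatten_append, List.length_append] at h1
  set s2 := ((s.set .nn (List.replicate n true)).set .clk (List.replicate (T + 1) true)).setAux tp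
  have e2 : ∀ r, r ≠ .inp → r ≠ .nn → r ≠ .clk → s2.reg r = [] := fun r h1 h2 h3 => by
    simp [s2, hs0, h1, h2, h3]
  have hnn2 : s2.reg .nn = List.replicate n true := by simp [s2]
  have hclk2 : s2.reg .clk = List.replicate (T + 1) true := by simp [s2]
  have hinp2 : s2.reg .inp = As.flatten ++ Bs.flatten := by simp [s2, hsinp]
  have hsim2 : s2.sim = (Machine.init k []).tape := by simp [s2, hsim]
  clear_value s2
  have h3 := Run.countHoldout (s := s2) hnn2 (by simp [e2]) (by simp [e2]) (by simp [e2])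
  rw [← hBl] at h3
  have h4 := Run.dup (a := .mm) (b := .best) (t := .t1)
    (s := s2.set .mm (List.replicate Bs.length true)) (u := List.replicate Bs.length true) (w := [])
    (by simp) (by simp) (by simp) (by simp [e2]) (by simp) (by simp [e2])
  rw [List.append_nil] at h4
  have h5 := Run.countTraining (n := n) (c := Bs.length)
    (s := (s2.set .mm (List.replicate Bs.length true)).set .best (List.replicate Bs.length true))
    (by simp [hnn2]) (by simp) (by omega) (by simp [e2]) (by simp [e2]) (by simp [e2])
  have h6 := Run.splitSamples (As := As) (Bs := Bs)
    (s := ((s2.set .mm (List.replicate Bs.length true)).set .best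
      (List.replicate Bs.length true)).set .n2 (List.replicate (n - Bs.length) true))
    hAs (by simp [hinp2]) (by simp [show n - Bs.length = As.length by omega]) (by simp [e2])
    (by simp [e2])
  set s6 := (((((s2.set .mm (List.replicate Bs.length true)).set .best
      (List.replicate Bs.length true)).set .n2 (List.replicate (n - Bs.length) true)).set
      .n2 []).set .inp Bs.flatten).set .tr As.flatten
  have e6 : ∀ r, r ≠ .inp → r ≠ .nn → r ≠ .clk → r ≠ .mm → r ≠ .best → r ≠ .tr →
      s6.reg r = [] := fun r h1 h2 h3 h4 h5 h6 => by
    by_cases h7 : r = .n2 <;> simp [s6, e2, h1, h2, h3, h4, h5, h6, h7]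
  have hnn6 : s6.reg .nn = List.replicate n true := by simp [s6, hnn2]
  have hmm6 : s6.reg .mm = List.replicate Bs.length true := by simp [s6]
  have hbest6 : s6.reg .best = List.replicate Bs.length true := by simp [s6]
  have hclk6 : s6.reg .clk = List.replicate (T + 1) true := by simp [s6, hclk2]
  have hinp6 : s6.reg .inp = Bs.flatten := by simp [s6]
  have htr6 : s6.reg .tr = As.flatten := by simp [s6]
  have hsim6 : s6.sim = (Machine.init k []).tape := by simp [s6, hsim2]
  clear_value s6
  obtain ⟨v, hv, h7⟩ := Run.fillBig (W := W) htr6 hclk6 (by simp [e6]) (by simp [e6])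
  have h8 := Run.countMachines (n := n) (s := s6.set .big v) (by simp [hnn6]) (by simp [e6])
    (by simp [e6]) (by simp [e6]) (by simp [e6])
  set B := spaceBound W n T with hB
  have hB' : B = 2 * (n * (W + 1) + T + 2) + W + 1 := rfl
  have hR : Ready ((s6.set .big v).set .kk (List.replicate (Nat.log 2 n) true)) T W B
      As.flatten Bs := by
    constructor <;> first
      | (simp only [Store.set_reg, Store.set_sim, reduceCtorEq, if_false]; apply e6 <;> simp)
      | simp only [Store.set_reg, Store.set_sim, reduceCtorEq, if_false, if_true]
      | skip
    all_goals first | assumption | omega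
  have hlog : Nat.log 2 n ≤ n := Nat.log_le_self 2 n
  obtain ⟨s', h9, h10⟩ := Run.mainLoop (codes := codes) (i := 1) (K := Nat.log 2 n)
    (b := Bs.length) (o := []) hR le_rfl (by omega) (by simp) (by simp [e6, nthWord_one])
    (by simp [e6]) (by simp [e6]) (by simp [e6]) (by simp [hmm6]) (by simp [hbest6])
    (by simp [e6]) (by omega) ((show Bs.length ≤ B by omega).trans
      (Nat.le_mul_of_pos_left _ (by omega))) (by simp) hc hBs
  refine ⟨s', (Run.cons h1 (.cons h2 (.cons h3 (.cons h4 (.cons h5 (.cons h6 (.cons h7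
    (.cons h8 (.cons h9 .nil))))))))).mono ?_, h10⟩
  rw [stepBound, ← hB]
  simp only [List.length_replicate]
  omega

/-- There is a machine that, on the blocks of the samples, outputs the best predictor. -/
theorem exists_learner {M : Machine m} {T : ℕ → ℕ} {C : ℕ}
    (hM : ∀ n, M.output (List.replicate n true) (C * T n + C) = some (T n).bits)
    (hT : ∀ n, n ≤ T n) (k W : ℕ) (codes : List (List Bool × List Bool))
    (hc : ∀ c ∈ codes, c.1.length + c.2.length = W) :
    ∃ (l : ℕ) (A : Machine l), ∀ (n : ℕ) (As Bs : List (List Bool)),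
      (∀ b ∈ As, b.length = W + 1) → (∀ b ∈ Bs, b.length = W + 1) → As.length = 99 * n / 100 →
      As.length + Bs.length = n →
      A.output (As.flatten ++ Bs.flatten)
        (stepBound k W (codes.length + 1) n (T n) (C * T n + C)) =
      some ((List.range' 1 (Nat.log 2 n)).foldl (better k (T n) As.flatten Bs codes)
        (Bs.length, [])).2 := by
  obtain ⟨l, A, hA⟩ := Frag.exists_machine (learner M W codes : Prog m k)
    (i := .inr (.inr .inp)) (o := .inr (.inr .out)) (by simp)
  refine ⟨l, A, fun n As Bs hAs hBs hAl hl => ?_⟩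
  obtain ⟨s', h1, h2⟩ := Run.learner (k := k) (hM n) (hT n) hc hAs hBs hAl hl
  unfold Run at h1
  rw [initial_phys] at h1
  rw [hA _ _ _ h1, ← h2]
  simp [Store.phys, readWord_stackTape]

/-! ### The selected predictor -/

/-- Among several machines with the fewest errors, the last one is selected. -/
theorem foldl_better {T b : ℕ} {w : List Bool} {Bs : List (List Bool)}
    {codes : List (List Bool × List Bool)}
    (hb : ∀ i, errors k T Bs codes ((nthMachine k i).output w T) ≤ b) {K : ℕ} (hK : 1 ≤ K) :
    ∃ j, 1 ≤ j ∧ j ≤ K ∧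
      (∀ i, 1 ≤ i → i ≤ K → errors k T Bs codes ((nthMachine k j).output w T) ≤
        errors k T Bs codes ((nthMachine k i).output w T)) ∧
      (List.range' 1 K).foldl (better k T w Bs codes) (b, []) =
        (errors k T Bs codes ((nthMachine k j).output w T),
          ((nthMachine k j).output w T).getD []) := by
  induction K, hK using Nat.le_induction with
  | base =>
    refine ⟨1, le_rfl, le_rfl, fun i h1 h2 => by rw [le_antisymm h2 h1], ?_⟩
    simp [better, hb]
  | succ K hK ih =>
    obtain ⟨j, h1, h2, h3, h4⟩ := ih
    rw [List.range'_concat, List.foldl_concat, h4, mul_comm, mul_one, Nat.add_comm 1 K]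
    by_cases h : errors k T Bs codes ((nthMachine k (K + 1)).output w T) ≤
        errors k T Bs codes ((nthMachine k j).output w T)
    · refine ⟨K + 1, by omega, le_rfl, fun i hi1 hi2 => ?_, by rw [better, if_pos h]⟩
      rcases hi2.eq_or_lt with rfl | hi
      · exact le_rfl
      · exact h.trans (h3 i hi1 (by omega))
    · refine ⟨j, h1, by omega, fun i hi1 hi2 => ?_, by rw [better, if_neg h]⟩
      rcases hi2.eq_or_lt with rfl | hi
      · exact (not_le.1 h).le
      · exact h3 i hi1 (by omega)

section Domain

variable {X Y : Type*} [MeasurableSpace X] [MeasurableSpace Y] (dom : ClassificationDomain X Y)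

/-- The codes of the points and labels, as functions. -/
abbrev Code (dom : ClassificationDomain X Y) : Type :=
  (Fin dom.pointWidth → Bool) × (Fin dom.labelWidth → Bool)

/-- The code of a sample. -/
def code (z : X × Y) : Code dom := (dom.point z.1, dom.label z.2)

variable {dom} in
/-- The block of bits that stands for a sample with a given code. -/
def blockOf (q : Code dom) : List Bool := true :: (List.ofFn q.1 ++ List.ofFn q.2)

variable {dom} in
theorem length_blockOf (q : Code dom) :
    (blockOf q).length = dom.pointWidth + dom.labelWidth + 1 := by
  simp [blockOf]

variable {dom} in
theorem blockOf_injective : Function.Injective (blockOf (dom := dom)) := by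
  rintro ⟨a, b⟩ ⟨c, d⟩ h
  simp only [blockOf, List.cons.injEq, true_and] at h
  obtain ⟨h1, h2⟩ := List.append_inj h (by simp)
  rw [List.ofFn_injective h1, List.ofFn_injective h2]

/-- The words of all codes. -/
noncomputable def allCodes : List (List Bool × List Bool) :=
  (Finset.univ : Finset (Code dom)).toList.map fun q => (List.ofFn q.1, List.ofFn q.2)

theorem encodeSamples_eq (S : List (X × Y)) :
    dom.encodeSamples S = (S.map fun z => blockOf (code dom z)).flatten := rfl

open Classical in
/-- Whether an encoded predictor errs on a sample depends only on the code of the sample. -/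
theorem errors_eq_countP (T : ℕ) (S : List (X × Y)) (f : Option (List Bool)) :
    errors k T (S.map fun z => blockOf (code dom z)) (allCodes dom) f =
      S.countP fun z => decide (dom.Errs k f T z) := by
  rcases f with _ | p
  · rw [errors, List.length_map]
    symm
    rw [List.countP_eq_length]
    intro z _
    simp [ClassificationDomain.Errs]
  · have hE : ∀ z, dom.Errs k (some p) T z ↔
        predict k p (List.ofFn (code dom z).1) T ≠ some (List.ofFn (code dom z).2) := by
      simp [ClassificationDomain.Errs, code]
    have h1 : ∀ Bs, errors k T Bs (allCodes dom) (some p) = ∑ q : Code dom,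
        if predict k p (List.ofFn q.1) T = some (List.ofFn q.2) then 0 else
          Bs.count (blockOf q) := by
      intro Bs
      rw [errors, allCodes, List.map_map, ← Finset.sum_map_toList]
      rfl
    rw [h1]
    induction S with
    | nil => simp
    | cons z S ih =>
      rw [List.countP_cons, ← ih, List.map_cons]
      have h2 : ∀ q : Code dom, (if predict k p (List.ofFn q.1) T = some (List.ofFn q.2) then 0 else
          (blockOf (code dom z) :: S.map fun z => blockOf (code dom z)).count (blockOf q)) =
          (if predict k p (List.ofFn q.1) T = some (List.ofFn q.2) then 0 else
            (S.map fun z => blockOf (code dom z)).count (blockOf q)) +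
          if code dom z = q then
            (if predict k p (List.ofFn q.1) T = some (List.ofFn q.2) then 0 else 1) else 0 := by
        intro q
        rw [List.count_cons]
        by_cases hq : code dom z = q
        · subst hq; split_ifs <;> simp_all
        · have : blockOf (code dom z) ≠ blockOf q := fun h => hq (blockOf_injective h)
          simp [hq, this]
      simp_rw [h2]
      rw [Finset.sum_add_distrib, Finset.sum_ite_eq]
      simp [hE]

/-- A machine that outputs the predictor with the fewest errors on the holdout samples. -/
theorem exists_machine_selecting {T : ℕ → ℕ} (hT : TimeConstructible T) (k : ℕ) :
    ∃ (C N l : ℕ) (A : Machine l), ∀ (n : ℕ) (S : List (X × Y)), S.length = n →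
      ∃ p, A.output (dom.encodeSamples S)
          (stepBound k (dom.pointWidth + dom.labelWidth) N n (T n) (C * T n + C)) = some p ∧
        (2 ≤ n → ∃ j, 1 ≤ j ∧ j ≤ Nat.log 2 n ∧
          (∀ i, 1 ≤ i → i ≤ Nat.log 2 n →
            dom.holdoutLoss k j S (T n) ≤ dom.holdoutLoss k i S (T n)) ∧
          p = (dom.trained k j S (T n)).getD []) := by
  obtain ⟨hn, m, M, C, hM⟩ := hT
  obtain ⟨l, A, hA⟩ := exists_learner hM hn k (dom.pointWidth + dom.labelWidth) (allCodes dom) (by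
    intro c hc
    obtain ⟨q, -, rfl⟩ := List.mem_map.1 hc
    simp)
  refine ⟨C, (allCodes dom).length + 1, l, A, fun n S hS => ?_⟩
  set As := (S.take (99 * n / 100)).map fun z => blockOf (code dom z) with hAs
  set Bs := (S.drop (99 * n / 100)).map fun z => blockOf (code dom z) with hBs
  have hblk : ∀ (S : List (X × Y)), ∀ b ∈ S.map fun z => blockOf (code dom z),
      b.length = dom.pointWidth + dom.labelWidth + 1 := by
    intro S b hb
    obtain ⟨z, -, rfl⟩ := List.mem_map.1 hb
    exact length_blockOf _
  have hinp : dom.encodeSamples S = As.flatten ++ Bs.flatten := by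
    rw [encodeSamples_eq, hAs, hBs, ← List.flatten_append, ← List.map_append,
      List.take_append_drop]
  have h1 := hA n As Bs (hblk _) (hblk _) (by simp [hAs, hS]; omega) (by simp [hAs, hBs, hS]; omega)
  rw [← hinp] at h1
  refine ⟨_, h1, fun hn2 => ?_⟩
  have hb : ∀ f, errors k (T n) Bs (allCodes dom) f ≤ Bs.length := fun f => by
    rw [hBs, errors_eq_countP, List.length_map]
    exact List.countP_le_length
  obtain ⟨j, hj1, hj2, hj3, hj4⟩ := foldl_better (w := As.flatten) (fun i => hb _)
    (Nat.log_pos (b := 2) (by norm_num) hn2)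
  have htr : ∀ i, dom.trained k i S (T n) = (nthMachine k i).output As.flatten (T n) := fun i => by
    rw [ClassificationDomain.trained, encodeSamples_eq, hS]
  have hho : ∀ i, dom.holdoutLoss k i S (T n) = (errors k (T n) Bs (allCodes dom)
      ((nthMachine k i).output As.flatten (T n)) : ℝ) / Bs.length := fun i => by
    rw [ClassificationDomain.holdoutLoss, ClassificationDomain.empiricalLoss, htr, hBs,
      errors_eq_countP, List.length_map, hS]
  refine ⟨j, hj1, hj2, fun i hi1 hi2 => ?_, by rw [hj4, htr]⟩
  rw [hho, hho]
  exact div_le_div_of_nonneg_right (by exact_mod_cast hj3 i hi1 hi2) (by positivity)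

end Domain

/-! ### The running time -/

theorem natLog_le_two_mul_log (n : ℕ) : (Nat.log 2 n : ℝ) ≤ 2 * Real.log n := by
  rcases Nat.eq_zero_or_pos n with rfl | hn
  · simp
  · have h1 : (Nat.log 2 n : ℝ) ≤ Real.logb 2 n := by exact_mod_cast Real.natLog_le_logb n 2
    refine h1.trans ?_
    have h2 := Real.log_two_gt_d9
    have h3 : 0 ≤ Real.log n := Real.log_natCast_nonneg n
    rw [Real.logb, div_le_iff₀ (by linarith)]
    nlinarith

/-- With `t = T n`, the space bound is at most `K t ≤ t²`, so its logarithm is at most a multiple of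
that of `t`; the three factors `log t` come from the number of machines and from the square of the
length of a description. -/
theorem isBigO_stepBound {T : ℕ → ℕ} (hT : ∀ n, n ≤ T n) (k W N C : ℕ) :
    (fun n => (stepBound k W N n (T n) (C * T n + C) : ℝ)) =O[atTop]
      fun n => (T n : ℝ) * Real.log (T n) ^ 3 := by
  set K := 2 * (W + 1) + 2 + (W + 6) with hK
  refine IsBigO.of_bound ((1000 * K + 2 * C + 100 * 2002 * N * (k + 1) * K : ℕ) : ℝ) ?_
  filter_upwards [eventually_ge_atTop (K + 3)] with n hn
  have hnT := hT n
  generalize T n = t at hnT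
  have ht : K + 3 ≤ t := hn.trans hnT
  have hB : spaceBound W n t + 1 ≤ K * t := by
    have h1 : n * (W + 1) ≤ t * (W + 1) := Nat.mul_le_mul_right _ hnT
    have h2 : W + 6 ≤ (W + 6) * t := Nat.le_mul_of_pos_right _ (by omega)
    have h3 : K * t = 2 * (t * (W + 1)) + 2 * t + (W + 6) * t := by rw [hK]; ring
    rw [spaceBound]
    omega
  have hB2 : spaceBound W n t ≤ t ^ 2 := by
    rw [sq]
    have : K * t ≤ t * t := Nat.mul_le_mul_right _ (by omega)
    omega
  have ht0 : (0 : ℝ) < t := by exact_mod_cast (by omega : 0 < t)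
  set L := Real.log t with hL
  have hL1 : 1 ≤ L := by
    rw [hL, Real.le_log_iff_exp_le ht0]
    have : (3 : ℝ) ≤ t := by exact_mod_cast (by omega : 3 ≤ t)
    exact Real.exp_one_lt_d9.le.trans (by linarith)
  have hl1 : (Nat.log 2 n : ℝ) ≤ 2 * L := by
    refine le_trans ?_ (natLog_le_two_mul_log t)
    exact_mod_cast Nat.log_mono_right hnT
  have hl2 : (Nat.log 2 (spaceBound W n t) : ℝ) + 1 ≤ 5 * L := by
    have h1 : (Nat.log 2 (spaceBound W n t) : ℝ) ≤ Nat.log 2 (t ^ 2) := by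
      exact_mod_cast Nat.log_mono_right hB2
    have h2 := natLog_le_two_mul_log (t ^ 2)
    rw [Nat.cast_pow, Real.log_pow] at h2
    push_cast at h2
    linarith
  have hBr : (spaceBound W n t : ℝ) + 1 ≤ K * t := by exact_mod_cast hB
  rw [Real.norm_of_nonneg (by positivity), Real.norm_of_nonneg (by positivity), stepBound]
  push_cast
  have hL3 : 1 ≤ L ^ 3 := one_le_pow₀ hL1
  have ht1 : (1 : ℝ) ≤ t := by exact_mod_cast (by omega : 1 ≤ t)
  have e1 : 1000 * ((spaceBound W n t : ℝ) + 1) ≤ 1000 * K * (t * L ^ 3) := by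
    calc _ ≤ 1000 * (K * t : ℝ) := by gcongr
      _ = 1000 * K * (t * 1) := by ring
      _ ≤ _ := by gcongr
  have e2 : (C : ℝ) * t + C ≤ 2 * C * (t * L ^ 3) := by
    calc (C : ℝ) * t + C = C * t + C * 1 := by ring
      _ ≤ C * t + C * t := by gcongr
      _ = 2 * C * (t * 1) := by ring
      _ ≤ _ := by gcongr
  have e3 : (Nat.log 2 n : ℝ) * (2002 * N * ((k + 1) * (((spaceBound W n t : ℝ) + 1) *
      ((Nat.log 2 (spaceBound W n t) : ℝ) + 1) ^ 2))) ≤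
      100 * 2002 * N * (k + 1) * K * (t * L ^ 3) := by
    calc _ ≤ (2 * L) * (2002 * N * ((k + 1) * ((K * t) * (5 * L) ^ 2))) := by gcongr
      _ = 50 * 2002 * N * (k + 1) * K * (t * L ^ 3) := by ring
      _ ≤ _ := by gcongr; norm_num
  linarith

/-! ### Choosing on a holdout set -/

section Holdout

variable {Ω : Type*} [MeasurableSpace Ω] (D : Measure Ω) [IsProbabilityMeasure D]

/-- The fraction of a sequence of points that lie in a set. -/
noncomputable def frequency (E : Set Ω) {m : ℕ} (V : Fin m → Ω) : ℝ :=
  (∑ t, E.indicator (fun _ => (1 : ℝ)) (V t)) / m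

theorem integrable_indicator_eval {E : Set Ω} (hE : MeasurableSet E) {m : ℕ} (t : Fin m) :
    Integrable (fun V : Fin m → Ω => E.indicator (fun _ => (1 : ℝ)) (V t))
      (Measure.pi fun _ => D) :=
  ((measurePreserving_eval (fun _ : Fin m => D) t).integrable_comp
    ((integrable_const (1 : ℝ)).indicator hE).aestronglyMeasurable).2
    ((integrable_const (1 : ℝ)).indicator hE)

theorem integrable_frequency {E : Set Ω} (hE : MeasurableSet E) (m : ℕ) :
    Integrable (fun V : Fin m → Ω => frequency E V) (Measure.pi fun _ => D) :=
  (integrable_finsetSum _ fun t _ => integrable_indicator_eval D hE t).div_const _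

theorem integral_frequency {E : Set Ω} (hE : MeasurableSet E) {m : ℕ} (hm : 0 < m) :
    ∫ V : Fin m → Ω, frequency E V ∂(Measure.pi fun _ => D) = D.real E := by
  have hm' : (m : ℝ) ≠ 0 := by positivity
  simp only [frequency]
  rw [integral_div, integral_finsetSum _ fun t _ => integrable_indicator_eval D hE t]
  have h : ∀ t : Fin m, ∫ V : Fin m → Ω, E.indicator (fun _ => (1 : ℝ)) (V t)
      ∂(Measure.pi fun _ => D) = D.real E := fun t => by
    have he := measurePreserving_eval (fun _ : Fin m => D) t
    have h1 : ∫ z, E.indicator (fun _ => (1 : ℝ)) z ∂D = D.real E := integral_indicator_one hE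
    rw [← h1]
    conv_rhs => rw [← he.map_eq]
    exact (integral_map he.aemeasurable (measurable_const.indicator hE).aestronglyMeasurable).symm
  simp only [h, Finset.sum_const, Finset.card_univ, Fintype.card_fin, nsmul_eq_mul]
  field_simp

/-- Hoeffding's lemma for the deviation of the frequency of an event from its probability. -/
theorem integral_exp_deviation_le {E : Set Ω} (hE : MeasurableSet E) {m : ℕ} (hm : 0 < m) (c : ℝ) :
    Integrable (fun V : Fin m → Ω => Real.exp (c * (D.real E - frequency E V)))
      (Measure.pi fun _ => D) ∧
    ∫ V : Fin m → Ω, Real.exp (c * (D.real E - frequency E V)) ∂(Measure.pi fun _ => D) ≤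
      Real.exp (c ^ 2 / (8 * m)) := by
  have hm' : (m : ℝ) ≠ 0 := by positivity
  set g : Ω → ℝ := fun z => Real.exp (-(c / m) * (E.indicator (fun _ => (1 : ℝ)) z - D.real E))
    with hg
  have hfac : ∀ V : Fin m → Ω, Real.exp (c * (D.real E - frequency E V)) = ∏ t, g (V t) := by
    intro V
    rw [hg, ← Real.exp_sum, ← Finset.mul_sum, Finset.sum_sub_distrib]
    congr 1
    simp only [frequency, Finset.sum_const, Finset.card_univ, Fintype.card_fin, nsmul_eq_mul]
    field_simp
    ring
  have hsub := ProbabilityTheory.hasSubgaussianMGF_of_mem_Icc (μ := D) (a := 0) (b := 1)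
    (X := E.indicator fun _ => (1 : ℝ)) (measurable_const.indicator hE).aemeasurable
    (ae_of_all _ fun z => by by_cases hz : z ∈ E <;> simp [hz])
  have h1 : ∫ z, E.indicator (fun _ => (1 : ℝ)) z ∂D = D.real E := integral_indicator_one hE
  rw [h1] at hsub
  have hint := hsub.integrable_exp_mul (-(c / m))
  have hle := hsub.mgf_le (-(c / m))
  simp_rw [hfac]
  refine ⟨Integrable.fintype_prod fun _ => hint, ?_⟩
  rw [integral_fintype_prod_eq_pow, Fintype.card_fin]
  refine (pow_le_pow_left₀ (integral_nonneg fun z => (Real.exp_pos _).le) hle m).trans ?_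
  rw [← Real.exp_nat_mul]
  refine le_of_eq (congrArg _ ?_)
  simp only [sub_zero, nnnorm_one, NNReal.coe_pow, NNReal.coe_div, NNReal.coe_one, NNReal.coe_ofNat]
  field_simp
  norm_num
  ring

/-- Choosing the event with the least frequency among `m` holdout points costs at most
`√(log |s| / (2 m))` compared with any fixed one of the events. -/
theorem integral_le_of_selection {m : ℕ} (hm : 0 < m) {s : Finset ℕ} {E : ℕ → Set Ω}
    (hE : ∀ i, MeasurableSet (E i)) {G : (Fin m → Ω) → ℝ}
    (hG : Integrable G (Measure.pi fun _ => D))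
    (hsel : ∀ V, ∃ j ∈ s, (∀ i ∈ s, frequency (E j) V ≤ frequency (E i) V) ∧ G V ≤ D.real (E j))
    {L : ℝ} (hL : 0 < L) (hs : Real.log s.card ≤ L) {i : ℕ} (hi : i ∈ s) :
    ∫ V, G V ∂(Measure.pi fun _ => D) ≤ D.real (E i) + √(L / (2 * m)) := by
  have hm' : (0 : ℝ) < m := by exact_mod_cast hm
  have hs0 : (0 : ℝ) < s.card := by exact_mod_cast Finset.card_pos.2 ⟨i, hi⟩
  set c := √(8 * m * L) with hc
  have hc0 : 0 < c := Real.sqrt_pos.2 (by positivity)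
  have hc2 : c ^ 2 = 8 * m * L := Real.sq_sqrt (by positivity)
  set a := s.card * Real.exp (c ^ 2 / (8 * m)) with ha
  have ha0 : 0 < a := by positivity
  have hla : Real.log a ≤ 2 * L := by
    rw [ha, Real.log_mul hs0.ne' (Real.exp_ne_zero _), Real.log_exp, hc2]
    have : 8 * m * L / (8 * m) = L := by field_simp
    linarith
  -- `log x ≤ x / a - 1 + log a` bounds the largest deviation by a sum of exponentials
  have hpt : ∀ V, G V ≤ frequency (E i) V + ((∑ j ∈ s, Real.exp (c * (D.real (E j) -
      frequency (E j) V))) / a - 1 + Real.log a) / c := by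
    intro V
    obtain ⟨j, hj, hmin, hGV⟩ := hsel V
    set x := Real.exp (c * (D.real (E j) - frequency (E j) V)) with hx
    have hx0 : 0 < x := Real.exp_pos _
    have h1 : x ≤ ∑ j ∈ s, Real.exp (c * (D.real (E j) - frequency (E j) V)) :=
      Finset.single_le_sum (f := fun j => Real.exp (c * (D.real (E j) - frequency (E j) V)))
        (fun _ _ => (Real.exp_pos _).le) hj
    have h2 : c * (D.real (E j) - frequency (E j) V) ≤ x / a - 1 + Real.log a := by
      have h3 := Real.log_le_sub_one_of_pos (div_pos hx0 ha0)
      rw [Real.log_div hx0.ne' ha0.ne', hx, Real.log_exp] at h3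
      linarith
    have h4 : x / a ≤ (∑ j ∈ s, Real.exp (c * (D.real (E j) - frequency (E j) V))) / a :=
      div_le_div_of_nonneg_right h1 ha0.le
    have h5 : D.real (E j) - frequency (E j) V ≤ ((∑ j ∈ s, Real.exp (c * (D.real (E j) -
        frequency (E j) V))) / a - 1 + Real.log a) / c := by
      rw [le_div_iff₀ hc0]
      linarith
    linarith [hmin i hi]
  have hint : ∀ j, Integrable (fun V : Fin m → Ω => Real.exp (c * (D.real (E j) -
      frequency (E j) V))) (Measure.pi fun _ => D) := fun j =>
    (integral_exp_deviation_le D (hE j) hm c).1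
  have hS : Integrable (fun V : Fin m → Ω => ∑ j ∈ s, Real.exp (c * (D.real (E j) -
      frequency (E j) V))) (Measure.pi fun _ => D) := integrable_finsetSum _ fun j _ => hint j
  have hS' : Integrable (fun V : Fin m → Ω => (∑ j ∈ s, Real.exp (c * (D.real (E j) -
      frequency (E j) V))) / a - 1) (Measure.pi fun _ => D) :=
    (hS.div_const _).sub (integrable_const _)
  have hR : Integrable (fun V : Fin m → Ω => ((∑ j ∈ s, Real.exp (c * (D.real (E j) -
      frequency (E j) V))) / a - 1 + Real.log a) / c) (Measure.pi fun _ => D) :=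
    (hS'.add (integrable_const _)).div_const _
  refine (integral_mono hG ((integrable_frequency D (hE i) m).add hR) hpt).trans ?_
  rw [integral_add' (integrable_frequency D (hE i) m) hR, integral_frequency D (hE i) hm,
    integral_div, integral_add hS' (integrable_const _),
    integral_sub (hS.div_const _) (integrable_const _), integral_div,
    integral_finsetSum _ fun j _ => hint j]
  simp only [integral_const, probReal_univ, smul_eq_mul, one_mul]
  have h1 : (∑ j ∈ s, ∫ V : Fin m → Ω, Real.exp (c * (D.real (E j) - frequency (E j) V))
      ∂(Measure.pi fun _ => D)) / a ≤ 1 := by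
    rw [div_le_one ha0, ha, ← nsmul_eq_mul]
    exact Finset.sum_le_card_nsmul _ _ _ fun j _ => (integral_exp_deviation_le D (hE j) hm c).2
  have h2 : 2 * L / c = √(L / (2 * m)) := by
    symm
    rw [Real.sqrt_eq_iff_mul_self_eq (by positivity) (by positivity), ← sq, div_pow, hc2]
    field_simp
    ring
  rw [← h2]
  gcongr
  linarith

/-- Independent samples split into independent parts. -/
theorem integral_pi_append {N m : ℕ} {F : (Fin (N + m) → Ω) → ℝ}
    (hF : Integrable F (Measure.pi fun _ => D)) :
    Integrable (fun U : Fin N → Ω => ∫ V : Fin m → Ω, F (Fin.append U V) ∂(Measure.pi fun _ => D))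
      (Measure.pi fun _ => D) ∧
    ∫ Z, F Z ∂(Measure.pi fun _ => D) = ∫ U : Fin N → Ω, ∫ V : Fin m → Ω, F (Fin.append U V)
      ∂(Measure.pi fun _ => D) ∂(Measure.pi fun _ => D) := by
  let e : ((Fin N → Ω) × (Fin m → Ω)) ≃ᵐ (Fin (N + m) → Ω) :=
    (MeasurableEquiv.sumPiEquivProdPi (fun _ : Fin N ⊕ Fin m => Ω)).symm.trans
      (MeasurableEquiv.piCongrLeft (fun _ => Ω) finSumFinEquiv)
  have he : MeasurePreserving e ((Measure.pi fun _ => D).prod (Measure.pi fun _ => D))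
      (Measure.pi fun _ => D) :=
    (measurePreserving_sumPiEquivProdPi_symm (fun _ : Fin N ⊕ Fin m => D)).trans
      (measurePreserving_piCongrLeft (fun _ => D) finSumFinEquiv)
  have hea : ∀ p, e p = Fin.append p.1 p.2 := by
    rintro ⟨U, V⟩
    funext t
    obtain ⟨t, rfl⟩ := finSumFinEquiv.surjective t
    have h1 : e (U, V) (finSumFinEquiv t) = Sum.elim U V t :=
      (Equiv.piCongrLeft_apply_apply (fun _ => Ω) finSumFinEquiv _ t).trans
        (by rcases t with t | t <;> rfl)
    rw [h1]
    rcases t with t | t <;> simp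
  have hF' : Integrable (fun p : (Fin N → Ω) × (Fin m → Ω) => F (Fin.append p.1 p.2))
      ((Measure.pi fun _ => D).prod (Measure.pi fun _ => D)) := by
    have := he.integrable_comp_of_integrable hF
    simpa only [Function.comp_def, hea] using this
  refine ⟨hF'.integral_prod_left, ?_⟩
  rw [← integral_prod _ hF', ← he.integral_comp' F]
  simp only [hea]

end Holdout

/-! ### The expected test error -/

section Guarantee

variable {X Y : Type*} [MeasurableSpace X] [MeasurableSpace Y]
  (dom : ClassificationDomain X Y)

theorem measurable_code : Measurable (code dom) :=
  (dom.measurable_point.comp measurable_fst).prodMk (dom.measurable_label.comp measurable_snd)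

theorem measurableSet_errs (f : Option (List Bool)) (t : ℕ) :
    MeasurableSet {z | dom.Errs k f t z} := by
  have h : MeasurableSet {q : Code dom | ∀ p, f = some p →
      predict k p (List.ofFn q.1) t ≠ some (List.ofFn q.2)} := Set.Finite.measurableSet
        (Set.toFinite _)
  exact measurable_code dom h

theorem encodeSamples_ofFn {n : ℕ} (S : Fin n → X × Y) : dom.encodeSamples (List.ofFn S) =
    ((List.ofFn fun i => code dom (S i)).map blockOf).flatten := by
  rw [encodeSamples_eq, List.map_ofFn, List.map_ofFn]
  rfl

variable (D : Measure (X × Y)) [IsProbabilityMeasure D]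

/-- Every function of the codes of the samples is integrable, as there are finitely many codes. -/
theorem integrable_loss_output {l : ℕ} (M : Machine l) (n s t : ℕ) :
    Integrable (fun S : Fin n → X × Y =>
      dom.loss k D (M.output (dom.encodeSamples (List.ofFn S)) s) t) (Measure.pi fun _ => D) := by
  simp_rw [encodeSamples_ofFn]
  have hφ : Measurable fun (S : Fin n → X × Y) i => code dom (S i) :=
    measurable_pi_lambda _ fun i => (measurable_code dom).comp (measurable_pi_apply i)
  have h : Integrable (fun q : Fin n → Code dom =>
      dom.loss k D (M.output ((List.ofFn q).map blockOf).flatten s) t)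
      ((Measure.pi fun _ => D).map fun (S : Fin n → X × Y) i => code dom (S i)) :=
    haveI := Measure.isProbabilityMeasure_map (μ := Measure.pi fun _ : Fin n => D) hφ.aemeasurable
    Integrable.of_finite
  exact h.comp_measurable hφ

open Classical in
theorem countP_ofFn {Ω : Type*} (E : Set Ω) {m : ℕ} (V : Fin m → Ω) :
    (((List.ofFn V).countP fun z => decide (z ∈ E) : ℕ) : ℝ) =
      ∑ t, E.indicator (fun _ => (1 : ℝ)) (V t) := by
  induction m with
  | zero => simp
  | succ m ih =>
    rw [List.ofFn_succ, List.countP_cons, Fin.sum_univ_succ, ← ih, add_comm]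
    by_cases h : V 0 ∈ E <;> simp [h]

theorem empiricalLoss_ofFn {m : ℕ} (V : Fin m → X × Y) (f : Option (List Bool)) (t : ℕ) :
    dom.empiricalLoss k (List.ofFn V) f t = frequency {z | dom.Errs k f t z} V := by
  rw [ClassificationDomain.empiricalLoss, frequency, List.length_ofFn, ← countP_ofFn]
  rfl

/-- A learner that outputs the predictor with the least holdout loss is not much worse than each of
the machines it chooses from. -/
theorem expectedLoss_le {N m : ℕ} (hm : 0 < m) (hN : 99 * (N + m) / 100 = N) {l : ℕ}
    (A : Machine l) (R t K : ℕ)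
    (hsel : ∀ S : Fin (N + m) → X × Y, ∃ j, 1 ≤ j ∧ j ≤ K ∧
      (∀ i, 1 ≤ i → i ≤ K →
        dom.holdoutLoss k j (List.ofFn S) t ≤ dom.holdoutLoss k i (List.ofFn S) t) ∧
      (∀ p, dom.trained k j (List.ofFn S) t = some p →
        A.output (dom.encodeSamples (List.ofFn S)) R = some p))
    {L : ℝ} (hL : 0 < L) (hK : Real.log K ≤ L) {i : ℕ} (hi1 : 1 ≤ i) (hi2 : i ≤ K) :
    dom.expectedLoss k D A (N + m) R t ≤
      dom.expectedLoss k D (nthMachine k i) N t t + √(L / (2 * m)) := by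
  obtain ⟨hint, heq⟩ := integral_pi_append D (integrable_loss_output (k := k) dom D A (N + m) R t)
  rw [ClassificationDomain.expectedLoss, heq, ClassificationDomain.expectedLoss]
  have hi := integrable_loss_output (k := k) dom D (nthMachine k i) N t t
  have hconst : ∫ _ : Fin N → X × Y, √(L / (2 * m)) ∂(Measure.pi fun _ => D) = √(L / (2 * m)) := by
    simp
  rw [← hconst, ← integral_add hi (integrable_const _)]
  refine integral_mono hint (hi.add (integrable_const _)) fun U => ?_
  set f : ℕ → Option (List Bool) := fun j =>
    (nthMachine k j).output (dom.encodeSamples (List.ofFn U)) t with hf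
  have htr : ∀ (V : Fin m → X × Y) j, dom.trained k j (List.ofFn (Fin.append U V)) t = f j := by
    intro V j
    rw [ClassificationDomain.trained, List.length_ofFn, hN, List.ofFn_fin_append,
      List.take_left' (List.length_ofFn)]
  have hho : ∀ (V : Fin m → X × Y) j, dom.holdoutLoss k j (List.ofFn (Fin.append U V)) t =
      frequency {z | dom.Errs k (f j) t z} V := by
    intro V j
    rw [ClassificationDomain.holdoutLoss, htr, List.length_ofFn, hN, List.ofFn_fin_append,
      List.drop_left' (List.length_ofFn), empiricalLoss_ofFn]
  have hV : Integrable (fun V : Fin m → X × Y => dom.loss k D (A.output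
      (dom.encodeSamples (List.ofFn (Fin.append U V))) R) t) (Measure.pi fun _ => D) := by
    have hφ : Measurable fun (V : Fin m → X × Y) i => code dom (V i) :=
      measurable_pi_lambda _ fun i => (measurable_code dom).comp (measurable_pi_apply i)
    have h : Integrable (fun q : Fin m → Code dom => dom.loss k D (A.output
        (dom.encodeSamples (List.ofFn U) ++ ((List.ofFn q).map blockOf).flatten) R) t)
        ((Measure.pi fun _ => D).map fun (S : Fin m → X × Y) i => code dom (S i)) :=
      haveI := Measure.isProbabilityMeasure_map (μ := Measure.pi fun _ : Fin m => D) hφ.aemeasurable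
      Integrable.of_finite
    refine (h.comp_measurable hφ).congr (ae_of_all _ fun V => ?_)
    simp only [Function.comp_apply]
    rw [← encodeSamples_ofFn, List.ofFn_fin_append]
    simp only [ClassificationDomain.encodeSamples, List.flatMap_append]
  refine integral_le_of_selection D hm (s := Finset.Icc 1 K) (E := fun j => {z | dom.Errs k (f j) t z})
    (fun j => measurableSet_errs dom (f j) t) hV (fun V => ?_) hL (by simpa using hK)
    (Finset.mem_Icc.2 ⟨hi1, hi2⟩)
  obtain ⟨j, hj1, hj2, hj3, hj4⟩ := hsel (Fin.append U V)
  refine ⟨j, Finset.mem_Icc.2 ⟨hj1, hj2⟩, fun i hi => ?_, ?_⟩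
  · rw [← hho V j, ← hho V i]
    exact hj3 i (Finset.mem_Icc.1 hi).1 (Finset.mem_Icc.1 hi).2
  · rw [htr] at hj4
    rcases hfj : f j with _ | p
    · -- without a predictor, the machine has test error `1`
      have h1 : {z | dom.Errs k none t z} = Set.univ :=
        Set.eq_univ_of_forall fun z p hp => by simp at hp
      rw [h1, probReal_univ]
      exact measureReal_le_one
    · rw [hj4 p hfj]
      exact le_rfl

end Guarantee

/-- The bound on the number of candidates: `⌊log₂ n⌋ ≤ 2 log n`, and the right-hand side is greater
than `1`. -/
theorem log_natLog_le {n : ℕ} (hn : 2 ≤ n) :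
    Real.log (Nat.log 2 n) ≤ Real.log (Real.log n) + Real.log 2 ∧
      0 < Real.log (Real.log n) + Real.log 2 := by
  have h2 := Real.log_two_gt_d9
  have hn' : (2 : ℝ) ≤ n := by exact_mod_cast hn
  have hl : Real.log 2 ≤ Real.log n := Real.log_le_log (by norm_num) hn'
  rw [← Real.log_mul (by linarith) (by norm_num), mul_comm]
  refine ⟨Real.log_le_log ?_ (natLog_le_two_mul_log n), Real.log_pos (by linarith)⟩
  exact_mod_cast Nat.log_pos (by norm_num) hn

end UniversalLearner


open UniversalLearner in
theorem lemma1 {X Y : Type*} [MeasurableSpace X] [MeasurableSpace Y]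
    (dom : ClassificationDomain X Y) (k : ℕ) (T : ℕ → ℕ) (hT : TimeConstructible T) :
    ∃ (l : ℕ) (A : Machine l) (R : ℕ → ℕ),
      -- on `n` samples, `A` outputs an encoded predictor within `R n` steps, and `R` is `Õ(T)`
      (∀ (n : ℕ) (S : Fin n → X × Y),
        ∃ p, A.output (dom.encodeSamples (List.ofFn S)) (R n) = some p) ∧
      (∃ d : ℕ, (fun n => (R n : ℝ)) =O[atTop] fun n => (T n : ℝ) * Real.log (T n) ^ d) ∧
      -- the output is the predictor of a truncated machine with the least holdout loss
      (∀ n : ℕ, 2 ≤ n → ∀ S : Fin n → X × Y, ∃ j, 1 ≤ j ∧ j ≤ Nat.log 2 n ∧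
        (∀ i, 1 ≤ i → i ≤ Nat.log 2 n →
          dom.holdoutLoss k j (List.ofFn S) (T n) ≤ dom.holdoutLoss k i (List.ofFn S) (T n)) ∧
        (∀ p, dom.trained k j (List.ofFn S) (T n) = some p →
          A.output (dom.encodeSamples (List.ofFn S)) (R n) = some p)) ∧
      -- the guarantee on the expected test error
      (∀ (D : Measure (X × Y)) [IsProbabilityMeasure D] (n i : ℕ), 1 ≤ i → i ≤ Nat.log 2 n →
        dom.expectedLoss k D A n (R n) (T n) ≤
          dom.expectedLoss k D (nthMachine k i) (99 * n / 100) (T n) (T n) +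
            10 * √2 * √((Real.log (Real.log n) + Real.log 2) / n)) := by
  obtain ⟨C, N, l, A, hA⟩ := exists_machine_selecting dom hT k
  set R : ℕ → ℕ := fun n =>
    stepBound k (dom.pointWidth + dom.labelWidth) N n (T n) (C * T n + C) with hR
  have hsel : ∀ n : ℕ, 2 ≤ n → ∀ S : Fin n → X × Y, ∃ j, 1 ≤ j ∧ j ≤ Nat.log 2 n ∧
      (∀ i, 1 ≤ i → i ≤ Nat.log 2 n →
        dom.holdoutLoss k j (List.ofFn S) (T n) ≤ dom.holdoutLoss k i (List.ofFn S) (T n)) ∧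
      (∀ p, dom.trained k j (List.ofFn S) (T n) = some p →
        A.output (dom.encodeSamples (List.ofFn S)) (R n) = some p) := by
    intro n hn S
    obtain ⟨p, hp, h⟩ := hA n (List.ofFn S) (List.length_ofFn)
    obtain ⟨j, hj1, hj2, hj3, rfl⟩ := h hn
    exact ⟨j, hj1, hj2, hj3, fun p hp' => by rw [hp, hp', Option.getD_some]⟩
  refine ⟨l, A, R, fun n S => ?_, ⟨3, isBigO_stepBound hT.1 k _ N C⟩, hsel, ?_⟩
  · obtain ⟨p, hp, -⟩ := hA n (List.ofFn S) (List.length_ofFn)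
    exact ⟨p, hp⟩
  · intro D _ n i hi1 hi2
    have hn : 2 ≤ n := by
      by_contra h
      rw [Nat.log_of_lt (by omega)] at hi2
      omega
    obtain ⟨hlog, hpos⟩ := log_natLog_le hn
    obtain ⟨m, hm⟩ : ∃ m, n = 99 * n / 100 + m := ⟨n - 99 * n / 100, by omega⟩
    have hm0 : 0 < m := by omega
    have hm1 : n ≤ 100 * m := by omega
    have key : dom.expectedLoss k D A n (R n) (T n) ≤
        dom.expectedLoss k D (nthMachine k i) (99 * n / 100) (T n) (T n) +
          √((Real.log (Real.log n) + Real.log 2) / (2 * m)) := by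
      have h1 := hsel n hn
      generalize R n = r at *
      generalize T n = t at *
      generalize hq : 99 * n / 100 = q at *
      generalize Real.log (Real.log n) + Real.log 2 = L at *
      generalize Nat.log 2 n = K at *
      subst hm
      exact expectedLoss_le dom D hm0 hq A r t K h1 hpos hlog hi1 hi2
    -- `1 / (2 m) ≤ 50 / n`, while the claim has room for `200 / n`
    refine key.trans (add_le_add_right ?_ _)
    have hn0 : (0 : ℝ) < n := by exact_mod_cast (by omega : 0 < n)
    have hm0' : (0 : ℝ) < m := by exact_mod_cast hm0
    have hm1' : (n : ℝ) ≤ 100 * m := by exact_mod_cast hm1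
    rw [show (10 : ℝ) * √2 = √200 by
      rw [show (200 : ℝ) = 10 ^ 2 * 2 by norm_num, Real.sqrt_mul (by positivity),
        Real.sqrt_sq (by norm_num)], ← Real.sqrt_mul (by norm_num)]
    refine Real.sqrt_le_sqrt ?_
    rw [← mul_div_assoc, div_le_div_iff₀ (by positivity) hn0]
    nlinarith
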